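/- A finite set $F$ of edges on a vertex set is $(2,3)$-sparse if for every set $X$ of at least two vertices at most $2|X|-3$ edges of $F$ have both endpoints in $X$. A (rigidity) circuit is a finite simple graph without isolated vertices whose edge set is not $(2,3)$-sparse but all of whose proper subsets of edges are $(2,3)$-sparse. A graph is $3$-connected if it has at least four vertices and remains connected after the deletion of any at most two vertices. For two distinct graphs $G_1,G_2$ with a common edge $e$, the combinatorial resultant $\mathrm{CRes}(G_1,G_2,e)$ is the graph with vertex set $V(G_1)\cup V(G_2)$ and edge set $(E(G_1)\cup E(G_2))\setminus\{e\}$. Proposition. Let $C=(V,E)$ be a $3$-connected rigidity circuit on $n+1\geq 5$ vertices. Then there are rigidity circuits $A$ and $B$ with vertices in $V$ and a common edge $e$ of $A$ and $B$ such that $A$ has exactly $n$ vertices, $B$ has at most $n$ vertices, and $C=\mathrm{CRes}(A,B,e)$. Moreover such $A$, $B$, $e$ can be found in polynomial time: there are one fixed program for a unit-cost random access machine with addition and truncated subtraction of natural numbers (and no multiplication), and one polynomial $p$ with natural number coefficients, such that for every such $C$ and every numbering of its vertices by $0,\dots,n$, the program, started on $n+1$ and the adjacency matrix of $C$, halts after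 at most $p(n+1)$ steps with the adjacency matrices of such $A$ and $B$ and the endpoints of $e$ as output. -/

import Mathlib

namespace CombRes

/-! ### Graphs, the `(2,3)`-sparsity matroid, and its circuits -/

/-- Graphs whose vertices are taken from `V`: subgraphs of the complete graph on `V`.
A graph carries its own vertex set `G.verts` and its own edge set `G.edgeSet`. -/
abbrev Graph (V : Type*) := (⊤ : SimpleGraph V).Subgraph

/-- A set `F` of edges is `(2,3)`-sparse, i.e. independent in the 2D rigidity matroid: any
`n' ≥ 2` vertices span at most `2 n' - 3` edges of `F`. -/
def IsSparse {V : Type*} (F : Set (Sym2 V)) : Prop :=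
  ∀ X : Finset V, 2 ≤ X.card → {e ∈ F | ∀ v ∈ e, v ∈ X}.ncard + 3 ≤ 2 * X.card

/-- A rigidity circuit: a graph whose edge set is a minimal dependent set of the
`(2,3)`-sparsity matroid and whose vertex set is the vertex span of its edges. -/
structure IsCircuit {V : Type*} (G : Graph V) : Prop where
  verts_eq_support : G.verts = G.support
  minimal_dependent : Minimal (fun F : Set (Sym2 V) => ¬ IsSparse F) G.edgeSet

/-- A graph is 3-connected if it has at least four vertices and stays connected whenever
at most two vertices are deleted. -/
structure IsThreeConnected {V : Type*} (G : Graph V) : Prop where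
  four_le : 4 ≤ G.verts.ncard
  connected_deleteVerts : ∀ X : Finset V, X.card ≤ 2 → (G.deleteVerts (X : Set V)).Connected

/-- `C` is the combinatorial resultant of `G₁` and `G₂` on the elimination edge `e`: the graphs
`G₁`, `G₂` are distinct, `e` is a common edge of them, the vertex set of `C` is the union of
their vertex sets, and its edge set is the union of their edge sets without `e`. -/
structure IsCombRes {V : Type*} (C G₁ G₂ : Graph V) (e : Sym2 V) : Prop where
  ne : G₁ ≠ G₂
  mem_left : e ∈ G₁.edgeSet
  mem_right : e ∈ G₂.edgeSet
  eq_resultant : C = (G₁ ⊔ G₂).deleteEdges {e}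

/-! ### Random access machines with a step count

Structured programs over a memory of natural numbers that is divided into numbered arrays
(a program mentions only finitely many of them). The only arithmetic operations are
addition and truncated subtraction, so that the length of the numbers grows by at most a
constant number of bits per step and unit cost is polynomially equivalent to Turing machine
time. -/

/-- `m a i` is the content of cell `i` of array `a`. -/
abbrev Memory := ℕ → ℕ → ℕ

/-- Arithmetic expressions: constants, array look-up, addition, truncated subtraction. -/
inductive Expr where
  | lit (c : ℕ)
  | read (a : ℕ) (i : Expr)
  | add (x y : Expr)
  | sub (x y : Expr)

/-- The value of an expression. -/
def Expr.eval (m : Memory) : Expr → ℕ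
  | .lit c => c
  | .read a i => m a (i.eval m)
  | .add x y => x.eval m + y.eval m
  | .sub x y => x.eval m - y.eval m

/-- The number of elementary operations used to evaluate an expression. -/
def Expr.cost : Expr → ℕ
  | .lit _ => 1
  | .read _ i => i.cost + 1
  | .add x y => x.cost + y.cost + 1
  | .sub x y => x.cost + y.cost + 1

/-- Programs. In tests a value counts as true if it is not zero. -/
inductive Program where
  | skip
  | write (a : ℕ) (i x : Expr)
  | seq (p q : Program)
  | cond (x : Expr) (p q : Program)
  | loop (x : Expr) (p : Program)

/-- `Exec p m t m'`: started with memory `m`, the program `p` halts after exactly `t` steps with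
memory `m'`. -/
inductive Exec : Program → Memory → ℕ → Memory → Prop where
  | skip (m : Memory) : Exec .skip m 1 m
  | write (a : ℕ) (i x : Expr) (m : Memory) :
      Exec (.write a i x) m (i.cost + x.cost + 1)
        (Function.update m a (Function.update (m a) (i.eval m) (x.eval m)))
  | seq {p q : Program} {m m' m'' : Memory} {t t' : ℕ} :
      Exec p m t m' → Exec q m' t' m'' → Exec (.seq p q) m (t + t' + 1) m''
  | cond_true {x : Expr} {p q : Program} {m m' : Memory} {t : ℕ} :
      x.eval m ≠ 0 → Exec p m t m' → Exec (.cond x p q) m (x.cost + t + 1) m'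
  | cond_false {x : Expr} {p q : Program} {m m' : Memory} {t : ℕ} :
      x.eval m = 0 → Exec q m t m' → Exec (.cond x p q) m (x.cost + t + 1) m'
  | loop_stop {x : Expr} {p : Program} {m : Memory} :
      x.eval m = 0 → Exec (.loop x p) m (x.cost + 1) m
  | loop_step {x : Expr} {p : Program} {m m' m'' : Memory} {t t' : ℕ} :
      x.eval m ≠ 0 → Exec p m t m' → Exec (.loop x p) m' t' m'' →
        Exec (.loop x p) m (x.cost + t + t' + 1) m''

/-! ### Graphs as inputs and outputs of programs -/

open Classical in
/-- The adjacency matrix, row by row, of a graph on vertices numbered `0, …, N - 1` by `num`: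
cell `num x * N + num y` is `1` if `x` and `y` are adjacent; all other cells are `0`. -/
noncomputable def adjArray {V : Type*} {N : ℕ} (num : V ≃ Fin N) (G : Graph V) (k : ℕ) : ℕ :=
  if ∃ x y : V, G.Adj x y ∧ k = (num x : ℕ) * N + (num y : ℕ) then 1 else 0

/-- The initial memory for the input `G`: the number of vertices is in cell `0` of array `0`,
the adjacency matrix is in array `1`, and all other cells are `0`. -/
noncomputable def inputMemory {V : Type*} {N : ℕ} (num : V ≃ Fin N) (G : Graph V) : Memory
  | 0, 0 => N
  | 1, k => adjArray num G k
  | _, _ => 0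

/-- The final memory `m` presents the output `(A, B, uv)`: the adjacency matrices of `A` and `B`
are in arrays `2` and `3`, and the numbers of `u` and `v` are in cells `0` and `1` of
array `4`. (Graphs without isolated vertices, such as circuits, are determined by this.) -/
structure Outputs {V : Type*} {N : ℕ} (num : V ≃ Fin N) (A B : Graph V) (u v : V)
    (m : Memory) : Prop where
  left : ∀ k < N * N, m 2 k = adjArray num A k
  right : ∀ k < N * N, m 3 k = adjArray num B k
  edge_fst : m 4 0 = (num u : ℕ)
  edge_snd : m 4 1 = (num v : ℕ)

end CombRes

set_option linter.unusedSectionVars false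

namespace CombRes

/-! Count every edge twice. A circuit on `N` vertices then has count `4N - 4`, while a proper set
`X` of at least two vertices has count at most `4|X| - 6`; `X` is tight if equality holds. The count
is supermodular, so two tight sets that share two vertices and do not cover the graph have tight
union and intersection, with no edge between their differences (`CircuitCount.union_inter`).

Let `v` have degree three. If `V - v` is the only tight set that avoids `v` and contains its
neighbours `a`, `b`, then `A = C - v + ab` is a circuit. Such an admissible triple exists by
`CircuitCount.exists_admissible`, the combinatorial core and the only place where 3-connectedness
enters. Without one, every vertex of degree three is surrounded by three tight sets, each omitting
one neighbour. Uncrossing them shows that all vertices outside of a tight set have degree three, and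
then that all vertices do, which forces `N = 4`.

A degree count also yields a vertex `w` of degree three that is neither `v` nor a neighbour of `v`
(`CircuitCount.exists_decompositionVertices`). As `V - w` is tight, there is a least tight set `T`
that contains `a`, `b` and avoids `w`, and `B = C[T] + ab` is a circuit on at most `N - 1` vertices.
Admissibility forces `v` and all its neighbours into `T`. Hence `B` supplies the three edges at `v`,
`A` supplies all other edges, and `C` is the resultant of `A` and `B` on `ab`.

For the algorithm, all quadruples `v, a, b, w` are tried. The least tight set is found vertex by
vertex: `z` belongs to it exactly if, after the deletion of the avoided vertex and of `z`, the edges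
can be distributed to their endpoints with at most two at each vertex and none at `a` and `b`
(`CircuitCount.spanSet_eq`). A push-relabel method with a fixed number of rounds decides this
(`AfterRounds.load_le_iff`). The program is written in a language of bounded loops, where a
polynomial time bound can be read off from the syntax (`Stmt.exec_compile`). -/

/-! ### A language of bounded loops -/

/-- The memory `m` with cell `i` of array `a` set to `v`. -/
def setCell (m : Memory) (a i v : ℕ) : Memory :=
  Function.update m a (Function.update (m a) i v)

theorem setCell_apply (m : Memory) (a i v b j : ℕ) :
    setCell m a i v b j = if b = a ∧ j = i then v else m b j := by
  unfold setCell
  by_cases hb : b = a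
  · subst hb
    by_cases hj : j = i <;> simp [hj]
  · simp [hb]

theorem setCell_of_ne (m : Memory) {a b : ℕ} (i v : ℕ) (h : b ≠ a) : setCell m a i v b = m b := by
  simp [setCell, h]

/-- Programs all of whose loops run a counter, cell `0` of an array, through all numbers less than
the content of cell `0` of array `0`. -/
inductive Stmt where
  | skip
  | write (a : ℕ) (i x : Expr)
  | seq (p q : Stmt)
  | cond (x : Expr) (p q : Stmt)
  | loop (a : ℕ) (p : Stmt)

namespace Stmt

/-- Translation to random access machine programs. -/
def compile : Stmt → Program
  | skip => .skip
  | write a i x => .write a i x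
  | seq p q => .seq p.compile q.compile
  | cond x p q => .cond x p.compile q.compile
  | loop a p => .seq (.write a (.lit 0) (.lit 0))
      (.loop (.sub (.read 0 (.lit 0)) (.read a (.lit 0)))
        (.seq p.compile (.write a (.lit 0) (.add (.read a (.lit 0)) (.lit 1)))))

/-- The memory after the execution of a statement. -/
def den : Stmt → Memory → Memory
  | skip => id
  | write a i x => fun m => setCell m a (i.eval m) (x.eval m)
  | seq p q => fun m => q.den (p.den m)
  | cond x p q => fun m => if x.eval m ≠ 0 then p.den m else q.den m
  | loop a p => fun m =>
      (fun m' => setCell (p.den m') a 0 (p.den m' a 0 + 1))^[m 0 0] (setCell m a 0 0)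

/-- The arrays that a statement may change. -/
def writes : Stmt → List ℕ
  | skip => []
  | write a _ _ => [a]
  | seq p q => p.writes ++ q.writes
  | cond _ p q => p.writes ++ q.writes
  | loop a p => a :: p.writes

/-- No statement changes array `0`, and no loop body changes its own counter. -/
def wf : Stmt → Bool
  | skip => true
  | write a _ _ => a != 0
  | seq p q => p.wf && q.wf
  | cond _ p q => p.wf && q.wf
  | loop a p => a != 0 && !p.writes.contains a && p.wf

/-- A bound for the number of steps, as a polynomial in the number of iterations of the loops. -/
noncomputable def cost : Stmt → Polynomial ℕ
  | skip => 1
  | write _ i x => Polynomial.C (i.cost + x.cost + 1)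
  | seq p q => p.cost + q.cost + 1
  | cond x p q => Polynomial.C x.cost + (p.cost + q.cost) + 1
  | loop _ p => Polynomial.X * (p.cost + 14) + 14

theorem den_seq (p q : Stmt) (m : Memory) : (seq p q).den m = q.den (p.den m) := rfl

theorem den_write (a : ℕ) (i x : Expr) (m : Memory) :
    (write a i x).den m = setCell m a (i.eval m) (x.eval m) := rfl

theorem den_cond_pos {x : Expr} {p q : Stmt} {m : Memory} (h : x.eval m ≠ 0) :
    (cond x p q).den m = p.den m := if_pos h

theorem den_cond_neg {x : Expr} {p q : Stmt} {m : Memory} (h : ¬ x.eval m ≠ 0) :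
    (cond x p q).den m = q.den m := if_neg h

/-- The frame rule: it reduces all non-interference between parts of a program to membership in a
concrete list, which `decide` settles. -/
theorem den_frame (s : Stmt) (m : Memory) {k : ℕ} (hk : k ∉ s.writes) : s.den m k = m k := by
  induction s generalizing m with
  | skip => rfl
  | write a i x => exact setCell_of_ne _ _ _ (by simpa [writes] using hk)
  | seq p q ihp ihq =>
    simp only [writes, List.mem_append, not_or] at hk
    simp only [den, ihq _ hk.2, ihp _ hk.1]
  | cond x p q ihp ihq =>
    simp only [writes, List.mem_append, not_or] at hk
    simp only [den]
    split_ifs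
    · exact ihp _ hk.1
    · exact ihq _ hk.2
  | loop a p ih =>
    simp only [writes, List.mem_cons, not_or] at hk
    simp only [den]
    have : ∀ (r : ℕ) (m' : Memory),
        ((fun m' => setCell (p.den m') a 0 (p.den m' a 0 + 1))^[r] m') k = m' k := by
      intro r
      induction r with
      | zero => intro m'; rfl
      | succ r ihr =>
        intro m'
        rw [Function.iterate_succ_apply, ihr, setCell_of_ne _ _ _ hk.1, ih _ hk.2]
    rw [this, setCell_of_ne _ _ _ hk.1]

theorem zero_notMem_writes {s : Stmt} (hs : s.wf) : 0 ∉ s.writes := by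
  induction s with
  | skip => simp [writes]
  | write a i x =>
    simp only [wf, bne_iff_ne, ne_eq] at hs
    simp only [writes, List.mem_singleton]
    exact fun h => hs h.symm
  | seq p q ihp ihq =>
    simp only [wf, Bool.and_eq_true] at hs
    simp [writes, ihp hs.1, ihq hs.2]
  | cond x p q ihp ihq =>
    simp only [wf, Bool.and_eq_true] at hs
    simp [writes, ihp hs.1, ihq hs.2]
  | loop a p ih =>
    simp only [wf, Bool.and_eq_true, bne_iff_ne, ne_eq] at hs
    simp only [writes, List.mem_cons, not_or]
    exact ⟨fun h => hs.1.1 h.symm, ih hs.2⟩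

theorem den_zero {s : Stmt} (hs : s.wf) (m : Memory) : s.den m 0 = m 0 :=
  den_frame s m (zero_notMem_writes hs)

theorem wf_loop {a : ℕ} {p : Stmt} (h : (loop a p).wf) : a ≠ 0 ∧ a ∉ p.writes ∧ p.wf := by
  simpa [wf, and_assoc] using h

/-- Besides the body, a round costs 5 for the guard, 6 for the increment of the counter and 2 for
the sequencing and the loop itself, rounded up to 14. The failing last test costs 6. -/
theorem exec_loop {a : ℕ} {p : Stmt} (hs : (loop a p).wf) {c : ℕ} {N : ℕ}
    (hp : ∀ m : Memory, m 0 0 = N → ∃ t ≤ c, Exec p.compile m t (p.den m)) (r : ℕ) :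
    ∀ m : Memory, m 0 0 = N → m a 0 + r = N →
      ∃ t ≤ r * (c + 14) + 6,
        Exec (.loop (.sub (.read 0 (.lit 0)) (.read a (.lit 0)))
          (.seq p.compile (.write a (.lit 0) (.add (.read a (.lit 0)) (.lit 1))))) m t
          ((fun m' => setCell (p.den m') a 0 (p.den m' a 0 + 1))^[r] m) := by
  obtain ⟨ha, hap, hwf⟩ := wf_loop hs
  induction r with
  | zero =>
    intro m hm hr
    refine ⟨_, ?_, Exec.loop_stop (by simp [Expr.eval]; omega)⟩
    simp [Expr.cost]
  | succ r ih =>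
    intro m hm hr
    obtain ⟨t, ht, hexec⟩ := hp m hm
    have hN : (p.den m) 0 0 = N := by rw [den_zero hwf, hm]
    have hA : (p.den m) a 0 = m a 0 := by rw [den_frame p m hap]
    obtain ⟨t', ht', hexec'⟩ := ih (setCell (p.den m) a 0 (p.den m a 0 + 1))
      (by rw [setCell_apply, if_neg (fun h => ha h.1.symm), hN])
      (by rw [setCell_apply, if_pos ⟨rfl, rfl⟩, hA]; omega)
    have hw := Exec.write a (.lit 0) (.add (.read a (.lit 0)) (.lit 1)) (p.den m)
    refine ⟨_, ?_, Exec.loop_step (t' := t') (by simp [Expr.eval]; omega) (Exec.seq hexec hw) ?_⟩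
    · simp only [Expr.cost]
      have : (r + 1) * (c + 14) = r * (c + 14) + (c + 14) := by ring
      omega
    · rw [Function.iterate_succ_apply]
      exact hexec'

/-- Array `0` is never written, so every loop at every depth makes the same number of rounds.
Nesting therefore multiplies the cost by the variable of the polynomial. -/
theorem exec_compile (s : Stmt) (hs : s.wf) (m : Memory) :
    ∃ t ≤ s.cost.eval (m 0 0), Exec s.compile m t (s.den m) := by
  suffices h : ∀ N (m : Memory), m 0 0 = N → ∃ t ≤ s.cost.eval N, Exec s.compile m t (s.den m) from
    h _ m rfl
  intro N
  clear m
  induction s with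
  | skip => exact fun m _ => ⟨1, by simp [cost], Exec.skip m⟩
  | write a i x => exact fun m _ => ⟨_, by simp [cost], Exec.write a i x m⟩
  | seq p q ihp ihq =>
    intro m hm
    simp only [wf, Bool.and_eq_true] at hs
    obtain ⟨t, ht, h⟩ := ihp hs.1 m hm
    obtain ⟨t', ht', h'⟩ := ihq hs.2 (p.den m) (by rw [den_zero hs.1, hm])
    refine ⟨_, ?_, Exec.seq h h'⟩
    simp only [cost, Polynomial.eval_add, Polynomial.eval_one]
    omega
  | cond x p q ihp ihq =>
    intro m hm
    simp only [wf, Bool.and_eq_true] at hs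
    obtain ⟨t, ht, h⟩ := ihp hs.1 m hm
    obtain ⟨t', ht', h'⟩ := ihq hs.2 m hm
    by_cases hx : x.eval m = 0
    · refine ⟨x.cost + t' + 1, ?_, ?_⟩
      · simp only [cost, Polynomial.eval_add, Polynomial.eval_one, Polynomial.eval_C]
        omega
      · simpa [den, compile, hx] using Exec.cond_false hx h'
    · refine ⟨x.cost + t + 1, ?_, ?_⟩
      · simp only [cost, Polynomial.eval_add, Polynomial.eval_one, Polynomial.eval_C]
        omega
      · simpa [den, compile, hx] using Exec.cond_true hx h
  | loop a p ih =>
    intro m hm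
    have hwf := wf_loop hs
    obtain ⟨t, ht, h⟩ := exec_loop hs (c := p.cost.eval N) (fun m hm => ih hwf.2.2 m hm) N
      (setCell m a 0 0) (by rw [setCell_apply, if_neg (fun h => hwf.1 h.1.symm), hm])
      (by simp [setCell_apply])
    refine ⟨_, ?_, Exec.seq (t' := t) (Exec.write a (.lit 0) (.lit 0) m) ?_⟩
    · simp only [cost, Polynomial.eval_add, Polynomial.eval_mul, Polynomial.eval_X,
        Polynomial.eval_ofNat, Expr.cost]
      omega
    · simp only [den, hm]
      exact h

/-- The invariant rule for loops. -/
theorem den_loop {a : ℕ} {p : Stmt} {m : Memory} (hs : (loop a p).wf) (I : ℕ → Memory → Prop)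
    (h0 : I 0 (setCell m a 0 0))
    (hstep : ∀ i m', i < m 0 0 → I i m' → m' a 0 = i →
      (∀ k, k ∉ (loop a p).writes → m' k = m k) → I (i + 1) (setCell (p.den m') a 0 (i + 1))) :
    I (m 0 0) ((loop a p).den m) := by
  obtain ⟨ha, hap, hwf⟩ := wf_loop hs
  -- The invariant is carried together with the value of the counter and the frame condition, which
  -- `hstep` may use.
  have key : ∀ i, i ≤ m 0 0 →
      I i ((fun m' => setCell (p.den m') a 0 (p.den m' a 0 + 1))^[i] (setCell m a 0 0)) ∧
      ((fun m' => setCell (p.den m') a 0 (p.den m' a 0 + 1))^[i] (setCell m a 0 0)) a 0 = i ∧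
      ∀ k, k ∉ (loop a p).writes →
        ((fun m' => setCell (p.den m') a 0 (p.den m' a 0 + 1))^[i] (setCell m a 0 0)) k = m k := by
    intro i
    induction i with
    | zero =>
      refine fun _ => ⟨h0, by simp [setCell_apply], fun k hk => ?_⟩
      simp only [writes, List.mem_cons, not_or] at hk
      exact setCell_of_ne _ _ _ hk.1
    | succ i ih =>
      intro hi
      obtain ⟨h1, h2, h3⟩ := ih (by omega)
      rw [Function.iterate_succ_apply']
      set m' := (fun m' => setCell (p.den m') a 0 (p.den m' a 0 + 1))^[i] (setCell m a 0 0)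
      have hA : p.den m' a 0 = i := by rw [den_frame p m' hap, h2]
      rw [hA]
      refine ⟨hstep i m' (by omega) h1 h2 h3, by simp [setCell_apply], fun k hk => ?_⟩
      rw [← h3 k hk]
      simp only [writes, List.mem_cons, not_or] at hk
      rw [setCell_of_ne _ _ _ hk.1, den_frame p m' hk.2]
  exact (key _ le_rfl).1

/-- The rule for loops that merely repeat their body. -/
theorem den_loop_repeat {a : ℕ} {p : Stmt} (hs : (loop a p).wf) {N c : ℕ} (J : ℕ → Memory → Prop)
    (hset : ∀ k m v, J k m → J k (setCell m a 0 v))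
    (hstep : ∀ k (m : Memory), m 0 0 = N → J k m → J (k + c) (p.den m)) {k : ℕ} {m : Memory}
    (hN : m 0 0 = N) (h : J k m) : J (k + N * c) ((loop a p).den m) := by
  have := den_loop (m := m) hs (fun i m' => J (k + i * c) m') (by simpa using hset _ _ _ h) ?_
  · rwa [hN] at this
  · intro i m' hi hI _ hfr
    refine hset _ _ _ ?_
    have h0 := hfr 0 (zero_notMem_writes hs)
    have := hstep _ m' (by rw [h0, hN]) hI
    rwa [show k + (i + 1) * c = k + i * c + c by ring]

end Stmt

/-! ### Tests -/

namespace Expr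

/-- The variable kept in cell `0` of array `a`. -/
def var (a : ℕ) : Expr := .read a (.lit 0)

/-- Negation of a test. -/
def not (x : Expr) : Expr := .sub (.lit 1) x

/-- Conjunction of tests. -/
def and (x y : Expr) : Expr := .sub (.lit 1) (.add x.not y.not)

/-- The test `x < y`. -/
def lt (x y : Expr) : Expr := .sub y x

/-- The test `x ≠ y`. -/
def ne (x y : Expr) : Expr := .add (.sub x y) (.sub y x)

@[simp] theorem eval_var (m : Memory) (a : ℕ) : (var a).eval m = m a 0 := rfl

@[simp] theorem eval_lit (m : Memory) (c : ℕ) : (lit c).eval m = c := rfl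

@[simp] theorem eval_read (m : Memory) (a : ℕ) (i : Expr) : (read a i).eval m = m a (i.eval m) := rfl

@[simp] theorem eval_add (m : Memory) (x y : Expr) : (add x y).eval m = x.eval m + y.eval m := rfl

@[simp] theorem eval_sub (m : Memory) (x y : Expr) : (sub x y).eval m = x.eval m - y.eval m := rfl

@[simp] theorem eval_not (m : Memory) (x : Expr) : x.not.eval m = 0 ↔ x.eval m ≠ 0 := by
  simp [not]; omega

@[simp] theorem eval_and (m : Memory) (x y : Expr) :
    (x.and y).eval m = 0 ↔ ¬ (x.eval m ≠ 0 ∧ y.eval m ≠ 0) := by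
  simp [and, not]; omega

@[simp] theorem eval_lt (m : Memory) (x y : Expr) :
    (lt x y).eval m = 0 ↔ ¬ (x.eval m < y.eval m) := by
  simp [lt]; omega

@[simp] theorem eval_ne (m : Memory) (x y : Expr) : (ne x y).eval m = 0 ↔ x.eval m = y.eval m := by
  simp [ne]; omega

end Expr

/-! ### Counting edges -/

section Counting

variable {V : Type*} [Fintype V] [DecidableEq V] (C : Graph V)

open Classical in
/-- The entries of the adjacency matrix. -/
noncomputable def adjInd (x y : V) : ℤ := if C.Adj x y then 1 else 0

/-- The number of pairs of adjacent vertices in `X ×ˢ Y`. -/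
noncomputable def between (X Y : Finset V) : ℤ := ∑ x ∈ X, ∑ y ∈ Y, adjInd C x y

/-- Twice the number of edges with both endpoints in `X`. -/
noncomputable def inner (X : Finset V) : ℤ := between C X X

/-- The degree of a vertex. -/
noncomputable def deg (x : V) : ℤ := between C {x} Finset.univ

open Classical in
/-- The set of neighbours of a vertex. -/
noncomputable def nbrs (x : V) : Finset V := Finset.univ.filter (C.Adj x)

theorem mem_nbrs {x y : V} : y ∈ nbrs C x ↔ C.Adj x y := by simp [nbrs]

theorem adjInd_comm (x y : V) : adjInd C x y = adjInd C y x := by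
  by_cases h : C.Adj x y
  · rw [adjInd, adjInd, if_pos h, if_pos h.symm]
  · rw [adjInd, adjInd, if_neg h, if_neg fun h' => h h'.symm]

theorem adjInd_self (x : V) : adjInd C x x = 0 :=
  if_neg fun h => h.ne rfl

variable {C} in
theorem adjInd_of_adj {x y : V} (h : C.Adj x y) : adjInd C x y = 1 := if_pos h

variable {C} in
theorem adjInd_of_not_adj {x y : V} (h : ¬ C.Adj x y) : adjInd C x y = 0 := if_neg h

theorem adjInd_nonneg (x y : V) : 0 ≤ adjInd C x y := by
  unfold adjInd; split_ifs <;> simp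

theorem between_comm (X Y : Finset V) : between C X Y = between C Y X := by
  unfold between
  rw [Finset.sum_comm]
  simp only [adjInd_comm C]

theorem between_nonneg (X Y : Finset V) : 0 ≤ between C X Y :=
  Finset.sum_nonneg fun _ _ => Finset.sum_nonneg fun _ _ => adjInd_nonneg C _ _

theorem between_union_left {X Y : Finset V} (h : Disjoint X Y) (Z : Finset V) :
    between C (X ∪ Y) Z = between C X Z + between C Y Z :=
  Finset.sum_union h

theorem between_union_right (Z : Finset V) {X Y : Finset V} (h : Disjoint X Y) :
    between C Z (X ∪ Y) = between C Z X + between C Z Y := by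
  rw [between_comm, between_union_left C h, between_comm C X, between_comm C Y]

theorem between_mono_right (X : Finset V) {Y Z : Finset V} (h : Y ⊆ Z) :
    between C X Y ≤ between C X Z :=
  Finset.sum_le_sum fun _ _ =>
    Finset.sum_le_sum_of_subset_of_nonneg h fun _ _ _ => adjInd_nonneg C _ _

theorem between_mono_left {X Y : Finset V} (h : X ⊆ Y) (Z : Finset V) :
    between C X Z ≤ between C Y Z := by
  rw [between_comm C X, between_comm C Y]
  exact between_mono_right C Z h

theorem inner_mono {X Y : Finset V} (h : X ⊆ Y) : inner C X ≤ inner C Y :=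
  (between_mono_left C h X).trans (between_mono_right C Y h)

theorem between_eq_zero {X Y : Finset V} (h : ∀ x ∈ X, ∀ y ∈ Y, ¬ C.Adj x y) :
    between C X Y = 0 :=
  Finset.sum_eq_zero fun x hx => Finset.sum_eq_zero fun y hy => by simp [adjInd, h x hx y hy]

theorem not_adj_of_between_eq_zero {X Y : Finset V} (h : between C X Y = 0) {x y : V} (hx : x ∈ X)
    (hy : y ∈ Y) : ¬ C.Adj x y := by
  intro hxy
  have h1 : between C {x} {y} = 1 := by
    simp only [between, Finset.sum_singleton, adjInd, if_pos hxy]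
  have h2 := between_mono_left C (Finset.singleton_subset_iff.2 hx) {y}
  have h3 := between_mono_right C X (Finset.singleton_subset_iff.2 hy)
  omega

theorem between_singleton (x : V) (X : Finset V) : between C {x} X = (nbrs C x ∩ X).card := by
  classical
  simp only [between, Finset.sum_singleton, adjInd, Finset.sum_boole]
  congr 2
  ext y
  simp [mem_nbrs, and_comm]

theorem deg_eq_card (x : V) : deg C x = (nbrs C x).card := by
  simp [deg, between_singleton]

theorem between_univ (X : Finset V) : between C X Finset.univ = ∑ x ∈ X, deg C x := by
  simp [deg, between]

theorem inner_empty : inner C ∅ = 0 := by simp [inner, between]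

theorem inner_singleton (x : V) : inner C {x} = 0 := by simp [inner, between, adjInd_self]

theorem inner_union {X Y : Finset V} (h : Disjoint X Y) :
    inner C (X ∪ Y) = inner C X + inner C Y + 2 * between C X Y := by
  unfold inner
  rw [between_union_left C h, between_union_right C _ h, between_union_right C _ h,
    between_comm C Y X]
  ring

theorem inner_insert {x : V} {X : Finset V} (h : x ∉ X) :
    inner C (insert x X) = inner C X + 2 * between C {x} X := by
  rw [Finset.insert_eq, inner_union C (Finset.disjoint_singleton_left.2 h), inner_singleton]
  ring

/-- Parity sharpens the bound for sets that are not tight from `4|X| - 7` to `4|X| - 8`. -/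
theorem even_inner (X : Finset V) : Even (inner C X) := by
  induction X using Finset.induction_on with
  | empty => simp [inner_empty]
  | insert x X hx ih =>
    rw [inner_insert C hx]
    exact ih.add (even_two_mul _)

/-- Supermodularity with its exact defect: only the edges between the two differences are missed by
both sets. -/
theorem inner_union_add_inner_inter (X Y : Finset V) :
    inner C (X ∪ Y) + inner C (X ∩ Y) =
      inner C X + inner C Y + 2 * between C (X \ Y) (Y \ X) := by
  have hX : X = (X \ Y) ∪ (X ∩ Y) := (Finset.sdiff_union_inter X Y).symm
  have hY : Y = (Y \ X) ∪ (X ∩ Y) := by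
    rw [Finset.inter_comm]; exact (Finset.sdiff_union_inter Y X).symm
  have hU : X ∪ Y = (X \ Y) ∪ ((Y \ X) ∪ (X ∩ Y)) := by
    ext v; simp only [Finset.mem_union, Finset.mem_sdiff, Finset.mem_inter]; tauto
  have d1 : Disjoint (X \ Y) (X ∩ Y) := Finset.disjoint_sdiff_inter X Y
  have d2 : Disjoint (Y \ X) (X ∩ Y) := by
    rw [Finset.inter_comm]; exact Finset.disjoint_sdiff_inter Y X
  have d3 : Disjoint (X \ Y) (Y \ X) := disjoint_sdiff_sdiff
  have e1 := inner_union C d1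
  have e2 := inner_union C d2
  have e3 := inner_union C (Finset.disjoint_union_right.2 ⟨d3, d1⟩)
  rw [← hX] at e1
  rw [← hY] at e2
  rw [← hU, inner_union C d2, between_union_right C _ d2.symm.symm] at e3
  omega

theorem inner_pair {x y : V} (hxy : C.Adj x y) : inner C {x, y} = 2 := by
  rw [inner_insert C (by simpa using hxy.ne), inner_singleton]
  simp only [between, Finset.sum_singleton, adjInd, if_pos hxy]
  norm_num

/-- Removing `S` from the graph. -/
theorem inner_compl (S : Finset V) :
    inner C Sᶜ = inner C Finset.univ - 2 * (∑ x ∈ S, deg C x) + inner C S := by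
  have h : S ∪ Sᶜ = Finset.univ := Finset.union_compl S
  have h1 := inner_union C (disjoint_compl_right (a := S))
  have h2 := between_union_right C S (disjoint_compl_right (a := S))
  rw [h] at h1 h2
  rw [between_univ] at h2
  unfold inner at *
  omega

end Counting

/-! ### Counting form of circuits, and tight sets -/

section Circuits

variable {V : Type*} [Fintype V] [DecidableEq V] {C : Graph V}

/-- A circuit with vertex set `V` in terms of edge counts. -/
structure CircuitCount (C : Graph V) : Prop where
  total : inner C Finset.univ = 4 * Fintype.card V - 4
  sparse : ∀ X : Finset V, X ≠ Finset.univ → 2 ≤ X.card → inner C X ≤ 4 * X.card - 6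

/-- A proper subset of the vertices that spans as many edges as possible. -/
structure Tight (C : Graph V) (X : Finset V) : Prop where
  two_le : 2 ≤ X.card
  ne_univ : X ≠ Finset.univ
  inner_eq : inner C X = 4 * X.card - 6

theorem ne_univ_of_notMem {X : Finset V} {x : V} (h : x ∉ X) : X ≠ Finset.univ := by
  rintro rfl
  exact h (Finset.mem_univ x)

namespace CircuitCount

variable (hC : CircuitCount C)

include hC

theorem inner_le_of_nonempty {X : Finset V} (hX : X ≠ Finset.univ) (h : X.Nonempty) :
    inner C X ≤ 4 * X.card - 4 := by
  rcases (Nat.lt_or_ge 1 X.card) with h1 | h1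
  · have := hC.sparse X hX h1
    omega
  · obtain ⟨x, rfl⟩ := Finset.card_eq_one.1 (le_antisymm h1 h.card_pos)
    simp [inner_singleton]

theorem inner_le_of_not_tight {X : Finset V} (hX : X ≠ Finset.univ) (h : 2 ≤ X.card)
    (ht : ¬ Tight C X) : inner C X ≤ 4 * X.card - 8 := by
  have h1 := hC.sparse X hX h
  have h2 : inner C X ≠ 4 * X.card - 6 := fun h3 => ht ⟨h, hX, h3⟩
  obtain ⟨k, hk⟩ := even_inner C X
  omega

theorem tight_of_le {X : Finset V} (hX : X ≠ Finset.univ) (h : 2 ≤ X.card)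
    (hi : 4 * (X.card : ℤ) - 6 ≤ inner C X) : Tight C X :=
  ⟨h, hX, le_antisymm (hC.sparse X hX h) hi⟩

/-- Uncrossing: `4|X| - 6` is modular, so supermodularity turns the sparsity bounds for union and
intersection into equalities and leaves no room for edges between the differences. -/
theorem union_inter {X Y : Finset V} (hX : Tight C X) (hY : Tight C Y) (hXY : 2 ≤ (X ∩ Y).card)
    (hu : X ∪ Y ≠ Finset.univ) :
    Tight C (X ∪ Y) ∧ Tight C (X ∩ Y) ∧ between C (X \ Y) (Y \ X) = 0 := by
  have h1 := inner_union_add_inner_inter C X Y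
  have h2 := Finset.card_union_add_card_inter X Y
  have h3 : (X ∩ Y).card ≤ (X ∪ Y).card :=
    Finset.card_le_card (Finset.inter_subset_left.trans Finset.subset_union_left)
  have hi : X ∩ Y ≠ Finset.univ := by
    intro h
    apply hX.ne_univ
    rw [Finset.eq_univ_iff_forall] at h ⊢
    exact fun x => (Finset.mem_inter.1 (h x)).1
  have h4 := hC.sparse _ hu (by omega)
  have h5 := hC.sparse _ hi hXY
  have h6 := hX.inner_eq
  have h7 := hY.inner_eq
  have h8 := between_nonneg C (X \ Y) (Y \ X)
  exact ⟨⟨by omega, hu, by omega⟩, ⟨hXY, hi, by omega⟩, by omega⟩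

/-- Removing a vertex isolated in `X` would keep the count but lower the bound by 4. -/
theorem exists_adj_of_tight {X : Finset V} (hX : Tight C X) {x : V} (hx : x ∈ X) :
    ∃ y ∈ X, C.Adj x y := by
  by_contra! h
  have h1 := inner_insert C (Finset.notMem_erase x X)
  rw [Finset.insert_erase hx, between_eq_zero C (by
    intro a ha b hb
    rw [Finset.mem_singleton.1 ha]
    exact h b (Finset.mem_of_mem_erase hb))] at h1
  have h2 := Finset.card_erase_of_mem hx
  have h3 := hX.two_le
  have h4 := hX.inner_eq
  have h5 := hC.inner_le_of_nonempty (ne_univ_of_notMem (Finset.notMem_erase x X))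
    (Finset.card_pos.1 (by omega))
  obtain h6 | h6 := Nat.lt_or_ge 2 X.card
  · have := hC.sparse _ (ne_univ_of_notMem (Finset.notMem_erase x X)) (by omega)
    omega
  · obtain ⟨z, hz⟩ := Finset.card_eq_one.1 (show (X.erase x).card = 1 by omega)
    rw [hz, inner_singleton] at h1
    omega

theorem sum_deg : ∑ x, deg C x = 4 * Fintype.card V - 4 := by
  rw [← hC.total, inner, between_univ]

theorem inner_compl_eq (S : Finset V) :
    inner C Sᶜ = 4 * (Sᶜ.card : ℤ) + 4 * S.card - 4 - 2 * (∑ x ∈ S, deg C x) + inner C S := by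
  have := Finset.card_add_card_compl S
  rw [inner_compl, hC.total]
  omega

/-- The remaining vertices would otherwise span too many edges. -/
theorem three_le_deg (hV : 3 ≤ Fintype.card V) (x : V) : 3 ≤ deg C x := by
  have h1 := hC.inner_compl_eq {x}
  have h2 := Finset.card_add_card_compl ({x} : Finset V)
  have h3 := hC.sparse ({x}ᶜ) (ne_univ_of_notMem (x := x) (by simp))
  simp only [Finset.card_singleton, Finset.sum_singleton, inner_singleton] at *
  have := h3 (by omega)
  omega

theorem tight_compl_of_deg (hV : 3 ≤ Fintype.card V) {x : V} (hx : deg C x = 3) :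
    Tight C {x}ᶜ := by
  have h1 := hC.inner_compl_eq {x}
  have h2 := Finset.card_add_card_compl ({x} : Finset V)
  simp only [Finset.card_singleton, Finset.sum_singleton, inner_singleton] at *
  exact ⟨by omega, ne_univ_of_notMem (x := x) (by simp), by omega⟩

/-- A tight set that contains all neighbours of an outside vertex of degree three consists of all
other vertices. -/
theorem eq_compl_of_nbrs_subset {X : Finset V} (hX : Tight C X) {x : V} (hx : x ∉ X)
    (hd : deg C x = 3) (h : nbrs C x ⊆ X) : X = {x}ᶜ := by
  have h1 := inner_insert C hx
  rw [between_singleton, Finset.inter_eq_left.2 h, ← deg_eq_card, hd, hX.inner_eq] at h1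
  have h2 := Finset.card_insert_of_notMem hx
  have h3 : insert x X = Finset.univ := by
    by_contra h4
    have := hC.sparse _ h4 (by have := hX.two_le; omega)
    omega
  ext y
  have h4 := Finset.mem_univ y
  rw [← h3, Finset.mem_insert] at h4
  simp only [Finset.mem_compl, Finset.mem_singleton]
  constructor
  · rintro hy rfl
    exact hx hy
  · tauto

end CircuitCount

end Circuits

/-! ### Existence of an admissible vertex of degree three -/

section Admissible

variable {V : Type*} [Fintype V] [DecidableEq V] {C : Graph V}

/-- No set of at most two vertices separates the graph. -/
def NoSeparation (C : Graph V) : Prop :=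
  ∀ S P : Finset V, S.card ≤ 2 → Disjoint P S → P.Nonempty → P ∪ S ≠ Finset.univ →
    ∃ p ∈ P, ∃ q, q ∉ P ∪ S ∧ C.Adj p q

/-- The deletion of `y` and the addition of the edge `s(a, b)` creates no dependent proper
subgraph. -/
def Admissible (C : Graph V) (y a b : V) : Prop :=
  ∀ X : Finset V, Tight C X → y ∉ X → a ∈ X → b ∈ X → X = {y}ᶜ

namespace CircuitCount

variable (hC : CircuitCount C)

include hC

theorem union_eq_compl {X Y : Finset V} {y : V} (hd : deg C y = 3) (hX : Tight C X)
    (hY : Tight C Y) (hyX : y ∉ X) (hyY : y ∉ Y) (hN : nbrs C y ⊆ X ∪ Y)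
    (hXY : 2 ≤ (X ∩ Y).card) : X ∪ Y = {y}ᶜ ∧ between C (X \ Y) (Y \ X) = 0 := by
  have hy : y ∉ X ∪ Y := by simp [hyX, hyY]
  obtain ⟨h1, -, h2⟩ := hC.union_inter hX hY hXY (ne_univ_of_notMem hy)
  exact ⟨hC.eq_compl_of_nbrs_subset h1 hy hd hN, h2⟩

/-- The vertex `u` has a neighbour in the tight set `Z`. No edge leads from `X \ Y` to `Y \ X`, so
this neighbour lies in `X` as well. -/
theorem two_le_card_inter {X Y Z : Finset V} {y u : V} (hu : X ∪ Y = {y}ᶜ)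
    (hb : between C (X \ Y) (Y \ X) = 0) (hZ : Tight C Z) (hy : y ∉ Z) (huZ : u ∈ Z) (huX : u ∈ X)
    (huY : u ∉ Y) : 2 ≤ (X ∩ Z).card := by
  obtain ⟨v, hvZ, huv⟩ := hC.exists_adj_of_tight hZ huZ
  have hvX : v ∈ X := by
    by_contra hvX
    have hv : v ∈ X ∪ Y := by
      rw [hu, Finset.mem_compl, Finset.mem_singleton]
      rintro rfl
      exact hy hvZ
    exact not_adj_of_between_eq_zero C hb (Finset.mem_sdiff.2 ⟨huX, huY⟩)
      (Finset.mem_sdiff.2 ⟨(Finset.mem_union.1 hv).resolve_left hvX, hvX⟩) huv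
  exact Finset.one_lt_card.2 ⟨u, Finset.mem_inter.2 ⟨huX, huZ⟩, v, Finset.mem_inter.2 ⟨hvX, hvZ⟩,
    huv.ne⟩

/-- Three tight sets, hinged pairwise at single vertices, have a tight union: the three hinges
account for `4 * 3`, which cancels two of the three defects of 6. The union contains all neighbours
of `y`, so it is everything else, and no edge leaves `X₃` except at its two hinges. These would
separate any further vertex of `X₃`. -/
theorem hinged_triangle (hsep : NoSeparation C) {X₁ X₂ X₃ : Finset V} {y u₁ u₂ u₃ : V}
    (hd : deg C y = 3) (hN : nbrs C y = {u₁, u₂, u₃}) (h12 : u₁ ≠ u₂)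
    (hX₁ : Tight C X₁) (hX₂ : Tight C X₂) (hX₃ : Tight C X₃) (hy₁ : y ∉ X₁) (hy₂ : y ∉ X₂)
    (hy₃ : y ∉ X₃) (hi₁ : X₂ ∩ X₃ = {u₁}) (hi₂ : X₁ ∩ X₃ = {u₂}) (hi₃ : X₁ ∩ X₂ = {u₃})
    (h3 : u₃ ∉ X₃) : X₁ ∪ X₂ ∪ X₃ = {y}ᶜ ∧ X₃ ⊆ {u₁, u₂} := by
  have a1 : u₁ ∈ X₂ ∩ X₃ := by simp [hi₁]
  have a2 : u₂ ∈ X₁ ∩ X₃ := by simp [hi₂]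
  have a3 : u₃ ∈ X₁ ∩ X₂ := by simp [hi₃]
  simp only [Finset.mem_inter] at a1 a2 a3
  have n1 : u₁ ∉ X₁ := fun h => by
    have : u₁ ∈ X₁ ∩ X₃ := Finset.mem_inter.2 ⟨h, a1.2⟩
    rw [hi₂, Finset.mem_singleton] at this
    exact h12 this
  have n2 : u₂ ∉ X₂ := fun h => by
    have : u₂ ∈ X₂ ∩ X₃ := Finset.mem_inter.2 ⟨h, a2.2⟩
    rw [hi₁, Finset.mem_singleton] at this
    exact h12 this.symm
  have hi : (X₁ ∪ X₂) ∩ X₃ = {u₂, u₁} := by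
    rw [Finset.union_inter_distrib_right, hi₁, hi₂]
    rfl
  have e1 := inner_union_add_inner_inter C X₁ X₂
  have e2 := inner_union_add_inner_inter C (X₁ ∪ X₂) X₃
  -- A possible edge between the hinges `u₁`, `u₂` lies in `X₃` and also runs between `X₁` and `X₂`.
  -- The surplus of the first union compensates for this double count.
  have e3 : inner C {u₂, u₁} ≤ 2 * between C (X₁ \ X₂) (X₂ \ X₁) := by
    rw [inner_insert C (by simpa using h12.symm), inner_singleton, zero_add]
    refine mul_le_mul_of_nonneg_left ?_ (by norm_num)
    refine (between_mono_left C ?_ _).trans (between_mono_right C _ ?_)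
    · simp [a2.1, n2]
    · simp [a1.1, n1]
  have c1 := Finset.card_union_add_card_inter X₁ X₂
  have c2 := Finset.card_union_add_card_inter (X₁ ∪ X₂) X₃
  rw [hi₃] at e1 c1
  rw [hi] at e2 c2
  rw [inner_singleton] at e1
  rw [Finset.card_singleton] at c1
  rw [Finset.card_pair h12.symm] at c2
  have b := between_nonneg C ((X₁ ∪ X₂) \ X₃) (X₃ \ (X₁ ∪ X₂))
  have t1 := hX₁.inner_eq
  have t2 := hX₂.inner_eq
  have t3 := hX₃.inner_eq
  have hy : y ∉ X₁ ∪ X₂ ∪ X₃ := by simp [hy₁, hy₂, hy₃]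
  have w1 := hX₁.two_le
  have w2 := hX₂.two_le
  have w3 := hX₃.two_le
  have hs := hC.sparse _ (ne_univ_of_notMem hy) (by omega)
  have hU : X₁ ∪ X₂ ∪ X₃ = {y}ᶜ := by
    refine hC.eq_compl_of_nbrs_subset
      (hC.tight_of_le (ne_univ_of_notMem hy) (by omega) (by omega)) hy hd ?_
    rw [hN]
    intro x hx
    simp only [Finset.mem_insert, Finset.mem_singleton] at hx
    simp only [Finset.mem_union]
    rcases hx with rfl | rfl | rfl <;> tauto
  refine ⟨hU, ?_⟩
  have hb : between C ((X₁ ∪ X₂) \ X₃) (X₃ \ (X₁ ∪ X₂)) = 0 := by omega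
  by_contra hne
  obtain ⟨x, hx, hx'⟩ := Finset.not_subset.1 hne
  have hP : X₃ \ (X₁ ∪ X₂) = X₃ \ {u₁, u₂} := by
    rw [← Finset.sdiff_inter_self_right, hi, Finset.pair_comm]
  obtain ⟨p, hp, q, hq, hpq⟩ := hsep {u₁, u₂} (X₃ \ {u₁, u₂}) Finset.card_le_two
    Finset.sdiff_disjoint ⟨x, Finset.mem_sdiff.2 ⟨hx, hx'⟩⟩
    (ne_univ_of_notMem (x := y) (by
      simp only [Finset.mem_union, Finset.mem_sdiff, Finset.mem_insert, Finset.mem_singleton]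
      rintro (h | rfl | rfl)
      · exact hy₃ h.1
      · exact hy₂ a1.1
      · exact hy₁ a2.1))
  rw [Finset.sdiff_union_self_eq_union, Finset.mem_union, not_or] at hq
  by_cases hqy : q = y
  · subst hqy
    have : p ∈ nbrs C q := (mem_nbrs C).2 hpq.symm
    rw [hN] at this
    simp only [Finset.mem_sdiff, Finset.mem_insert, Finset.mem_singleton] at hp this
    rcases this with h | h | h
    · tauto
    · tauto
    · subst h
      exact h3 hp.1
  · have hqU : q ∈ X₁ ∪ X₂ ∪ X₃ := by simp [hU, hqy]
    refine not_adj_of_between_eq_zero C hb (x := q) (y := p) ?_ (by rwa [hP]) hpq.symm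
    exact Finset.mem_sdiff.2 ⟨(Finset.mem_union.1 hqU).resolve_right hq.1, hq.1⟩

/-- Around a vertex of degree three without admissible pair of neighbours there are three tight
sets, each omitting one neighbour, any two of which cover all other vertices. -/
theorem exists_tight_cover (hsep : NoSeparation C) (hV : 5 ≤ Fintype.card V) {y : V}
    (hd : deg C y = 3)
    (hbad : ∀ a ∈ nbrs C y, ∀ b ∈ nbrs C y, a ≠ b → ¬ Admissible C y a b) :
    ∃ X : V → Finset V, ∀ u ∈ nbrs C y, Tight C (X u) ∧ y ∉ X u ∧ u ∉ X u ∧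
      ∀ w ∈ nbrs C y, w ≠ u → w ∈ X u ∧ X u ∪ X w = {y}ᶜ ∧
        between C (X u \ X w) (X w \ X u) = 0 := by
  obtain ⟨u₁, u₂, u₃, h12, h13, h23, hN⟩ := Finset.card_eq_three.1
    (show (nbrs C y).card = 3 by rw [deg_eq_card] at hd; exact_mod_cast hd)
  -- A tight set that refutes admissibility of `a`, `b` must omit `c`, as otherwise it would be all
  -- of `V - y`.
  have key : ∀ a b c : V, a ≠ b → nbrs C y = {a, b, c} →
      ∃ X, Tight C X ∧ y ∉ X ∧ a ∈ X ∧ b ∈ X ∧ c ∉ X := by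
    intro a b c hab hN
    have := hbad a (by simp [hN]) b (by simp [hN]) hab
    simp only [Admissible, not_forall] at this
    obtain ⟨X, hX, hy, ha, hb, hne⟩ := this
    refine ⟨X, hX, hy, ha, hb, fun hc => hne (hC.eq_compl_of_nbrs_subset hX hy hd ?_)⟩
    rw [hN]
    simp [Finset.insert_subset_iff, ha, hb, hc]
  have hN2 : nbrs C y = {u₁, u₃, u₂} := by rw [hN]; ext; simp; tauto
  have hN1 : nbrs C y = {u₂, u₃, u₁} := by rw [hN]; ext; simp; tauto
  obtain ⟨X₃, T3, y3, m31, m32, n3⟩ := key u₁ u₂ u₃ h12 hN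
  obtain ⟨X₂, T2, y2, m21, m23, n2⟩ := key u₁ u₃ u₂ h13 hN2
  obtain ⟨X₁, T1, y1, m12, m13, n1⟩ := key u₂ u₃ u₁ h23 hN1
  have s12 : nbrs C y ⊆ X₁ ∪ X₂ := by
    rw [hN]; simp [Finset.insert_subset_iff, m21, m12, m13]
  have s13 : nbrs C y ⊆ X₁ ∪ X₃ := by
    rw [hN]; simp [Finset.insert_subset_iff, m31, m12, m13]
  have s23 : nbrs C y ⊆ X₂ ∪ X₃ := by
    rw [hN]; simp [Finset.insert_subset_iff, m21, m32, m23]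
  -- One large intersection forces the others by `two_le_card_inter`. If all are single vertices,
  -- `hinged_triangle` shrinks the three sets to pairs and leaves only four vertices.
  have all : 2 ≤ (X₁ ∩ X₂).card ∧ 2 ≤ (X₁ ∩ X₃).card ∧ 2 ≤ (X₂ ∩ X₃).card := by
    by_cases a12 : 2 ≤ (X₁ ∩ X₂).card
    · obtain ⟨hu, hb⟩ := hC.union_eq_compl hd T1 T2 y1 y2 s12 a12
      refine ⟨a12, hC.two_le_card_inter hu hb T3 y3 m32 m12 n2, ?_⟩
      rw [Finset.union_comm] at hu
      rw [between_comm] at hb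
      exact hC.two_le_card_inter hu hb T3 y3 m31 m21 n1
    by_cases a13 : 2 ≤ (X₁ ∩ X₃).card
    · obtain ⟨hu, hb⟩ := hC.union_eq_compl hd T1 T3 y1 y3 s13 a13
      exact absurd (hC.two_le_card_inter hu hb T2 y2 m23 m13 n3) a12
    by_cases a23 : 2 ≤ (X₂ ∩ X₃).card
    · obtain ⟨hu, hb⟩ := hC.union_eq_compl hd T2 T3 y2 y3 s23 a23
      have := hC.two_le_card_inter hu hb T1 y1 m13 m23 n3
      rw [Finset.inter_comm] at this
      exact absurd this a12
    exfalso
    have single : ∀ {X Y : Finset V} {u : V}, ¬ 2 ≤ (X ∩ Y).card → u ∈ X → u ∈ Y →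
        X ∩ Y = {u} := by
      intro X Y u h hX hY
      have hu : u ∈ X ∩ Y := Finset.mem_inter.2 ⟨hX, hY⟩
      exact Finset.eq_singleton_iff_unique_mem.2 ⟨hu, fun v hv => by
        by_contra hne
        exact h (Finset.one_lt_card.2 ⟨v, hv, u, hu, hne⟩)⟩
    have i12 := single a12 m13 m23
    have i13 := single a13 m12 m32
    have i23 := single a23 m21 m31
    have i21 := i12
    have i31 := i13
    have i32 := i23
    rw [Finset.inter_comm] at i21 i31 i32
    obtain ⟨hU, k3⟩ := hC.hinged_triangle hsep hd hN h12 T1 T2 T3 y1 y2 y3 i23 i13 i12 n3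
    obtain ⟨-, k2⟩ := hC.hinged_triangle hsep hd hN2 h13 T1 T3 T2 y1 y3 y2 i32 i12 i13 n2
    obtain ⟨-, k1⟩ := hC.hinged_triangle hsep hd hN1 h23 T2 T3 T1 y2 y3 y1 i31 i21 i23 n1
    have hle : X₁ ∪ X₂ ∪ X₃ ⊆ {u₁, u₂, u₃} := by
      refine Finset.union_subset (Finset.union_subset (k1.trans ?_) (k2.trans ?_)) (k3.trans ?_) <;>
        intro x <;> simp <;> tauto
    have h1 := Finset.card_le_card hle
    have h2 := Finset.card_le_three (a := u₁) (b := u₂) (c := u₃)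
    have h3 := Finset.card_add_card_compl ({y} : Finset V)
    rw [hU] at h1
    rw [Finset.card_singleton] at h3
    omega
  obtain ⟨p12, q12⟩ := hC.union_eq_compl hd T1 T2 y1 y2 s12 all.1
  obtain ⟨p13, q13⟩ := hC.union_eq_compl hd T1 T3 y1 y3 s13 all.2.1
  obtain ⟨p23, q23⟩ := hC.union_eq_compl hd T2 T3 y2 y3 s23 all.2.2
  have p21 := p12
  have p31 := p13
  have p32 := p23
  rw [Finset.union_comm] at p21 p31 p32
  have q21 := q12
  have q31 := q13
  have q32 := q23
  rw [between_comm] at q21 q31 q32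
  refine ⟨fun u => if u = u₁ then X₁ else if u = u₂ then X₂ else X₃, ?_⟩
  rw [hN]
  simp only [Finset.mem_insert, Finset.mem_singleton, forall_eq_or_imp, forall_eq, if_true,
    h12.symm, h13.symm, h23.symm, if_false, ne_eq, not_true_eq_false, false_imp_iff, true_and,
    and_true, not_false_iff, true_imp_iff, h12, h13, h23]
  tauto

end CircuitCount

end Admissible

/-! ### Vertices outside of tight sets and the degree count -/

section Existence

variable {V : Type*} [Fintype V] [DecidableEq V] {C : Graph V}

namespace CircuitCount

variable (hC : CircuitCount C)

include hC

theorem inner_eq_sum (X : Finset V) : inner C X = ∑ x ∈ X, ((nbrs C x ∩ X).card : ℤ) := by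
  unfold inner
  simp only [← between_singleton]
  simp [between]

/-- If all outside degrees were at least 4, deleting the complement would leave `X` with a count of
at most `4|X| - 8`. -/
theorem exists_deg_eq_three_of_tight (hV : 3 ≤ Fintype.card V) {X : Finset V} (hX : Tight C X) :
    ∃ x, x ∉ X ∧ deg C x = 3 := by
  by_contra! h
  have h1 : ∀ x ∈ Xᶜ, 4 ≤ deg C x := by
    intro x hx
    have := h x (Finset.mem_compl.1 hx)
    have := hC.three_le_deg hV x
    omega
  have h2 : Xᶜ.card • (4 : ℤ) ≤ ∑ x ∈ Xᶜ, deg C x := Finset.card_nsmul_le_sum _ _ _ h1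
  have h3 := hC.inner_compl_eq Xᶜ
  rw [compl_compl, hX.inner_eq] at h3
  have hne : Xᶜ.Nonempty := by
    rw [Finset.nonempty_iff_ne_empty, ne_eq, Finset.compl_eq_empty_iff]
    exact hX.ne_univ
  have hun : Xᶜ ≠ Finset.univ := by
    obtain ⟨x, hx⟩ := Finset.card_pos.1 (show 0 < X.card by have := hX.two_le; omega)
    exact ne_univ_of_notMem (x := x) (by simpa using hx)
  have h4 := hC.inner_le_of_nonempty hun hne
  simp only [nsmul_eq_mul] at h2
  omega

/-- If there is no admissible vertex of degree three, then all vertices outside of a tight set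
have degree three. -/
theorem deg_eq_three_of_notMem_tight (hsep : NoSeparation C) (hV : 5 ≤ Fintype.card V)
    (hbad : ∀ y, deg C y = 3 → ∀ a ∈ nbrs C y, ∀ b ∈ nbrs C y, a ≠ b → ¬ Admissible C y a b)
    {X : Finset V} (hX : Tight C X) {z : V} (hz : z ∉ X) : deg C z = 3 := by
  classical
  induction hk : Xᶜ.card using Nat.strong_induction_on generalizing X z with
  | _ k ih =>
  -- The induction grows the tight set.
  have larger : ∀ {Y : Finset V} {z : V}, Tight C Y → X ⊂ Y → z ∉ Y → deg C z = 3 := by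
    intro Y z hY hXY hzY
    refine ih _ ?_ hY hzY rfl
    rw [← hk]
    exact Finset.card_lt_card (Finset.compl_ssubset_compl.2 hXY)
  by_contra hz3
  set S : Finset V := Xᶜ.filter fun x => deg C x = 3 with hS
  have memS : ∀ x, x ∈ S ↔ x ∉ X ∧ deg C x = 3 := by simp [hS]
  have hSne : S.Nonempty := by
    obtain ⟨x, hx⟩ := hC.exists_deg_eq_three_of_tight (by omega) hX
    exact ⟨x, (memS x).2 hx⟩
  -- The heart of the argument: `S` induces minimum degree two, so deleting `S` destroys too few
  -- edges.
  have hnbrs : ∀ y ∈ S, 2 ≤ (nbrs C y ∩ S).card := by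
    intro y hyS
    obtain ⟨hyX, hd⟩ := (memS y).1 hyS
    have hN : (nbrs C y).card = 3 := by rw [deg_eq_card] at hd; exact_mod_cast hd
    obtain ⟨F, hF⟩ := hC.exists_tight_cover hsep hV hd (hbad y hd)
    -- With two neighbours of `y` in `X`, adding `y` would give a larger tight set that still misses
    -- `z`.
    have hout : 2 ≤ (nbrs C y \ X).card := by
      by_contra hlt
      have h1 := Finset.card_sdiff_add_card_inter (nbrs C y) X
      have h2 := inner_insert C hyX
      rw [between_singleton, hX.inner_eq] at h2
      have h3 := Finset.card_insert_of_notMem hyX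
      have hzy : z ∉ insert y X := by
        rw [Finset.mem_insert]
        rintro (rfl | h)
        exacts [hz3 hd, hz h]
      have h4 := hX.two_le
      exact hz3 (larger (hC.tight_of_le (ne_univ_of_notMem hzy) (by omega) (by omega))
        (Finset.ssubset_insert hyX) hzy)
    -- Here `X ∪ F u` is tight and misses `u`. It is strictly larger than `X`, since it contains a
    -- second neighbour of `y` outside of `X`.
    have hnode : ∀ u ∈ nbrs C y, u ∉ X → 2 ≤ (X ∩ F u).card → u ∈ S := by
      intro u hu huX hcard
      obtain ⟨f1, f2, f3, f4⟩ := hF u hu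
      refine (memS u).2 ⟨huX, ?_⟩
      have hun : X ∪ F u ≠ Finset.univ := ne_univ_of_notMem (x := y) (by simp [hyX, f2])
      refine larger (hC.union_inter hX f1 hcard hun).1 ?_ (by simp [huX, f3])
      refine Finset.ssubset_iff_subset_ne.2 ⟨Finset.subset_union_left, fun h => ?_⟩
      obtain ⟨w, hw, hwu⟩ := Finset.exists_mem_ne hout u
      rw [Finset.mem_sdiff] at hw
      apply hw.2
      rw [h]
      exact Finset.mem_union_right _ (f4 w hw.1 hwu).1
    obtain ⟨u, hu, w, hw, huw⟩ := Finset.one_lt_card.1 hout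
    rw [Finset.mem_sdiff] at hu hw
    by_cases hall : ∀ u ∈ nbrs C y, 2 ≤ (X ∩ F u).card
    · refine Finset.one_lt_card.2 ⟨u, Finset.mem_inter.2 ⟨hu.1, hnode u hu.1 hu.2 (hall u hu.1)⟩,
        w, Finset.mem_inter.2 ⟨hw.1, hnode w hw.1 hw.2 (hall w hw.1)⟩, huw⟩
    · push Not at hall
      obtain ⟨t, ht, hlt⟩ := hall
      have hsub : (nbrs C y).erase t ⊆ nbrs C y ∩ S := by
        intro s hs
        rw [Finset.mem_erase] at hs
        obtain ⟨f1, f2, f3, f4⟩ := hF t ht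
        obtain ⟨-, f5, f6⟩ := f4 s hs.2 hs.1
        -- A vertex of `X` in `F t` but not in `F s` would have a neighbour in `X ∩ F t` too,
        -- contrary to the choice of `t`.
        have hXs : X ⊆ F s := by
          intro x hx
          by_contra hxs
          have hxt : x ∈ F t := by
            have : x ∈ F t ∪ F s := by
              rw [f5, Finset.mem_compl, Finset.mem_singleton]
              rintro rfl
              exact hyX hx
            exact (Finset.mem_union.1 this).resolve_right hxs
          have := hC.two_le_card_inter f5 f6 hX hyX hx hxt hxs
          rw [Finset.inter_comm] at this
          omega
        refine Finset.mem_inter.2 ⟨hs.2, hnode s hs.2 (fun h => (hF s hs.2).2.2.1 (hXs h)) ?_⟩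
        rw [Finset.inter_eq_left.2 hXs]
        exact hX.two_le
      have := Finset.card_le_card hsub
      rw [Finset.card_erase_of_mem ht, hN] at this
      exact this
  -- Deleting `S` lowers the count by at most `2 * 3|S| - 2|S| = 4|S|`, so the proper set `Sᶜ` would
  -- keep a count of at least `4|Sᶜ| - 4`.
  have h1 := hC.inner_compl_eq S
  have h2 : inner C S = ∑ x ∈ S, ((nbrs C x ∩ S).card : ℤ) := hC.inner_eq_sum S
  have h3 := Finset.card_nsmul_le_sum S (fun x => ((nbrs C x ∩ S).card : ℤ)) 2
    (fun x hx => by exact_mod_cast hnbrs x hx)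
  have h4 : ∑ x ∈ S, deg C x = ∑ x ∈ S, 3 := Finset.sum_congr rfl fun x hx => ((memS x).1 hx).2
  have h5 : X ⊆ Sᶜ := fun x hx => by simp [memS, hx]
  have h6 := Finset.card_le_card h5
  have h7 := hX.two_le
  obtain ⟨s, hs⟩ := hSne
  have h8 := hC.sparse Sᶜ (ne_univ_of_notMem (x := s) (by simpa using hs)) (by omega)
  simp only [Finset.sum_const, nsmul_eq_mul] at h3 h4
  omega

/-- Otherwise each neighbour of a vertex of degree three lies outside of some tight set and has
degree three itself. By connectedness (separation by the empty set) all degrees are three, and `3N =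
4N - 4` contradicts `N ≥ 5`. -/
theorem exists_admissible (hsep : NoSeparation C) (hV : 5 ≤ Fintype.card V) :
    ∃ y, deg C y = 3 ∧ ∃ a ∈ nbrs C y, ∃ b ∈ nbrs C y, a ≠ b ∧ Admissible C y a b := by
  classical
  by_contra! hbad
  have hclosed : ∀ y, deg C y = 3 → ∀ u ∈ nbrs C y, deg C u = 3 := by
    intro y hy u hu
    obtain ⟨F, hF⟩ := hC.exists_tight_cover hsep hV hy (hbad y hy)
    obtain ⟨f1, -, f3, -⟩ := hF u hu
    exact hC.deg_eq_three_of_notMem_tight hsep hV hbad f1 f3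
  have hsum := hC.sum_deg
  have hex : ∃ y, deg C y = 3 := by
    by_contra! h
    have h1 : ∀ x ∈ Finset.univ, 4 ≤ deg C x := by
      intro x _
      have := h x
      have := hC.three_le_deg (by omega) x
      omega
    have h2 : Finset.univ.card • (4 : ℤ) ≤ ∑ x, deg C x := Finset.card_nsmul_le_sum _ _ _ h1
    simp only [nsmul_eq_mul, Finset.card_univ] at h2
    omega
  obtain ⟨y, hy⟩ := hex
  by_cases hall : (Finset.univ.filter fun x => deg C x = 3) = Finset.univ
  · have h1 : ∑ x, deg C x = ∑ x : V, 3 := Finset.sum_congr rfl fun x _ => by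
      have := Finset.mem_univ x
      rw [← hall] at this
      exact (Finset.mem_filter.1 this).2
    simp only [Finset.sum_const, nsmul_eq_mul, Finset.card_univ] at h1
    omega
  · obtain ⟨p, hp, q, hq, hpq⟩ := hsep ∅ (Finset.univ.filter fun x => deg C x = 3) (by simp)
      (Finset.disjoint_empty_right _) ⟨y, by simp [hy]⟩ (by simpa using hall)
    refine hq ?_
    simp only [Finset.mem_filter, Finset.mem_univ, true_and, Finset.union_empty] at hp ⊢
    exact hclosed p hp q ((mem_nbrs C).2 hpq)

end CircuitCount

/-! ### The vertices that determine a decomposition -/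

/-- Vertices `v`, `a`, `b`, `w` that yield a decomposition: `v` is to be deleted, `s(a, b)` is the
elimination edge, and the second circuit avoids `w`. -/
structure DecompositionVertices (C : Graph V) (v a b w : V) : Prop where
  deg_left : deg C v = 3
  deg_right : deg C w = 3
  ne : v ≠ w
  not_adj : ¬ C.Adj v w
  ne_ab : a ≠ b
  ne_av : a ≠ v
  ne_bv : b ≠ v
  ne_aw : a ≠ w
  ne_bw : b ≠ w
  admissible : Admissible C v a b

theorem CircuitCount.exists_decompositionVertices (hC : CircuitCount C) (hsep : NoSeparation C)
    (hV : 5 ≤ Fintype.card V) : ∃ v a b w, DecompositionVertices C v a b w := by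
  classical
  obtain ⟨v, hv, a, ha, b, hb, hab, hadm⟩ := hC.exists_admissible hsep hV
  have hva := (mem_nbrs C).1 ha
  have hvb := (mem_nbrs C).1 hb
  suffices h : ∃ w, deg C w = 3 ∧ v ≠ w ∧ ¬ C.Adj v w by
    obtain ⟨w, hw, hvw, hadj⟩ := h
    exact ⟨v, a, b, w, hv, hw, hvw, hadj, hab, hva.ne.symm, hvb.ne.symm,
      fun h => hadj (h ▸ hva), fun h => hadj (h ▸ hvb), hadm⟩
  by_contra! h
  -- If the third neighbour `c` had degree three, deleting `v` and `c` would leave a tight set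
  -- containing `a` and `b`, against admissibility.
  have hlow : ∀ c ∈ nbrs C v, c ≠ a → c ≠ b → deg C c ≠ 3 := by
    intro c hc hca hcb hdc
    have hvc := (mem_nbrs C).1 hc
    have h1 := hC.inner_compl_eq {v, c}
    have h2 := Finset.card_add_card_compl ({v, c} : Finset V)
    rw [Finset.card_pair hvc.ne] at h1 h2
    rw [Finset.sum_pair hvc.ne, inner_pair C hvc, hv, hdc] at h1
    have h3 := hadm {v, c}ᶜ
      (hC.tight_of_le (ne_univ_of_notMem (x := v) (by simp)) (by omega) (by push_cast at h1; omega))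
      (by simp) (by simp [hva.ne.symm, hca.symm]) (by simp [hvb.ne.symm, hcb.symm])
    have h4 : c ∈ ({v}ᶜ : Finset V) := by simp [hvc.ne.symm]
    rw [← h3] at h4
    simp at h4
  -- Only three vertices could have degree three, so the degree sum would be at least `4N - 3`
  -- instead of `4N - 4`.
  have h1 : ∀ x, 4 ≤ deg C x + if x ∈ ({v, a, b} : Finset V) then 1 else 0 := by
    intro x
    have h3 := hC.three_le_deg (by omega) x
    by_cases hx : deg C x = 3
    · have : x ∈ ({v, a, b} : Finset V) := by
        simp only [Finset.mem_insert, Finset.mem_singleton]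
        by_contra! hne
        exact hlow x ((mem_nbrs C).2 (h x hx hne.1.symm)) hne.2.1 hne.2.2 hx
      rw [if_pos this]
      omega
    · split_ifs <;> omega
  have h2 := Finset.card_nsmul_le_sum Finset.univ _ _ fun x _ => h1 x
  rw [Finset.sum_add_distrib, hC.sum_deg, Finset.sum_boole] at h2
  have h3 := Finset.card_le_three (a := v) (b := a) (c := b)
  simp only [nsmul_eq_mul, Finset.card_univ, Finset.filter_univ_mem] at h2
  omega

end Existence

/-! ### The circuit spanned by a pair of vertices -/

section Span

variable {V : Type*} [Fintype V] [DecidableEq V] {C : Graph V}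

open Classical in
/-- The vertices `z` such that no tight set contains `a` and `b` but neither `c` nor `z`, in the
form in which this is tested by orientations. -/
noncomputable def spanSet (C : Graph V) (c a b : V) : Finset V :=
  Finset.univ.filter fun z =>
    ∀ X : Finset V, c ∉ X → z ∉ X → inner C X ≤ 4 * ((X \ {a, b}).card : ℤ)

theorem mem_spanSet {c a b z : V} : z ∈ spanSet C c a b ↔
    ∀ X : Finset V, c ∉ X → z ∉ X → inner C X ≤ 4 * ((X \ {a, b}).card : ℤ) := by
  simp [spanSet]

/-- `T` is the least tight set that contains `a` and `b` but not `c`. -/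
structure IsTightSpan (C : Graph V) (c a b : V) (T : Finset V) : Prop where
  tight : Tight C T
  left_mem : a ∈ T
  right_mem : b ∈ T
  notMem : c ∉ T
  subset : ∀ X : Finset V, Tight C X → c ∉ X → a ∈ X → b ∈ X → T ⊆ X

namespace CircuitCount

variable (hC : CircuitCount C)

include hC

/-- The family contains `V - c` and is closed under intersection, because `a` and `b` always lie in
both sets and `c` in neither. A member of least size is therefore the least one. -/
theorem exists_isTightSpan (hV : 3 ≤ Fintype.card V) {c a b : V} (hc : deg C c = 3) (hab : a ≠ b)
    (hac : a ≠ c) (hbc : b ≠ c) : ∃ T, IsTightSpan C c a b T := by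
  classical
  let F : Finset (Finset V) := Finset.univ.filter fun X => Tight C X ∧ c ∉ X ∧ a ∈ X ∧ b ∈ X
  have hF : F.Nonempty := ⟨{c}ᶜ, by simp [F, hC.tight_compl_of_deg hV hc, hac, hbc]⟩
  obtain ⟨T, hT, hmin⟩ := Finset.exists_min_image F Finset.card hF
  simp only [F, Finset.mem_filter, Finset.mem_univ, true_and] at hT hmin
  obtain ⟨t1, t2, t3, t4⟩ := hT
  refine ⟨T, t1, t3, t4, t2, fun X h1 h2 h3 h4 => ?_⟩
  have ha := Finset.mem_inter.2 ⟨t3, h3⟩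
  have hb := Finset.mem_inter.2 ⟨t4, h4⟩
  have hi := (hC.union_inter t1 h1 (Finset.one_lt_card.2 ⟨a, ha, b, hb, hab⟩)
    (ne_univ_of_notMem (x := c) (by simp [t2, h2]))).2.1
  have := hmin (T ∩ X) ⟨hi, by simp [t2], ha, hb⟩
  exact Finset.inter_eq_left.1 (Finset.eq_of_subset_of_card_le Finset.inter_subset_left this)

/-- If `z ∉ T`, then `T` violates the condition, as `4|T| - 6 > 4(|T| - 2)`. If `z ∈ T` is neither
`a` nor `b`, then `X ∪ {a, b}` misses `z` and is not tight, and parity gives the bound `4(|X \ {a,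
b}| + 2) - 8`. If `z` is `a` or `b`, then a nonempty `X` contains at most one of them and `4|X| - 4`
suffices. -/
theorem spanSet_eq {c a b : V} (hab : a ≠ b) (hac : a ≠ c) (hbc : b ≠ c) {T : Finset V}
    (hT : IsTightSpan C c a b T) : spanSet C c a b = T := by
  ext z
  rw [mem_spanSet]
  constructor
  · intro h
    by_contra hz
    have h1 := h T hT.notMem hz
    have h2 := Finset.card_sdiff_add_card_inter T {a, b}
    rw [Finset.inter_eq_right.2 (by simp [Finset.insert_subset_iff, hT.left_mem, hT.right_mem]),
      Finset.card_pair hab] at h2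
    have h3 := hT.tight.inner_eq
    omega
  · intro hz X hcX hzX
    by_cases hz' : z = a ∨ z = b
    · rcases X.eq_empty_or_nonempty with rfl | hne
      · simp [inner_empty]
      have h1 := hC.inner_le_of_nonempty (ne_univ_of_notMem hcX) hne
      have h2 : X.card ≤ (X \ {a, b}).card + 1 := by
        have hsub : ∃ t, X ∩ {a, b} ⊆ {t} := by
          rcases hz' with rfl | rfl
          · refine ⟨b, fun x hx => ?_⟩
            simp only [Finset.mem_inter, Finset.mem_insert, Finset.mem_singleton] at hx ⊢
            rcases hx with ⟨hx, rfl | rfl⟩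
            exacts [absurd hx hzX, rfl]
          · refine ⟨a, fun x hx => ?_⟩
            simp only [Finset.mem_inter, Finset.mem_insert, Finset.mem_singleton] at hx ⊢
            rcases hx with ⟨hx, rfl | rfl⟩
            exacts [rfl, absurd hx hzX]
        obtain ⟨t, ht⟩ := hsub
        have h3 := Finset.card_le_card ht
        have h4 := Finset.card_sdiff_add_card_inter X {a, b}
        rw [Finset.card_singleton] at h3
        omega
      omega
    · push Not at hz'
      have hc' : c ∉ X ∪ {a, b} := by simp [hcX, hac.symm, hbc.symm]
      have hz'' : z ∉ X ∪ {a, b} := by simp [hzX, hz'.1, hz'.2]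
      have h1 := inner_mono C (Finset.subset_union_left : X ⊆ X ∪ {a, b})
      have h2 : (X ∪ {a, b}).card = (X \ {a, b}).card + 2 := by
        rw [← Finset.sdiff_union_self_eq_union, Finset.card_union_of_disjoint
          Finset.sdiff_disjoint, Finset.card_pair hab]
      have h3 := hC.inner_le_of_not_tight (ne_univ_of_notMem hc') (by omega)
        (fun ht => hz'' (hT.subset _ ht hc' (by simp) (by simp) hz))
      omega

end CircuitCount

/-! ### Edge counts versus the definitions of circuit and connectivity -/

/-- The subgraph of `C` induced by `T`, with the additional edge `s(a, b)`. -/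
def spanGraph (C : Graph V) (T : Set V) (a b : V) : Graph V where
  verts := insert a (insert b T)
  Adj x y := (C.Adj x y ∧ x ∈ T ∧ y ∈ T) ∨ (x ≠ y ∧ s(x, y) = s(a, b))
  adj_sub := by
    rintro x y (h | h)
    exacts [h.1.adj_sub, h.1]
  edge_vert := by
    rintro x y (h | ⟨-, h⟩)
    · simp [h.2.1]
    · simp only [Sym2.eq_iff] at h
      rcases h with ⟨rfl, -⟩ | ⟨rfl, -⟩ <;> simp
  symm := ⟨by
    rintro x y (h | ⟨h1, h2⟩)
    · exact Or.inl ⟨h.1.symm, h.2.2, h.2.1⟩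
    · exact Or.inr ⟨h1.symm, by rw [Sym2.eq_swap, h2]⟩⟩

/-- The handshake lemma for the subgraph spanned by `X`. -/
theorem two_mul_ncard_eq_inner (H : Graph V) (X : Finset V) :
    (2 * {e ∈ H.edgeSet | ∀ v ∈ e, v ∈ X}.ncard : ℤ) = inner H X := by
  classical
  let G : SimpleGraph V :=
    { Adj := fun x y => H.Adj x y ∧ x ∈ X ∧ y ∈ X
      symm := ⟨fun x y h => ⟨h.1.symm, h.2.2, h.2.1⟩⟩
      loopless := ⟨fun x h => h.1.ne rfl⟩ }
  have h1 : {e ∈ H.edgeSet | ∀ v ∈ e, v ∈ X} = (G.edgeFinset : Set (Sym2 V)) := by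
    ext e
    induction e using Sym2.ind with
    | _ x y => simp [G]
  have h2 := G.sum_degrees_eq_twice_card_edges
  rw [h1, Set.ncard_coe_finset]
  have h3 : inner H X = ∑ x, (G.degree x : ℤ) := by
    have h4 : ∀ x, (G.degree x : ℤ) = if x ∈ X then ∑ y ∈ X, adjInd H x y else 0 := by
      intro x
      rw [← SimpleGraph.card_neighborFinset_eq_degree, SimpleGraph.neighborFinset_eq_filter]
      split_ifs with hx
      · simp only [adjInd, Finset.sum_boole, G, hx, true_and]
        congr 2
        ext y
        simp [and_comm]
      · simp [G, hx]
    simp only [h4, inner, between, Finset.sum_ite_mem, Finset.univ_inter]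
  rw [h3]
  exact_mod_cast h2.symm

/-- A violating set may be intersected with `T`, and among subsets of `T` only `T` itself exceeds
the bound, by exactly one edge. A dependent set of edges must therefore contain all edges. -/
theorem isCircuit_of_count {H : Graph V} {T : Finset V} (hT : H.verts = T) (h2 : 2 ≤ T.card)
    (htot : inner H T = 4 * T.card - 4)
    (hsp : ∀ X ⊂ T, 2 ≤ X.card → inner H X ≤ 4 * X.card - 6) : IsCircuit H := by
  classical
  have hins : ∀ X : Finset V, {e ∈ H.edgeSet | ∀ v ∈ e, v ∈ X} =
      {e ∈ H.edgeSet | ∀ v ∈ e, v ∈ X ∩ T} := by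
    intro X
    ext e
    simp only [Set.mem_ofPred_eq, Finset.mem_inter, and_congr_right_iff]
    refine fun he => forall₂_congr fun v hv => (and_iff_left ?_).symm
    have := H.mem_verts_of_mem_edge he hv
    rwa [hT] at this
  have hfull : {e ∈ H.edgeSet | ∀ v ∈ e, v ∈ T} = H.edgeSet := by
    ext e
    simp only [Set.mem_ofPred_eq, and_iff_left_iff_imp]
    intro he v hv
    have := H.mem_verts_of_mem_edge he hv
    rwa [hT] at this
  refine ⟨?_, ?_, ?_⟩
  · refine Set.Subset.antisymm (fun x hx => ?_) H.support_subset_verts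
    have hxT : x ∈ T := by rwa [hT] at hx
    by_contra hns
    have h1 := inner_insert H (Finset.notMem_erase x T)
    rw [Finset.insert_erase hxT, between_eq_zero H (by
      intro y hy z hz hyz
      rw [Finset.mem_singleton.1 hy] at hyz
      exact hns ((SimpleGraph.Subgraph.mem_support H).2 ⟨z, hyz⟩))] at h1
    have h3 := Finset.card_erase_of_mem hxT
    rcases Nat.lt_or_ge 2 T.card with h4 | h4
    · have := hsp _ (Finset.erase_ssubset hxT) (by omega)
      omega
    · obtain ⟨y, hy⟩ := Finset.card_eq_one.1 (show (T.erase x).card = 1 by omega)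
      rw [hy, inner_singleton] at h1
      omega
  · intro hs
    have h1 := hs T h2
    have h3 := two_mul_ncard_eq_inner H T
    omega
  · intro F hF hFH
    replace hFH : F ⊆ H.edgeSet := hFH
    change ¬ IsSparse F at hF
    change H.edgeSet ⊆ F
    simp only [IsSparse, not_forall] at hF
    obtain ⟨X, hX, hlt⟩ := hF
    have h1 : {e ∈ F | ∀ v ∈ e, v ∈ X} ⊆ {e ∈ H.edgeSet | ∀ v ∈ e, v ∈ X ∩ T} := by
      rw [← hins]
      exact fun e he => ⟨hFH he.1, he.2⟩
    have h3 := Set.ncard_le_ncard h1 (Set.toFinite _)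
    have h4 := two_mul_ncard_eq_inner H (X ∩ T)
    have h5 := Finset.card_le_card (Finset.inter_subset_left : X ∩ T ⊆ X)
    have h6 : X ∩ T = T := by
      by_contra hne
      have hss : X ∩ T ⊂ T := Finset.ssubset_iff_subset_ne.2 ⟨Finset.inter_subset_right, hne⟩
      rcases Nat.lt_or_ge 1 (X ∩ T).card with h7 | h7
      · have := hsp _ hss h7
        omega
      · rcases Nat.eq_zero_or_pos (X ∩ T).card with h8 | h8
        · rw [Finset.card_eq_zero.1 h8, inner_empty] at h4
          rw [Finset.card_eq_zero.1 h8] at h3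
          omega
        · obtain ⟨y, hy⟩ := Finset.card_eq_one.1 (le_antisymm h7 h8)
          rw [hy, inner_singleton] at h4
          rw [hy] at h3
          omega
    rw [h6] at h1 h3 h4 h5
    have h7 : {e ∈ F | ∀ v ∈ e, v ∈ X} = {e ∈ H.edgeSet | ∀ v ∈ e, v ∈ T} :=
      Set.eq_of_subset_of_ncard_le h1 (by omega) (Set.toFinite _)
    rw [hfull] at h7
    rw [← h7]
    exact fun e he => he.1

/-- No vertex is isolated, so a proper set of vertices spans a proper, hence sparse, set of edges.
The violation occurs at the whole vertex set and disappears with one edge, which fixes the total. -/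
theorem circuitCount_of_isCircuit (hsp : C.IsSpanning) (hC : IsCircuit C) : CircuitCount C := by
  have hedge : ∀ x : V, ∃ y, C.Adj x y := by
    intro x
    have := hsp x
    rw [hC.verts_eq_support] at this
    exact (SimpleGraph.Subgraph.mem_support C).1 this
  have hsub : ∀ F : Set (Sym2 V), F ⊆ C.edgeSet → F ≠ C.edgeSet → IsSparse F := by
    intro F hF hne
    by_contra hs
    exact hne (hF.antisymm (hC.minimal_dependent.2 hs hF))
  have hprop : ∀ X : Finset V, X ≠ Finset.univ → 2 ≤ X.card → inner C X ≤ 4 * X.card - 6 := by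
    intro X hX h2
    have h1 : {e ∈ C.edgeSet | ∀ v ∈ e, v ∈ X} ≠ C.edgeSet := by
      intro heq
      apply hX
      rw [Finset.eq_univ_iff_forall]
      intro x
      obtain ⟨y, hy⟩ := hedge x
      have : s(x, y) ∈ C.edgeSet := hy
      rw [← heq] at this
      exact this.2 x (by simp)
    have h3 := hsub _ (Set.sep_subset _ _) h1 X h2
    rw [show {e ∈ {e ∈ C.edgeSet | ∀ v ∈ e, v ∈ X} | ∀ v ∈ e, v ∈ X} =
      {e ∈ C.edgeSet | ∀ v ∈ e, v ∈ X} by ext; simp] at h3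
    have := two_mul_ncard_eq_inner C X
    omega
  refine ⟨?_, hprop⟩
  have hlow := hC.minimal_dependent.1
  simp only [IsSparse, not_forall] at hlow
  obtain ⟨X, hX, hlt⟩ := hlow
  have h1 := two_mul_ncard_eq_inner C X
  have h2 : X = Finset.univ := by
    by_contra hne
    have := hprop X hne hX
    omega
  subst h2
  have hne : (Finset.univ : Finset V).Nonempty := Finset.card_pos.1 (by omega)
  obtain ⟨x, -⟩ := hne
  obtain ⟨y, hy⟩ := hedge x
  have he : s(x, y) ∈ C.edgeSet := hy
  have h3 := hsub (C.edgeSet \ {s(x, y)}) Set.sdiff_subset (fun h => by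
    rw [← h] at he
    exact he.2 rfl) Finset.univ hX
  simp only [Finset.mem_univ, implies_true, and_true, Set.ofPred_mem_eq] at h1 h3 hlt
  have h4 := Set.ncard_sdiff_singleton_add_one he (Set.toFinite _)
  rw [Finset.card_univ] at *
  omega

/-- A walk from `P` to the remaining vertices that avoids `S` has an edge that leaves `P`. -/
theorem noSeparation_of_isThreeConnected (hsp : C.IsSpanning) (hC : IsThreeConnected C) :
    NoSeparation C := by
  intro S P hS hPS hP hne
  obtain ⟨p, hp⟩ := hP
  obtain ⟨q, hq⟩ : ∃ q, q ∉ P ∪ S := by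
    by_contra! h
    exact hne (Finset.eq_univ_iff_forall.2 h)
  have hpS : p ∉ S := fun h => Finset.disjoint_left.1 hPS hp h
  have hqS : q ∉ S := fun h => hq (Finset.mem_union_right _ h)
  have hcon := hC.connected_deleteVerts S hS
  have hv : ∀ x, x ∉ S → x ∈ (C.deleteVerts (S : Set V)).verts := fun x hx => by
    simp [hsp x, hx]
  obtain ⟨walk⟩ := hcon.coe.preconnected ⟨p, hv p hpS⟩ ⟨q, hv q hqS⟩
  obtain ⟨d, -, h1, h2⟩ := walk.exists_boundary_dart {x | (x : V) ∈ P} hp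
    (fun h => hq (Finset.mem_union_left _ h))
  have hadj : (C.deleteVerts (S : Set V)).Adj d.fst d.snd := d.adj
  rw [SimpleGraph.Subgraph.deleteVerts_adj] at hadj
  refine ⟨d.fst, h1, d.snd, ?_, hadj.2.2.2.2⟩
  rw [Finset.mem_union, not_or]
  exact ⟨h2, by simpa using hadj.2.2.2.1⟩

end Span

/-! ### The decomposition -/

section Decomposition

variable {V : Type*} [Fintype V] [DecidableEq V] {C : Graph V}

theorem spanGraph_verts {c a b : V} {T : Finset V} (hT : IsTightSpan C c a b T) :
    (spanGraph C T a b).verts = T := by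
  have ha : a ∈ (T : Set V) := hT.left_mem
  have hb : b ∈ (T : Set V) := hT.right_mem
  simp [spanGraph, Set.insert_eq_of_mem ha, Set.insert_eq_of_mem hb]

theorem adjInd_spanGraph {T : Finset V} {a b x y : V} (hab : a ≠ b) (hadj : ¬ C.Adj a b)
    (hx : x ∈ T) (hy : y ∈ T) : adjInd (spanGraph C T a b) x y =
      adjInd C x y + ((if x = a ∧ y = b then 1 else 0) + if x = b ∧ y = a then 1 else 0) := by
  have hadj' : ¬ C.Adj b a := fun h => hadj h.symm
  have h : (spanGraph C T a b).Adj x y ↔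
      C.Adj x y ∨ (x = a ∧ y = b) ∨ (x = b ∧ y = a) := by
    simp only [spanGraph, Finset.mem_coe, hx, hy, and_true, Sym2.eq_iff]
    constructor
    · tauto
    · rintro (h | h | h)
      · exact Or.inl h
      · exact Or.inr ⟨by rw [h.1, h.2]; exact hab, Or.inl h⟩
      · exact Or.inr ⟨by rw [h.1, h.2]; exact hab.symm, Or.inr h⟩
  by_cases h0 : C.Adj x y
  · have h1 : ¬ (x = a ∧ y = b) := by rintro ⟨rfl, rfl⟩; exact hadj h0
    have h2 : ¬ (x = b ∧ y = a) := by rintro ⟨rfl, rfl⟩; exact hadj' h0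
    rw [adjInd_of_adj (h.2 (Or.inl h0)), adjInd_of_adj h0, if_neg h1, if_neg h2]
    rfl
  · rw [adjInd_of_not_adj h0]
    by_cases h1 : x = a ∧ y = b
    · have h2 : ¬ (x = b ∧ y = a) := by rintro ⟨rfl, rfl⟩; exact hab h1.1.symm
      rw [adjInd_of_adj (h.2 (Or.inr (Or.inl h1))), if_pos h1, if_neg h2]
      rfl
    · by_cases h2 : x = b ∧ y = a
      · rw [adjInd_of_adj (h.2 (Or.inr (Or.inr h2))), if_neg h1, if_pos h2]
        rfl
      · rw [adjInd_of_not_adj (fun h3 => by tauto), if_neg h1, if_neg h2]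
        rfl

theorem inner_spanGraph {T X : Finset V} {a b : V} (hab : a ≠ b) (hadj : ¬ C.Adj a b)
    (hX : X ⊆ T) :
    inner (spanGraph C T a b) X = inner C X + if a ∈ X ∧ b ∈ X then 2 else 0 := by
  have h : ∀ a b : V, ∑ x ∈ X, ∑ y ∈ X, (if x = a ∧ y = b then (1 : ℤ) else 0) =
      if a ∈ X ∧ b ∈ X then 1 else 0 := by
    intro a b
    have : ∀ x y : V, (if x = a ∧ y = b then (1 : ℤ) else 0) =
        if x = a then if y = b then 1 else 0 else 0 := by
      intro x y
      split_ifs <;> simp_all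
    simp only [this]
    by_cases ha : a ∈ X <;> by_cases hb : b ∈ X <;>
      simp [ha, hb, Finset.sum_ite_eq']
  unfold inner between
  rw [Finset.sum_congr rfl fun x hx => Finset.sum_congr rfl fun y hy =>
    adjInd_spanGraph hab hadj (hX hx) (hX hy)]
  simp only [Finset.sum_add_distrib, h]
  by_cases ha : a ∈ X <;> by_cases hb : b ∈ X <;> simp [ha, hb]

namespace CircuitCount

variable (hC : CircuitCount C)

include hC

/-- The new edge lifts the tight set `T` to the total of a circuit. Smaller sets containing both
endpoints are not tight by minimality, and parity leaves room for one more edge. -/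
theorem isCircuit_spanGraph {c a b : V} {T : Finset V} (hT : IsTightSpan C c a b T) (hab : a ≠ b)
    (hadj : ¬ C.Adj a b) : IsCircuit (spanGraph C T a b) := by
  refine isCircuit_of_count (spanGraph_verts hT) hT.tight.two_le ?_ ?_
  · rw [inner_spanGraph hab hadj subset_rfl, if_pos ⟨hT.left_mem, hT.right_mem⟩,
      hT.tight.inner_eq]
    ring
  · intro X hX h2
    rw [inner_spanGraph hab hadj hX.1]
    have hc : c ∉ X := fun h => hT.notMem (hX.1 h)
    split_ifs with h
    · have := hC.inner_le_of_not_tight (ne_univ_of_notMem hc) h2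
        fun ht => hX.2 (hT.subset X ht hc h.1 h.2)
      omega
    · have := hC.sparse X (ne_univ_of_notMem hc) h2
      omega

theorem isTightSpan_compl (hV : 3 ≤ Fintype.card V) {v a b w : V}
    (h : DecompositionVertices C v a b w) : IsTightSpan C v a b {v}ᶜ where
  tight := hC.tight_compl_of_deg hV h.deg_left
  left_mem := by simp [h.ne_av]
  right_mem := by simp [h.ne_bv]
  notMem := by simp
  subset X hX hv ha hb := (h.admissible X hX hv ha hb).ge

/-- Adjacent `a` and `b` would form a tight pair, which is not `V - v` because it misses `w`. -/
theorem not_adj_elimination {v a b w : V}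
    (h : DecompositionVertices C v a b w) : ¬ C.Adj a b := by
  intro hadj
  have h1 := h.admissible {a, b}
    (hC.tight_of_le (ne_univ_of_notMem (x := v) (by simp [h.ne_av.symm, h.ne_bv.symm]))
      (Finset.card_pair h.ne_ab).ge (by rw [inner_pair C hadj, Finset.card_pair h.ne_ab]; norm_num))
    (by simp [h.ne_av.symm, h.ne_bv.symm]) (by simp) (by simp)
  have h2 : w ∈ ({v}ᶜ : Finset V) := by simp [h.ne.symm]
  rw [← h1] at h2
  simp [h.ne_aw.symm, h.ne_bw.symm] at h2

/-- The second circuit contains the deleted vertex. -/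
theorem mem_span {v a b w : V} (h : DecompositionVertices C v a b w) {T : Finset V}
    (hT : IsTightSpan C w a b T) : v ∈ T := by
  by_contra hv
  have h1 := h.admissible T hT.tight hv hT.left_mem hT.right_mem
  have h2 : w ∈ ({v}ᶜ : Finset V) := by simp [h.ne.symm]
  rw [← h1] at h2
  exact hT.notMem h2

/-- The second circuit contains all neighbours of the deleted vertex. -/
theorem nbrs_subset_span {v a b w : V} (h : DecompositionVertices C v a b w) {T : Finset V}
    (hT : IsTightSpan C w a b T) : nbrs C v ⊆ T := by
  have hv := hC.mem_span h hT
  have h1 := inner_insert C (Finset.notMem_erase v T)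
  rw [Finset.insert_erase hv, between_singleton, hT.tight.inner_eq] at h1
  have h2 := Finset.card_erase_of_mem hv
  have ha : a ∈ T.erase v := Finset.mem_erase.2 ⟨h.ne_av, hT.left_mem⟩
  have hb : b ∈ T.erase v := Finset.mem_erase.2 ⟨h.ne_bv, hT.right_mem⟩
  -- Without `v` the set `T` is not tight, so `v` has at least `(4|T| - 6 - (4(|T| - 1) - 8)) / 2 =
  -- 3` neighbours in `T`.
  have h3 := hC.inner_le_of_not_tight (ne_univ_of_notMem (Finset.notMem_erase v T))
    (Finset.one_lt_card.2 ⟨a, ha, b, hb, h.ne_ab⟩) (fun ht => by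
      have h4 := h.admissible _ ht (Finset.notMem_erase v T) ha hb
      have h5 : w ∈ ({v}ᶜ : Finset V) := by simp [h.ne.symm]
      rw [← h4] at h5
      exact hT.notMem (Finset.mem_of_mem_erase h5))
  have h4 := deg_eq_card C v
  have h6 := hT.tight.two_le
  rw [h.deg_left] at h4
  have h5 : nbrs C v ∩ T.erase v = nbrs C v :=
    Finset.eq_of_subset_of_card_le Finset.inter_subset_left (by omega)
  exact fun x hx => Finset.mem_of_mem_erase (Finset.inter_eq_left.1 h5 hx)

theorem isCombRes (hsp : C.IsSpanning) (hV : 5 ≤ Fintype.card V) {v a b w : V}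
    (h : DecompositionVertices C v a b w) {T : Finset V} (hT : IsTightSpan C w a b T) :
    IsCombRes C (spanGraph C (({v}ᶜ : Finset V) : Set V) a b) (spanGraph C T a b) s(a, b) := by
  have hadj := hC.not_adj_elimination h
  have hA := spanGraph_verts (hC.isTightSpan_compl (by omega) h)
  have hB := spanGraph_verts hT
  refine ⟨fun heq => ?_, Or.inr ⟨h.ne_ab, rfl⟩, Or.inr ⟨h.ne_ab, rfl⟩, ?_⟩
  · rw [heq, hB] at hA
    have := hC.mem_span h hT
    rw [← Finset.mem_coe, hA] at this
    simp at this
  · apply SimpleGraph.Subgraph.ext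
    · ext x
      rw [SimpleGraph.Subgraph.deleteEdges_verts, SimpleGraph.Subgraph.verts_sup, hA, hB]
      simp only [hsp x, Set.mem_union, Finset.mem_coe, true_iff, Finset.mem_compl,
        Finset.mem_singleton]
      by_cases hx : x = v
      · exact Or.inr (hx ▸ hC.mem_span h hT)
      · exact Or.inl hx
    · funext x y
      apply propext
      rw [SimpleGraph.Subgraph.deleteEdges_adj, SimpleGraph.Subgraph.sup_adj]
      simp only [Set.mem_singleton_iff, spanGraph, Finset.mem_coe, Finset.mem_compl,
        Finset.mem_singleton]
      constructor
      · intro hxy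
        refine ⟨?_, fun he => ?_⟩
        · have hsub := hC.nbrs_subset_span h hT
          have hv := hC.mem_span h hT
          by_cases hx : x = v
          · subst hx
            exact Or.inr (Or.inl ⟨hxy, hv, hsub ((mem_nbrs C).2 hxy)⟩)
          · by_cases hy : y = v
            · subst hy
              exact Or.inr (Or.inl ⟨hxy, hsub ((mem_nbrs C).2 hxy.symm), hv⟩)
            · exact Or.inl (Or.inl ⟨hxy, hx, hy⟩)
        · rcases Sym2.eq_iff.1 he with ⟨rfl, rfl⟩ | ⟨rfl, rfl⟩
          exacts [hadj hxy, hadj hxy.symm]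
      · rintro ⟨(h1 | h1) | (h1 | h1), h2⟩
        exacts [h1.1, absurd h1.2 h2, h1.1, absurd h1.2 h2]

end CircuitCount

end Decomposition

/-! ### Orientations of bounded load by the push-relabel method -/

section PushRelabel

open Finset

/-- The edges of the graph with adjacency matrix `α` can be distributed to their endpoints so that
every vertex `x` gets at most `2 - c x` edges, in the form of Hall's condition. -/
def Feasible (N : ℕ) (α : ℕ → ℕ → ℕ) (c : ℕ → ℕ) : Prop :=
  ∀ S ⊆ range N, (∑ x ∈ S, ∑ y ∈ S, α x y) + 2 * (∑ x ∈ S, c x) ≤ 4 * S.card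

/-- The states of the push-relabel method: `O x y = 1` if the edge `s(x, y)` is given to `x`,
`l x` is the load of `x`, consisting of these edges and the initial load `c x`, and `h x` is the
height of `x`. -/
structure Valid (N : ℕ) (α : ℕ → ℕ → ℕ) (c : ℕ → ℕ) (O : ℕ → ℕ → ℕ) (l h : ℕ → ℕ) : Prop where
  split : ∀ x < N, ∀ y < N, O x y + O y x = α x y
  load : ∀ x < N, l x = c x + ∑ y ∈ range N, O x y
  height : ∀ x < N, ∀ y < N, O x y ≠ 0 → h x ≤ h y + 1
  full : ∀ x < N, h x ≠ 0 → 2 ≤ l x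

/-- The potential that decreases in every step. -/
def potential (N : ℕ) (O : ℕ → ℕ → ℕ) (h : ℕ → ℕ) : ℤ :=
  (∑ x ∈ range N, ((N : ℤ) - h x) * (N + 1)) + ∑ x ∈ range N, ∑ y ∈ range N, (O x y : ℤ) * h x

variable {N : ℕ} {α : ℕ → ℕ → ℕ} {c : ℕ → ℕ} {O O' : ℕ → ℕ → ℕ} {l l' h h' : ℕ → ℕ}

theorem potential_nonneg (hh : ∀ x < N, h x ≤ N) : 0 ≤ potential N O h := by
  refine add_nonneg (sum_nonneg fun x hx => mul_nonneg ?_ (by positivity)) (by positivity)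
  have := hh x (mem_range.1 hx)
  omega

namespace Valid

/-- Every edge inside `S` is charged to one of its endpoints in `S`, and no load exceeds two. -/
theorem feasible_of_load_le (hv : Valid N α c O l h) (hl : ∀ x < N, l x ≤ 2) :
    Feasible N α c := by
  intro S hS
  have hS' : ∀ x ∈ S, x < N := fun x hx => mem_range.1 (hS hx)
  have h1 : ∑ x ∈ S, ∑ y ∈ S, α x y = 2 * ∑ x ∈ S, ∑ y ∈ S, O x y := by
    have : ∑ x ∈ S, ∑ y ∈ S, α x y = ∑ x ∈ S, ∑ y ∈ S, (O x y + O y x) :=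
      sum_congr rfl fun x hx => sum_congr rfl fun y hy => (hv.split x (hS' x hx) y (hS' y hy)).symm
    rw [this]
    simp only [sum_add_distrib]
    rw [sum_comm (f := fun x y => O y x)]
    ring
  have h2 : ∑ x ∈ S, (c x + ∑ y ∈ S, O x y) ≤ ∑ x ∈ S, 2 := by
    refine sum_le_sum fun x hx => ?_
    have h3 := hl x (hS' x hx)
    rw [hv.load x (hS' x hx)] at h3
    exact (Nat.add_le_add_left (sum_le_sum_of_subset hS) _).trans h3
  rw [sum_add_distrib, sum_const, smul_eq_mul] at h2
  omega

/-- Overloaded vertices have small height, as otherwise the vertices above a gap in the sequence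
of heights violate Hall's condition. -/
theorem height_lt (hv : Valid N α c O l h) (hf : Feasible N α c) {x : ℕ} (hx : x < N)
    (hl : 2 < l x) : h x < N := by
  by_contra! hN
  -- The vertex `x` is at height at least `N`, and the other `N - 1` vertices cannot occupy all `N`
  -- levels below.
  obtain ⟨k, hk, hgap⟩ : ∃ k < N, ∀ y < N, h y ≠ k := by
    by_contra! hall
    have hsub : range N ⊆ ((range N).erase x).image h := by
      intro k hk
      obtain ⟨y, hy, hyk⟩ := hall k (mem_range.1 hk)
      refine mem_image.2 ⟨y, mem_erase.2 ⟨?_, mem_range.2 hy⟩, hyk⟩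
      rintro rfl
      have := mem_range.1 hk
      omega
    have h1 := (card_le_card hsub).trans card_image_le
    rw [card_erase_of_mem (mem_range.2 hx), card_range] at h1
    omega
  set S := (range N).filter fun y => k < h y with hS
  have memS : ∀ y, y ∈ S ↔ y < N ∧ k < h y := by simp [hS]
  have hxS : x ∈ S := (memS x).2 ⟨hx, by omega⟩
  have h1 : ∀ y ∈ S, l y = c y + ∑ z ∈ S, O y z := by
    intro y hy
    rw [memS] at hy
    rw [hv.load y hy.1]
    congr 1
    symm
    -- An edge descends by at most one level and so cannot cross the empty level `k`.
    refine sum_subset (filter_subset _ _) fun z hz hzS => ?_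
    by_contra hO
    have h2 := hv.height y hy.1 z (mem_range.1 hz) hO
    have h3 := hgap z (mem_range.1 hz)
    exact hzS ((memS z).2 ⟨mem_range.1 hz, by omega⟩)
  have h2 : ∑ y ∈ S, 2 < ∑ y ∈ S, l y :=
    sum_lt_sum (fun y hy => hv.full y ((memS y).1 hy).1 (by have := ((memS y).1 hy).2; omega))
      ⟨x, hxS, hl⟩
  rw [sum_congr rfl h1, sum_add_distrib, sum_const, smul_eq_mul] at h2
  have h3 : ∑ x ∈ S, ∑ y ∈ S, α x y = 2 * ∑ x ∈ S, ∑ y ∈ S, O x y := by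
    have : ∑ x ∈ S, ∑ y ∈ S, α x y = ∑ x ∈ S, ∑ y ∈ S, (O x y + O y x) :=
      sum_congr rfl fun x hx => sum_congr rfl fun y hy =>
        (hv.split x ((memS x).1 hx).1 y ((memS y).1 hy).1).symm
    rw [this]
    simp only [sum_add_distrib]
    rw [sum_comm (f := fun x y => O y x)]
    ring
  have h4 := hf S (filter_subset _ _)
  omega

/-- The edge passes from height `h x` to the smaller height `h y`, which lowers the second sum of
the potential. -/
theorem push (hv : Valid N α c O l h) (hα : ∀ x < N, ∀ y < N, α x y ≤ 1) {x y : ℕ} (hx : x < N)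
    (hy : y < N) (hl : 2 < l x) (hO : O x y ≠ 0) (hxy : h y < h x)
    (hO' : ∀ p < N, ∀ q < N, O' p q =
      if p = y ∧ q = x then 1 else if p = x ∧ q = y then 0 else O p q)
    (hl' : ∀ p < N, l' p = if p = y then l y + 1 else if p = x then l x - 1 else l p) :
    Valid N α c O' l' h ∧ potential N O' h + 1 ≤ potential N O h := by
  have hne : x ≠ y := by rintro rfl; omega
  have h1 := hv.split x hx y hy
  have h2 := hα x hx y hy
  have hO1 : O x y = 1 := by omega
  have hO2 : O y x = 0 := by omega
  -- Stated additively, to avoid truncated subtraction when the rows are summed.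
  have key : ∀ p < N, ∀ q < N, O' p q + (if p = x then if q = y then 1 else 0 else 0) =
      O p q + (if p = y then if q = x then 1 else 0 else 0) := by
    intro p hp q hq
    rw [hO' p hp q hq]
    by_cases a1 : p = x
    · subst a1
      by_cases a2 : q = y
      · subst a2; simp [hne, hO1]
      · simp [hne, a2]
    · by_cases a2 : p = y
      · subst a2
        by_cases a3 : q = x
        · subst a3; simp [a1, hO2]
        · simp [a1, a3]
      · simp [a1, a2]
  have rows : ∀ p < N, (∑ q ∈ range N, O' p q) + (if p = x then 1 else 0) =
      (∑ q ∈ range N, O p q) + (if p = y then 1 else 0) := by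
    intro p hp
    have := sum_congr rfl fun q (hq : q ∈ range N) => key p hp q (mem_range.1 hq)
    rw [sum_add_distrib, sum_add_distrib] at this
    by_cases a1 : p = x <;> by_cases a2 : p = y <;> simp [a1, a2, hx, hy] at this ⊢ <;> omega
  refine ⟨⟨?_, ?_, ?_, ?_⟩, ?_⟩
  · intro p hp q hq
    rw [hO' p hp q hq, hO' q hq p hp]
    have := hv.split p hp q hq
    by_cases a1 : p = x ∧ q = y
    · obtain ⟨rfl, rfl⟩ := a1
      simp [hne]
      omega
    · by_cases a2 : p = y ∧ q = x
      · obtain ⟨rfl, rfl⟩ := a2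
        simp [hne.symm]
        omega
      · have a3 : ¬ (q = x ∧ p = y) := fun h => a2 h.symm
        have a4 : ¬ (q = y ∧ p = x) := fun h => a1 h.symm
        simp [a1, a2, a3, a4, this]
  · intro p hp
    have r := rows p hp
    have e := hv.load p hp
    rw [hl' p hp]
    split_ifs at r ⊢ <;> subst_vars <;> omega
  · intro p hp q hq hpq
    rw [hO' p hp q hq] at hpq
    split_ifs at hpq with a1 a2
    · rw [a1.1, a1.2]; omega
    · exact absurd rfl hpq
    · exact hv.height p hp q hq hpq
  · intro p hp hh
    have := hv.full p hp hh
    rw [hl' p hp]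
    split_ifs <;> subst_vars <;> omega
  · unfold potential
    have e : ∑ p ∈ range N, ∑ q ∈ range N, (O' p q : ℤ) * h p + h x =
        ∑ p ∈ range N, ∑ q ∈ range N, (O p q : ℤ) * h p + h y := by
      have e1 : ∀ p ∈ range N, ((∑ q ∈ range N, (O' p q : ℤ)) + (if p = x then 1 else 0)) * h p =
          ((∑ q ∈ range N, (O p q : ℤ)) + (if p = y then 1 else 0)) * h p := by
        intro p hp
        congr 1
        exact_mod_cast rows p (mem_range.1 hp)
      have e2 := sum_congr rfl e1
      simpa [add_mul, sum_add_distrib, sum_mul, hx, hy] using e2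
    have : (h y : ℤ) + 1 ≤ h x := by exact_mod_cast hxy
    linarith

/-- The first sum of the potential drops by `N + 1`, while the second grows by the number of edges
held by `x`, at most `N`. This explains the weight `N + 1`. -/
theorem relabel (hv : Valid N α c O l h) (hα : ∀ x < N, ∀ y < N, α x y ≤ 1) {x : ℕ} (hx : x < N)
    (hl : 2 < l x) (hlow : ∀ y < N, O x y ≠ 0 → h x ≤ h y)
    (hh' : ∀ p < N, h' p = if p = x then h x + 1 else h p) :
    Valid N α c O l h' ∧ potential N O h' + 1 ≤ potential N O h := by
  refine ⟨⟨hv.split, hv.load, ?_, ?_⟩, ?_⟩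
  · intro p hp q hq hpq
    have h1 := hv.height p hp q hq hpq
    rw [hh' p hp, hh' q hq]
    split_ifs with a1 a2 a2
    · omega
    · subst a1
      have := hlow q hq hpq
      omega
    · subst a2; omega
    · exact h1
  · intro p hp hpp
    rw [hh' p hp] at hpp
    split_ifs at hpp with a1
    · subst a1; omega
    · exact hv.full p hp hpp
  · have e1 : ∑ p ∈ range N, ((N : ℤ) - h' p) * (N + 1) =
        ∑ p ∈ range N, ((N : ℤ) - h p) * (N + 1) - (N + 1) := by
      have : ∀ p ∈ range N, ((N : ℤ) - h' p) * (N + 1) =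
          ((N : ℤ) - h p) * (N + 1) - if p = x then (N + 1 : ℤ) else 0 := by
        intro p hp
        rw [hh' p (mem_range.1 hp)]
        split_ifs with a
        · subst a; push_cast; ring
        · ring
      rw [sum_congr rfl this, sum_sub_distrib]
      simp [hx]
    have e2 : ∑ p ∈ range N, ∑ q ∈ range N, (O p q : ℤ) * h' p =
        ∑ p ∈ range N, ∑ q ∈ range N, (O p q : ℤ) * h p + ∑ q ∈ range N, (O x q : ℤ) := by
      have : ∀ p ∈ range N, ∑ q ∈ range N, (O p q : ℤ) * h' p =
          ∑ q ∈ range N, (O p q : ℤ) * h p + if p = x then ∑ q ∈ range N, (O p q : ℤ) else 0 := by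
        intro p hp
        rw [hh' p (mem_range.1 hp)]
        split_ifs with a
        · subst a
          rw [← sum_add_distrib]
          exact sum_congr rfl fun q _ => by push_cast; ring
        · simp
      rw [sum_congr rfl this, sum_add_distrib]
      simp [hx]
    have e3 : ∑ q ∈ range N, (O x q : ℤ) ≤ ∑ q ∈ range N, 1 := by
      refine sum_le_sum fun q hq => ?_
      have h1 := hv.split x hx q (mem_range.1 hq)
      have h2 := hα x hx q (mem_range.1 hq)
      omega
    simp only [sum_const, card_range, nsmul_eq_mul, mul_one] at e3
    unfold potential
    linarith

end Valid

theorem valid_initial (hα : ∀ x < N, ∀ y < N, α x y = α y x) (hα' : ∀ x < N, α x x = 0)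
    (hO : ∀ x < N, ∀ y < N, O x y = if x < y then α x y else 0)
    (hl : ∀ x < N, l x = c x + ∑ y ∈ range N, O x y) (hh : ∀ x < N, h x = 0) :
    Valid N α c O l h ∧ potential N O h = N * N * (N + 1) := by
  refine ⟨⟨fun x hx y hy => ?_, hl, fun x hx y hy _ => by rw [hh x hx]; omega,
    fun x hx h0 => absurd (hh x hx) h0⟩, ?_⟩
  · rw [hO x hx y hy, hO y hy x hx]
    rcases lt_trichotomy x y with h | rfl | h
    · simp [h, h.le]
    · simp [hα' x hx]
    · simp [h, h.le, hα x hx y hy]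
  · unfold potential
    have e1 : ∀ x ∈ range N, ((N : ℤ) - h x) * (N + 1) = N * (N + 1) := by
      intro x hx
      simp [hh x (mem_range.1 hx)]
    have e2 : ∀ x ∈ range N, ∑ y ∈ range N, (O x y : ℤ) * h x = 0 := by
      intro x hx
      simp [hh x (mem_range.1 hx)]
    rw [sum_congr rfl e1, sum_congr rfl e2]
    simp
    ring

end PushRelabel

/-! ### The orientation test as a program

Array `5` holds the offsets of the rows of the adjacency matrix, arrays `6`, `7` and `8` hold the
orientation, the loads and the heights, and the result is put into array `9`. The deleted vertices
are the variables `20` and `36`, the vertices of initial load two are the variables `21`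
and `22`. -/

section Test

open Stmt Finset

/-- The position of a matrix entry; the row and the column are the variables `x` and `y`. -/
def entry (x y : ℕ) : Expr := .add (.read 5 (.var x)) (.var y)

/-- Gives the edge `s(x, y)` to `y` if it is given to `x`, `x` is overloaded, and `y` is lower. -/
def pushStep : Stmt :=
  .cond (.and (.lt (.lit 2) (.read 7 (.var 30)))
      (.and (.read 6 (entry 30 31)) (.lt (.read 8 (.var 31)) (.read 8 (.var 30)))))
    (.seq (.write 6 (entry 30 31) (.lit 0)) (.seq (.write 6 (entry 31 30) (.lit 1))
      (.seq (.write 7 (.var 30) (.sub (.read 7 (.var 30)) (.lit 1)))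
        (.write 7 (.var 31) (.add (.read 7 (.var 31)) (.lit 1))))))
    .skip

/-- Pushes edges away from `x`, and lifts `x` if it remains overloaded. -/
def processVertex : Stmt :=
  .seq (.loop 31 pushStep)
    (.cond (.lt (.lit 2) (.read 7 (.var 30)))
      (.write 8 (.var 30) (.add (.read 8 (.var 30)) (.lit 1))) .skip)

/-- Processes all vertices. -/
def processAll : Stmt := .loop 30 processVertex

/-- Processes all vertices sufficiently often. -/
def processRepeatedly : Stmt := .loop 32 (.loop 33 (.loop 34 (.loop 35 processAll)))

/-- Gives the edge `s(x, y)`, if there is one that remains, to `x` if `x < y`. -/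
def assignEdge : Stmt :=
  .cond
    (.and (.read 1 (entry 30 31)) (.and (.lt (.var 30) (.var 31))
      (.and (.ne (.var 30) (.var 20)) (.and (.ne (.var 30) (.var 36))
        (.and (.ne (.var 31) (.var 20)) (.ne (.var 31) (.var 36)))))))
    (.seq (.write 6 (entry 30 31) (.lit 1))
      (.write 7 (.var 30) (.add (.read 7 (.var 30)) (.lit 1))))
    (.write 6 (entry 30 31) (.lit 0))

/-- Gives every edge to its endpoint with the smaller number. -/
def assignEdges : Stmt :=
  .loop 30 (.seq (.write 8 (.var 30) (.lit 0))
    (.seq (.cond (.and (.ne (.var 30) (.var 21)) (.ne (.var 30) (.var 22)))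
        (.write 7 (.var 30) (.lit 0)) (.write 7 (.var 30) (.lit 2)))
      (.loop 31 assignEdge)))

/-- Tests if there is no overloaded vertex. -/
def checkLoads : Stmt :=
  .seq (.write 9 (.lit 0) (.lit 1))
    (.loop 30 (.cond (.lt (.lit 2) (.read 7 (.var 30))) (.write 9 (.lit 0) (.lit 0)) .skip))

/-- The test for the existence of an orientation of bounded load. -/
def orientationTest : Stmt := .seq assignEdges (.seq processRepeatedly checkLoads)

/-! ### Correctness of the orientation test -/

theorem entry_inj {N x y p q : ℕ} (hy : y < N) (hq : q < N) :
    p * N + q = x * N + y ↔ p = x ∧ q = y := by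
  constructor
  · intro h
    have h1 := congrArg (· / N) h
    have h2 := congrArg (· % N) h
    have hN : 0 < N := by omega
    simp only [Nat.mul_add_mod_of_lt hy, Nat.mul_add_mod_of_lt hq] at h2
    rw [h2] at h
    exact ⟨Nat.eq_of_mul_eq_mul_right hN (by omega), h2⟩
  · rintro ⟨rfl, rfl⟩
    rfl

/-- Cell `0` of array `0` contains `N`, and array `5` the offsets of the rows. -/
structure HasOffsets (N : ℕ) (m : Memory) : Prop where
  size : m 0 0 = N
  offset : ∀ x < N, m 5 x = x * N

theorem HasOffsets.congr {N : ℕ} {m m' : Memory} (h : HasOffsets N m) (h0 : m' 0 = m 0)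
    (h5 : m' 5 = m 5) : HasOffsets N m' :=
  ⟨by rw [h0, h.size], by rw [h5]; exact h.offset⟩

/-- The memory contains a state of the push-relabel method. -/
def StoresValid (N : ℕ) (α : ℕ → ℕ → ℕ) (c : ℕ → ℕ) (m : Memory) : Prop :=
  Valid N α c (fun x y => m 6 (x * N + y)) (m 7) (m 8)

/-- The potential of the state in the memory. -/
def storedPotential (N : ℕ) (m : Memory) : ℤ := potential N (fun x y => m 6 (x * N + y)) (m 8)

variable {N : ℕ} {α : ℕ → ℕ → ℕ} {c : ℕ → ℕ}

theorem den_pushStep_of_not {m : Memory} {x y : ℕ} (ho : HasOffsets N m) (hx : x < N)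
    (hmx : m 30 0 = x) (hmy : m 31 0 = y)
    (h : ¬ (2 < m 7 x ∧ m 6 (x * N + y) ≠ 0 ∧ m 8 y < m 8 x)) : pushStep.den m = m := by
  have ox := ho.offset x hx
  simp only [pushStep, Stmt.den]
  rw [if_neg]
  · rfl
  · simpa [entry, hmx, hmy, ox] using h

theorem den_pushStep {m : Memory} {x y : ℕ} (ho : HasOffsets N m) (hx : x < N) (hy : y < N)
    (hmx : m 30 0 = x) (hmy : m 31 0 = y) (h1 : 2 < m 7 x) (h2 : m 6 (x * N + y) ≠ 0)
    (h3 : m 8 y < m 8 x) :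
    pushStep.den m 6 = Function.update (Function.update (m 6) (x * N + y) 0) (y * N + x) 1 ∧
    pushStep.den m 7 = Function.update (Function.update (m 7) x (m 7 x - 1)) y (m 7 y + 1) ∧
    pushStep.den m 8 = m 8 := by
  have ox := ho.offset x hx
  have oy := ho.offset y hy
  have hxy : y ≠ x := by rintro rfl; omega
  simp only [pushStep, Stmt.den]
  rw [if_pos]
  · simp [setCell, entry, hmx, hmy, ox, oy, hxy]
  · simp [entry, hmx, hmy, ox, h1, h2, h3]

/-- If `x` stays overloaded, it keeps no edge to a lower vertex, as lifting requires. Each push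
lowers the load of `x` by one and the potential by at least one, so a drop of the load certifies a
drop of the potential. -/
theorem den_pushLoop (hα : ∀ x < N, ∀ y < N, α x y ≤ 1) {m : Memory} (ho : HasOffsets N m)
    {x : ℕ} (hx : x < N) (hmx : m 30 0 = x) (hv : StoresValid N α c m) :
    let m' := (Stmt.loop 31 pushStep).den m
    StoresValid N α c m' ∧ m' 8 = m 8 ∧
      (∀ y < N, 2 < m' 7 x → m' 6 (x * N + y) ≠ 0 → m 8 x ≤ m 8 y) ∧
      storedPotential N m' + m 7 x ≤ storedPotential N m + m' 7 x ∧ m' 7 x ≤ m 7 x ∧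
      (m 7 x ≤ 2 → m' 7 = m 7) := by
  have := den_loop (a := 31) (p := pushStep) (m := m) (by decide) (fun i m' =>
    StoresValid N α c m' ∧ m' 8 = m 8 ∧
      (∀ y < i, 2 < m' 7 x → m' 6 (x * N + y) ≠ 0 → m 8 x ≤ m 8 y) ∧
      storedPotential N m' + m 7 x ≤ storedPotential N m + m' 7 x ∧ m' 7 x ≤ m 7 x ∧
      (m 7 x ≤ 2 → m' 7 = m 7)) ?_ ?_
  · rwa [ho.size] at this
  · have e6 : setCell m 31 0 0 6 = m 6 := setCell_of_ne _ _ _ (by decide)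
    have e7 : setCell m 31 0 0 7 = m 7 := setCell_of_ne _ _ _ (by decide)
    have e8 : setCell m 31 0 0 8 = m 8 := setCell_of_ne _ _ _ (by decide)
    simp only [StoresValid, storedPotential, e6, e7, e8]
    exact ⟨hv, trivial, fun y hy => absurd hy (by omega), le_rfl, le_rfl, fun _ => trivial⟩
  · rintro y m' hy ⟨i1, i2, i3, i4, i5, i6⟩ hm'y hfr
    rw [ho.size] at hy
    have ho' := ho.congr (hfr 0 (by decide)) (hfr 5 (by decide))
    have hm'x : m' 30 0 = x := by rw [hfr 30 (by decide), hmx]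
    have e6 := setCell_of_ne (pushStep.den m') (a := 31) (b := 6) 0 (y + 1) (by decide)
    have e7 := setCell_of_ne (pushStep.den m') (a := 31) (b := 7) 0 (y + 1) (by decide)
    have e8 := setCell_of_ne (pushStep.den m') (a := 31) (b := 8) 0 (y + 1) (by decide)
    simp only [StoresValid, storedPotential, e6, e7, e8]
    simp only [StoresValid, storedPotential] at i1 i4
    by_cases hc : 2 < m' 7 x ∧ m' 6 (x * N + y) ≠ 0 ∧ m' 8 y < m' 8 x
    · obtain ⟨c1, c2, c3⟩ := hc
      obtain ⟨d6, d7, d8⟩ := den_pushStep ho' hx hy hm'x hm'y c1 c2 c3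
      have hxy : x ≠ y := by rintro rfl; omega
      obtain ⟨v1, v2⟩ := i1.push (O' := fun p q => pushStep.den m' 6 (p * N + q))
        (l' := pushStep.den m' 7) hα hx hy c1 c2 c3
        (fun p hp q hq => by
          simp only [d6, Function.update_apply, entry_inj hy hq, entry_inj hx hq])
        (fun p hp => by simp only [d7, Function.update_apply])
      have l1 : pushStep.den m' 7 x = m' 7 x - 1 := by simp [d7, hxy]
      rw [d8, l1]
      refine ⟨v1, i2, ?_, by omega, by omega, fun h => absurd c1 (by omega)⟩
      intro q hq hl hO
      rcases Nat.lt_succ_iff_lt_or_eq.1 hq with h | rfl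
      · refine i3 q h (by omega) ?_
        rw [d6, Function.update_apply, if_neg, Function.update_apply, if_neg] at hO
        · exact hO
        · rw [entry_inj hy (by omega)]
          omega
        · rw [entry_inj hx (by omega)]
          omega
      · rw [d6, Function.update_apply, if_neg, Function.update_self] at hO
        · exact absurd rfl hO
        · rw [entry_inj hx hy]
          omega
    · rw [den_pushStep_of_not ho' hx hm'x hm'y hc]
      refine ⟨i1, i2, ?_, i4, i5, i6⟩
      intro q hq hl hO
      rcases Nat.lt_succ_iff_lt_or_eq.1 hq with h | rfl
      · exact i3 q h hl hO
      · rw [i2] at hc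
        by_contra hlt
        exact hc ⟨hl, hO, by omega⟩

/-- An overloaded vertex either loses load by pushes or is lifted, and both lower the potential.
Only overloaded vertices are lifted, and these are below height `N` in a feasible instance. -/
theorem den_processVertex (hα : ∀ x < N, ∀ y < N, α x y ≤ 1) {m : Memory} (ho : HasOffsets N m)
    {x : ℕ} (hx : x < N) (hmx : m 30 0 = x) (hv : StoresValid N α c m) :
    let m' := processVertex.den m
    StoresValid N α c m' ∧ storedPotential N m' ≤ storedPotential N m ∧
      (2 < m 7 x → storedPotential N m' + 1 ≤ storedPotential N m) ∧
      (m 7 x ≤ 2 → m' 7 = m 7) ∧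
      (Feasible N α c → (∀ p < N, m 8 p ≤ N) → ∀ p < N, m' 8 p ≤ N) := by
  obtain ⟨i1, i2, i3, i4, i5, i6⟩ := den_pushLoop hα ho hx hmx hv
  have hfr : (Stmt.loop 31 pushStep).den m 30 = m 30 := den_frame _ _ (by decide)
  simp only [processVertex]
  rw [Stmt.den_seq]
  set m' := (Stmt.loop 31 pushStep).den m
  have hm'x : m' 30 0 = x := by rw [hfr, hmx]
  by_cases hl : 2 < m' 7 x
  · have hden : (Stmt.cond (.lt (.lit 2) (.read 7 (.var 30)))
        (.write 8 (.var 30) (.add (.read 8 (.var 30)) (.lit 1))) .skip).den m' =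
        setCell m' 8 x (m' 8 x + 1) := by
      simp only [Stmt.den]
      rw [if_pos (by simpa [hm'x] using hl)]
      simp [hm'x]
    rw [hden]
    have e6 := setCell_of_ne m' (a := 8) (b := 6) x (m' 8 x + 1) (by decide)
    have e7 := setCell_of_ne m' (a := 8) (b := 7) x (m' 8 x + 1) (by decide)
    obtain ⟨v1, v2⟩ := Valid.relabel (h' := setCell m' 8 x (m' 8 x + 1) 8) i1 hα hx hl
      (fun y hy hO => by rw [i2]; exact i3 y hy hl hO)
      (fun p hp => by simp only [setCell_apply, true_and])
    simp only [StoresValid, storedPotential, e6, e7] at i4 ⊢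
    refine ⟨v1, by omega, fun _ => by omega, i6, fun hf hb p hp => ?_⟩
    have hlt := i1.height_lt hf hx hl
    have hp' := hb p hp
    rw [← i2] at hp'
    simp only [setCell_apply, true_and]
    split_ifs
    · omega
    · exact hp'
  · have hden : (Stmt.cond (.lt (.lit 2) (.read 7 (.var 30)))
        (.write 8 (.var 30) (.add (.read 8 (.var 30)) (.lit 1))) .skip).den m' = m' := by
      simp only [Stmt.den]
      rw [if_neg (by simpa [hm'x] using hl)]
      rfl
    rw [hden]
    exact ⟨i1, by omega, fun _ => by omega, i6, fun _ hb => by rwa [i2]⟩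

theorem den_processAll (hα : ∀ x < N, ∀ y < N, α x y ≤ 1) {m : Memory} (ho : HasOffsets N m)
    (hv : StoresValid N α c m) :
    let m' := processAll.den m
    StoresValid N α c m' ∧ (Feasible N α c → (∀ p < N, m 8 p ≤ N) → ∀ p < N, m' 8 p ≤ N) ∧
      (storedPotential N m' + 1 ≤ storedPotential N m ∨ ∀ x < N, m' 7 x ≤ 2) ∧
      ((∀ x < N, m 7 x ≤ 2) → m' 7 = m 7) := by
  have := den_loop (a := 30) (p := processVertex) (m := m) (by decide) (fun i m' =>
    StoresValid N α c m' ∧ (Feasible N α c → (∀ p < N, m 8 p ≤ N) → ∀ p < N, m' 8 p ≤ N) ∧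
      -- Either the potential has already dropped, or no load has changed and no vertex seen so far
      -- is overloaded.
      (storedPotential N m' + 1 ≤ storedPotential N m ∨
        storedPotential N m' ≤ storedPotential N m ∧ m' 7 = m 7 ∧ ∀ x < i, m 7 x ≤ 2) ∧
      ((∀ x < N, m 7 x ≤ 2) → m' 7 = m 7)) ?_ ?_
  · rw [ho.size] at this
    obtain ⟨h1, h2, h3, h4⟩ := this
    refine ⟨h1, h2, h3.imp_right fun h x hx => ?_, h4⟩
    rw [processAll, h.2.1]
    exact h.2.2 x hx
  · have e6 := setCell_of_ne m (a := 30) (b := 6) 0 0 (by decide)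
    have e7 := setCell_of_ne m (a := 30) (b := 7) 0 0 (by decide)
    have e8 := setCell_of_ne m (a := 30) (b := 8) 0 0 (by decide)
    simp only [StoresValid, storedPotential, e6, e7, e8]
    exact ⟨hv, fun _ h => h, Or.inr ⟨le_rfl, trivial, fun x hx => absurd hx (by omega)⟩,
      fun _ => trivial⟩
  · rintro x m' hx ⟨i1, i2, i3, i4⟩ hm'x hfr
    rw [ho.size] at hx
    have ho' := ho.congr (hfr 0 (by decide)) (hfr 5 (by decide))
    obtain ⟨p1, p2, p3, p4, p5⟩ := den_processVertex hα ho' hx hm'x i1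
    have e6 := setCell_of_ne (processVertex.den m') (a := 30) (b := 6) 0 (x + 1) (by decide)
    have e7 := setCell_of_ne (processVertex.den m') (a := 30) (b := 7) 0 (x + 1) (by decide)
    have e8 := setCell_of_ne (processVertex.den m') (a := 30) (b := 8) 0 (x + 1) (by decide)
    simp only [StoresValid, storedPotential, e6, e7, e8] at *
    refine ⟨p1, fun hf hb => p5 hf (i2 hf hb), ?_, fun hs => ?_⟩
    · rcases i3 with i3 | ⟨i3, i3', i3''⟩
      · exact Or.inl (by omega)
      · by_cases hl : 2 < m' 7 x
        · have := p3 hl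
          exact Or.inl (by omega)
        · refine Or.inr ⟨by omega, by rw [p4 (by omega), i3'], fun q hq => ?_⟩
          rcases Nat.lt_succ_iff_lt_or_eq.1 hq with h | rfl
          · exact i3'' q h
          · rw [← i3']; omega
    · have h1 := i4 hs
      rw [p4 (by rw [h1]; exact hs x hx), h1]

/-- The effect of `k` rounds. -/
structure AfterRounds (N : ℕ) (α : ℕ → ℕ → ℕ) (c : ℕ → ℕ) (k : ℕ) (m : Memory) : Prop where
  offsets : HasOffsets N m
  valid : StoresValid N α c m
  height_le : Feasible N α c → ∀ p < N, m 8 p ≤ N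
  progress : storedPotential N m + k ≤ N * N * (N + 1) ∨ ∀ x < N, m 7 x ≤ 2

theorem AfterRounds.congr {k : ℕ} {m : Memory} (h : AfterRounds N α c k m) {a : ℕ} (ha : 30 ≤ a)
    (v : ℕ) : AfterRounds N α c k (setCell m a 0 v) := by
  have e : ∀ b < 30, setCell m a 0 v b = m b := fun b hb => setCell_of_ne _ _ _ (by omega)
  refine ⟨h.offsets.congr (e 0 (by decide)) (e 5 (by decide)), ?_, ?_, ?_⟩
  · simpa only [StoresValid, e 6 (by decide), e 7 (by decide), e 8 (by decide)] using h.valid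
  · simpa only [e 8 (by decide)] using h.height_le
  · simpa only [storedPotential, e 6 (by decide), e 7 (by decide), e 8 (by decide)] using h.progress

theorem AfterRounds.step (hα : ∀ x < N, ∀ y < N, α x y ≤ 1) {k : ℕ} {m : Memory}
    (h : AfterRounds N α c k m) : AfterRounds N α c (k + 1) (processAll.den m) := by
  obtain ⟨p1, p2, p3, p4⟩ := den_processAll hα h.offsets h.valid
  refine ⟨h.offsets.congr (den_frame _ _ (by decide)) (den_frame _ _ (by decide)), p1,
    fun hf => p2 hf (h.height_le hf), ?_⟩
  rcases h.progress with h1 | h1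
  · rcases p3 with p3 | p3
    · left
      push_cast
      omega
    · exact Or.inr p3
  · right
    rw [p4 h1]
    exact h1

theorem AfterRounds.den_processRepeatedly (hα : ∀ x < N, ∀ y < N, α x y ≤ 1) {m : Memory}
    (h : AfterRounds N α c 0 m) :
    AfterRounds N α c (N * (N * (N * (N * 1)))) (processRepeatedly.den m) := by
  have key : ∀ (a : ℕ) (p : Stmt) (d : ℕ), 30 ≤ a → (Stmt.loop a p).wf →
      (∀ k (m : Memory), m 0 0 = N → AfterRounds N α c k m → AfterRounds N α c (k + d) (p.den m)) →
      ∀ k (m : Memory), m 0 0 = N → AfterRounds N α c k m →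
        AfterRounds N α c (k + N * d) ((Stmt.loop a p).den m) :=
    fun a p d ha hwf hp k m hm h => den_loop_repeat hwf _ (fun _ _ v h => h.congr ha v) hp hm h
  have := key 32 _ _ (by decide) (by decide) (key 33 _ _ (by decide) (by decide)
    (key 34 _ _ (by decide) (by decide) (key 35 processAll 1 (by decide) (by decide)
      fun k m _ h => h.step hα))) 0 m h.offsets.size h
  rwa [Nat.zero_add] at this

/-- The initial potential `N²(N + 1)` is less than the number `N⁴` of rounds when `N ≥ 2`. In a
feasible instance the potential stays nonnegative, so it cannot have dropped in every round. In an
infeasible one the heights need no bound, since some vertex is overloaded in any case. -/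
theorem AfterRounds.load_le_iff {m : Memory} (hN : 2 ≤ N)
    (h : AfterRounds N α c (N * (N * (N * (N * 1)))) m) :
    (∀ x < N, m 7 x ≤ 2) ↔ Feasible N α c := by
  refine ⟨fun hl => h.valid.feasible_of_load_le hl, fun hf => ?_⟩
  refine h.progress.resolve_left fun hp => ?_
  have h1 : 0 ≤ storedPotential N m := potential_nonneg (h.height_le hf)
  have h2 : (2 : ℤ) ≤ N := by exact_mod_cast hN
  push_cast at hp
  have h3 : (N : ℤ) * N * (N + 1) < N * (N * (N * (N * 1))) := by
    have h4 : (N : ℤ) + 1 < N * N := by nlinarith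
    have h5 : (0 : ℤ) < N * N := by positivity
    have := mul_lt_mul_of_pos_left h4 h5
    linarith
  omega

open Classical in
theorem den_checkLoads {m : Memory} (hN : m 0 0 = N) :
    checkLoads.den m 9 0 = if ∀ x < N, m 7 x ≤ 2 then 1 else 0 := by
  simp only [checkLoads]
  rw [Stmt.den_seq]
  set m₁ := (Stmt.write 9 (.lit 0) (.lit 1)).den m with hm₁
  have e0 : m₁ 0 = m 0 := den_frame _ _ (by decide)
  have e7 : m₁ 7 = m 7 := den_frame _ _ (by decide)
  have := den_loop (a := 30)
    (p := .cond (.lt (.lit 2) (.read 7 (.var 30))) (.write 9 (.lit 0) (.lit 0)) .skip) (m := m₁)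
    (by decide) (fun i m' => m' 9 0 = if ∀ x < i, m 7 x ≤ 2 then 1 else 0) ?_ ?_
  · rwa [e0, hN] at this
  · simp [hm₁, Stmt.den, setCell_apply]
  · intro i m' hi hI hi' hfr
    have h7 : m' 7 = m 7 := by rw [hfr 7 (by decide), e7]
    rw [setCell_of_ne _ _ _ (by decide)]
    by_cases hl : 2 < m 7 i
    · rw [den_cond_pos (by simpa [hi', h7] using hl),
        if_neg (fun h => absurd (h i (by omega)) (by omega))]
      simp [Stmt.den, setCell_apply]
    · rw [den_cond_neg (by simpa [hi', h7] using hl)]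
      simp only [Stmt.den, id, hI]
      refine if_congr ⟨fun h x hx => ?_, fun h x hx => h x (by omega)⟩ rfl rfl
      rcases Nat.lt_succ_iff_lt_or_eq.1 hx with hx | rfl
      · exact h x hx
      · omega

/-- The adjacency matrix `g` after the deletion of two vertices. -/
def deleteTwo (g : ℕ → ℕ → ℕ) (d z : ℕ) (x y : ℕ) : ℕ :=
  if x ≠ d ∧ x ≠ z ∧ y ≠ d ∧ y ≠ z then g x y else 0

/-- An initial load of two at `a` and `b`. -/
def pinned (a b : ℕ) (x : ℕ) : ℕ := if x ≠ a ∧ x ≠ b then 0 else 2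

/-- The memory contains the adjacency matrix `g` of a simple graph on `N` vertices and the offsets
of its rows. -/
structure HasMatrix (N : ℕ) (g : ℕ → ℕ → ℕ) (m : Memory) : Prop extends HasOffsets N m where
  matrix : ∀ x < N, ∀ y < N, m 1 (x * N + y) = g x y
  symm : ∀ x < N, ∀ y < N, g x y = g y x
  loopless : ∀ x < N, g x x = 0
  le_one : ∀ x < N, ∀ y < N, g x y ≤ 1

theorem HasMatrix.congr {g : ℕ → ℕ → ℕ} {m m' : Memory} (h : HasMatrix N g m) (h0 : m' 0 = m 0)
    (h1 : m' 1 = m 1) (h5 : m' 5 = m 5) : HasMatrix N g m' :=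
  ⟨h.toHasOffsets.congr h0 h5, by rw [h1]; exact h.matrix, h.symm, h.loopless, h.le_one⟩

theorem den_assignEdge {g : ℕ → ℕ → ℕ} {m : Memory} (hm : HasMatrix N g m) {x y : ℕ} (hx : x < N)
    (hy : y < N) (hmx : m 30 0 = x) (hmy : m 31 0 = y) {t : ℕ}
    (ht : t = if x < y then deleteTwo g (m 20 0) (m 36 0) x y else 0) :
    assignEdge.den m 6 = Function.update (m 6) (x * N + y) t ∧
    assignEdge.den m 7 = Function.update (m 7) x (m 7 x + t) := by
  have ox := hm.offset x hx
  have h1 := hm.le_one x hx y hy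
  have h2 := hm.matrix x hx y hy
  unfold assignEdge
  by_cases hc : g x y ≠ 0 ∧ x < y ∧ x ≠ m 20 0 ∧ x ≠ m 36 0 ∧ y ≠ m 20 0 ∧ y ≠ m 36 0
  · rw [den_cond_pos (by simpa [entry, hmx, hmy, ox, h2] using hc)]
    have ht1 : t = 1 := by
      rw [ht, if_pos hc.2.1, deleteTwo, if_pos hc.2.2]
      omega
    subst ht1
    simp [Stmt.den, setCell, entry, hmx, hmy, ox]
  · rw [den_cond_neg (by simpa [entry, hmx, hmy, ox, h2] using hc)]
    have ht0 : t = 0 := by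
      rw [ht]
      unfold deleteTwo
      split_ifs with a1 a2
      · by_contra h0
        exact hc ⟨h0, a1, a2⟩
      · rfl
      · rfl
    subst ht0
    simp [Stmt.den, setCell, entry, hmx, hmy, ox]

theorem den_assignRow {g : ℕ → ℕ → ℕ} {m : Memory} (hm : HasMatrix N g m) {x : ℕ} (hx : x < N)
    (hmx : m 30 0 = x) :
    let m' := (Stmt.loop 31 assignEdge).den m
    (∀ p < N, ∀ q < N, m' 6 (p * N + q) =
      if p = x then if x < q then deleteTwo g (m 20 0) (m 36 0) x q else 0 else m 6 (p * N + q)) ∧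
    (∀ p, p ≠ x → m' 7 p = m 7 p) ∧
    m' 7 x = m 7 x + ∑ q ∈ range N, if x < q then deleteTwo g (m 20 0) (m 36 0) x q else 0 := by
  have := den_loop (a := 31) (p := assignEdge) (m := m) (by decide) (fun i m' =>
    (∀ p < N, ∀ q < N, m' 6 (p * N + q) =
      if p = x ∧ q < i then if x < q then deleteTwo g (m 20 0) (m 36 0) x q else 0
      else m 6 (p * N + q)) ∧
    (∀ p, p ≠ x → m' 7 p = m 7 p) ∧
    m' 7 x = m 7 x + ∑ q ∈ range i, if x < q then deleteTwo g (m 20 0) (m 36 0) x q else 0) ?_ ?_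
  · rw [hm.size] at this
    refine ⟨fun p hp q hq => ?_, this.2⟩
    rw [this.1 p hp q hq]
    simp [hq]
  · rw [setCell_of_ne _ _ _ (by decide), setCell_of_ne _ _ _ (by decide)]
    simp
  · rintro y m' hy ⟨i1, i2, i3⟩ hm'y hfr
    rw [hm.size] at hy
    have hm' := hm.congr (hfr 0 (by decide)) (hfr 1 (by decide)) (hfr 5 (by decide))
    have hm'x : m' 30 0 = x := by rw [hfr 30 (by decide), hmx]
    rw [setCell_of_ne _ _ _ (by decide), setCell_of_ne _ _ _ (by decide)]
    obtain ⟨d6, d7⟩ := den_assignEdge hm' hx hy hm'x hm'y rfl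
    rw [hfr 20 (by decide), hfr 36 (by decide)] at d6 d7
    refine ⟨fun p hp q hq => ?_, fun p hp => ?_, ?_⟩
    · rw [d6, Function.update_apply, if_congr (entry_inj hy hq) rfl rfl, i1 p hp q hq]
      by_cases hpx : p = x
      · subst hpx
        rcases lt_trichotomy q y with h | rfl | h
        · simp [h.ne, h, Nat.lt_succ_of_lt h]
        · simp
        · simp [h.ne', h.not_gt, show ¬ q < y + 1 by omega]
      · simp [hpx]
    · rw [d7, Function.update_of_ne hp, i2 p hp]
    · rw [d7, Function.update_self, i3, sum_range_succ, Nat.add_assoc]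

theorem den_assignEdges {g : ℕ → ℕ → ℕ} {m : Memory} (hm : HasMatrix N g m) :
    let m' := assignEdges.den m
    (∀ p < N, ∀ q < N, m' 6 (p * N + q) =
      if p < q then deleteTwo g (m 20 0) (m 36 0) p q else 0) ∧
    (∀ p < N, m' 7 p = pinned (m 21 0) (m 22 0) p +
      ∑ q ∈ range N, if p < q then deleteTwo g (m 20 0) (m 36 0) p q else 0) ∧
    ∀ p < N, m' 8 p = 0 := by
  have := den_loop (a := 30) (p := .seq (.write 8 (.var 30) (.lit 0))
    (.seq (.cond (.and (.ne (.var 30) (.var 21)) (.ne (.var 30) (.var 22)))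
        (.write 7 (.var 30) (.lit 0)) (.write 7 (.var 30) (.lit 2)))
      (.loop 31 assignEdge))) (m := m) (by decide) (fun i m' =>
    (∀ p < N, ∀ q < N, p < i → m' 6 (p * N + q) =
      if p < q then deleteTwo g (m 20 0) (m 36 0) p q else 0) ∧
    (∀ p < i, m' 7 p = pinned (m 21 0) (m 22 0) p +
      ∑ q ∈ range N, if p < q then deleteTwo g (m 20 0) (m 36 0) p q else 0) ∧
    ∀ p < i, m' 8 p = 0) ?_ ?_
  · rw [hm.size] at this
    exact ⟨fun p hp q hq => this.1 p hp q hq hp, this.2.1, this.2.2⟩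
  · simp
  · rintro x m' hx ⟨i1, i2, i3⟩ hm'x hfr
    rw [hm.size] at hx
    rw [setCell_of_ne _ _ _ (by decide), setCell_of_ne _ _ _ (by decide),
      setCell_of_ne _ _ _ (by decide), den_seq, den_seq, den_write]
    set m₁ := setCell m' 8 ((Expr.var 30).eval m') ((Expr.lit 0).eval m') with hm₁
    have f1 : ∀ k, k ≠ 8 → m₁ k = m' k := fun k hk => setCell_of_ne _ _ _ hk
    set s : Stmt := .cond (.and (.ne (.var 30) (.var 21)) (.ne (.var 30) (.var 22)))
        (.write 7 (.var 30) (.lit 0)) (.write 7 (.var 30) (.lit 2)) with hs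
    have f2 : ∀ k, k ≠ 7 → s.den m₁ k = m₁ k := fun k hk => den_frame _ _ (by simpa [s, writes])
    have g7 : s.den m₁ 7 = Function.update (m' 7) x (pinned (m 21 0) (m 22 0) x) := by
      have e30 : m₁ 30 0 = x := by rw [f1 30 (by decide), hm'x]
      have e21 : m₁ 21 = m 21 := by rw [f1 21 (by decide), hfr 21 (by decide)]
      have e22 : m₁ 22 = m 22 := by rw [f1 22 (by decide), hfr 22 (by decide)]
      have e7 : m₁ 7 = m' 7 := f1 7 (by decide)
      by_cases hc : x ≠ m 21 0 ∧ x ≠ m 22 0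
      · rw [hs, den_cond_pos (by simpa [e30, e21, e22] using hc), pinned, if_pos hc]
        simp [Stmt.den, setCell, e30, e7]
      · rw [hs, den_cond_neg (by simpa [e30, e21, e22] using hc), pinned, if_neg hc]
        simp [Stmt.den, setCell, e30, e7]
    have hm₂ : HasMatrix N g (s.den m₁) := hm.congr
      (by rw [f2 0 (by decide), f1 0 (by decide), hfr 0 (by decide)])
      (by rw [f2 1 (by decide), f1 1 (by decide), hfr 1 (by decide)])
      (by rw [f2 5 (by decide), f1 5 (by decide), hfr 5 (by decide)])
    have e30 : s.den m₁ 30 0 = x := by rw [f2 30 (by decide), f1 30 (by decide), hm'x]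
    have e20 : s.den m₁ 20 = m 20 := by
      rw [f2 20 (by decide), f1 20 (by decide), hfr 20 (by decide)]
    have e36 : s.den m₁ 36 = m 36 := by
      rw [f2 36 (by decide), f1 36 (by decide), hfr 36 (by decide)]
    have e6 : s.den m₁ 6 = m' 6 := by rw [f2 6 (by decide), f1 6 (by decide)]
    have e8 : (Stmt.loop 31 assignEdge).den (s.den m₁) 8 = Function.update (m' 8) x 0 := by
      rw [den_frame _ _ (by decide), f2 8 (by decide), hm₁]
      simp [setCell, hm'x]
    obtain ⟨r1, r2, r3⟩ := den_assignRow hm₂ hx e30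
    rw [e20, e36] at r1 r3
    rw [g7] at r2 r3
    rw [e6] at r1
    rw [Function.update_self] at r3
    refine ⟨fun p hp q hq hpx => ?_, fun p hpx => ?_, fun p hpx => ?_⟩
    · rw [r1 p hp q hq]
      rcases Nat.lt_succ_iff_lt_or_eq.1 hpx with h | rfl
      · rw [if_neg h.ne, i1 p hp q hq h]
      · rw [if_pos rfl]
    · rcases Nat.lt_succ_iff_lt_or_eq.1 hpx with h | rfl
      · rw [r2 p h.ne, Function.update_of_ne h.ne, i2 p h]
      · exact r3
    · rw [e8, Function.update_apply]
      rcases Nat.lt_succ_iff_lt_or_eq.1 hpx with h | rfl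
      · rw [if_neg h.ne, i3 p h]
      · rw [if_pos rfl]

open Classical in
/-- The orientation test decides Hall's condition. -/
theorem den_orientationTest {g : ℕ → ℕ → ℕ} {m : Memory} (hN : 2 ≤ N) (hm : HasMatrix N g m) :
    orientationTest.den m 9 0 = if Feasible N (deleteTwo g (m 20 0) (m 36 0))
      (pinned (m 21 0) (m 22 0)) then 1 else 0 := by
  obtain ⟨a6, a7, a8⟩ := den_assignEdges hm
  have hα : ∀ x < N, ∀ y < N, deleteTwo g (m 20 0) (m 36 0) x y ≤ 1 := by
    intro x hx y hy
    unfold deleteTwo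
    split_ifs
    · exact hm.le_one x hx y hy
    · exact Nat.zero_le 1
  obtain ⟨v1, v2⟩ := valid_initial (N := N) (α := deleteTwo g (m 20 0) (m 36 0))
    (c := pinned (m 21 0) (m 22 0)) (O := fun x y => assignEdges.den m 6 (x * N + y))
    (l := assignEdges.den m 7) (h := assignEdges.den m 8)
    (fun x hx y hy => by
      unfold deleteTwo
      rw [hm.symm x hx y hy]
      exact if_congr (by tauto) rfl rfl)
    (fun x hx => by
      unfold deleteTwo
      rw [hm.loopless x hx, ite_self])
    a6
    (fun x hx => by
      rw [a7 x hx]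
      congr 1
      exact sum_congr rfl fun y hy => (a6 x hx y (mem_range.1 hy)).symm)
    a8
  have h0 : AfterRounds N (deleteTwo g (m 20 0) (m 36 0)) (pinned (m 21 0) (m 22 0)) 0
      (assignEdges.den m) :=
    ⟨hm.toHasOffsets.congr (den_frame _ _ (by decide)) (den_frame _ _ (by decide)), v1,
      fun _ p hp => by rw [a8 p hp]; omega,
      Or.inl (by rw [storedPotential, v2]; simp)⟩
  have h1 := h0.den_processRepeatedly hα
  rw [orientationTest, den_seq, den_seq, den_checkLoads h1.offsets.size]
  exact if_congr (h1.load_le_iff hN) rfl rfl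

end Test

/-! ### The decomposition program -/

section Decompose

open Stmt Finset

/-- Puts the offsets of the rows of the adjacency matrix into array `5`. -/
def computeOffsets : Stmt :=
  .loop 50 (.write 5 (.add (.var 50) (.lit 1)) (.add (.read 5 (.var 50)) (.var 0)))

/-- Puts the degrees into array `29`. -/
def computeDegrees : Stmt :=
  .loop 30 (.loop 31
    (.write 29 (.var 30) (.add (.read 29 (.var 30)) (.read 1 (entry 30 31)))))

/-- Marks in array `23` the vertices of the circuit that avoids the variable `20` and contains
the edge between the variables `21` and `22`. -/
def computeSpan : Stmt := .loop 36 (.seq orientationTest (.write 23 (.var 36) (.var 9)))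

/-- Sets the variable `24` to `1` if array `23` marks all vertices but the variable `40`. -/
def checkSpan : Stmt :=
  .seq (.write 24 (.lit 0) (.lit 1))
    (.loop 44 (.cond (.and (.ne (.var 44) (.var 40)) (.not (.read 23 (.var 44))))
      (.write 24 (.lit 0) (.lit 0)) .skip))

/-- The conditions on the variables `40`, `41`, `42`, `43`. -/
def candidateTest : Expr :=
  .and (.var 24) (.and (.not (.ne (.read 29 (.var 40)) (.lit 3)))
    (.and (.not (.ne (.read 29 (.var 43)) (.lit 3))) (.and (.ne (.var 40) (.var 43))
      (.and (.not (.read 1 (entry 40 43))) (.and (.ne (.var 41) (.var 42))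
        (.and (.ne (.var 41) (.var 40)) (.and (.ne (.var 42) (.var 40))
          (.and (.ne (.var 41) (.var 43)) (.ne (.var 42) (.var 43))))))))))

/-- Copies the variables `40`, `41`, `42`, `43` to `25`, `26`, `27`, `28`. -/
def saveCandidate : Stmt :=
  .seq (.write 25 (.lit 0) (.var 40)) (.seq (.write 26 (.lit 0) (.var 41))
    (.seq (.write 27 (.lit 0) (.var 42)) (.write 28 (.lit 0) (.var 43))))

/-- Computes a span: the variable `src` is avoided, `x` and `y` are contained. -/
def computeSpanOf (src x y : ℕ) : Stmt :=
  .seq (.write 20 (.lit 0) (.var src)) (.seq (.write 21 (.lit 0) (.var x))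
    (.seq (.write 22 (.lit 0) (.var y)) computeSpan))

/-- Saves the variables `40`, `41`, `42`, `43` if they yield a decomposition. -/
def tryCandidate : Stmt :=
  .seq (computeSpanOf 40 41 42) (.seq checkSpan (.cond candidateTest saveCandidate .skip))

/-- Tries all candidates. -/
def search : Stmt := .loop 40 (.loop 41 (.loop 42 (.loop 43 tryCandidate)))

/-- The test for an entry of the output. -/
def outputTest : Expr :=
  .add (.and (.read 1 (entry 30 31)) (.and (.read 23 (.var 30)) (.read 23 (.var 31))))
    (.add (.and (.not (.ne (.var 30) (.var 21))) (.not (.ne (.var 31) (.var 22))))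
      (.and (.not (.ne (.var 30) (.var 22))) (.not (.ne (.var 31) (.var 21)))))

/-- Computes one entry of the output. -/
def outputEntry (dst : ℕ) : Stmt :=
  .cond outputTest (.write dst (entry 30 31) (.lit 1)) (.write dst (entry 30 31) (.lit 0))

/-- Puts the adjacency matrix of a circuit into array `dst`. -/
def outputMatrix (dst : ℕ) : Stmt := .loop 30 (.loop 31 (outputEntry dst))

/-- The decomposition program. -/
def decompose : Stmt :=
  .seq computeOffsets (.seq computeDegrees (.seq search
    (.seq (computeSpanOf 25 26 27) (.seq (outputMatrix 2)
      (.seq (computeSpanOf 28 26 27) (.seq (outputMatrix 3)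
        (.seq (.write 4 (.lit 0) (.var 26)) (.write 4 (.lit 1) (.var 27)))))))))

/-! ### Correctness of the decomposition program -/

variable {N : ℕ} {g : ℕ → ℕ → ℕ}

/-- The vertex `z` lies in the circuit that avoids `d` and contains the edge `s(a, b)`. -/
def InSpan (N : ℕ) (g : ℕ → ℕ → ℕ) (d a b z : ℕ) : Prop :=
  Feasible N (deleteTwo g d z) (pinned a b)

theorem den_computeOffsets {m : Memory} (hN : m 0 0 = N) (h5 : m 5 0 = 0) :
    HasOffsets N (computeOffsets.den m) := by
  refine ⟨by rw [den_zero (by decide), hN], fun x hx => ?_⟩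
  have := den_loop (a := 50)
    (p := .write 5 (.add (.var 50) (.lit 1)) (.add (.read 5 (.var 50)) (.var 0))) (m := m)
    (by decide) (fun i m' => ∀ x ≤ i, m' 5 x = x * N) ?_ ?_
  · rw [hN] at this
    exact this x hx.le
  · intro x hx
    rw [setCell_of_ne _ _ _ (by decide), Nat.le_zero.1 hx, h5, Nat.zero_mul]
  · intro i m' hi hI hi' hfr x hx
    rw [setCell_of_ne _ _ _ (by decide), den_write, setCell_apply]
    have h0 : m' 0 0 = N := by rw [hfr 0 (by decide), hN]
    simp only [Expr.eval_add, Expr.eval_var, Expr.eval_lit, Expr.eval_read, hi', true_and, h0,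
      hI i le_rfl]
    split_ifs with h
    · rw [h, Nat.succ_mul]
    · exact hI x (by omega)

theorem den_computeDegrees {m : Memory} (hm : HasMatrix N g m) (h29 : ∀ x, m 29 x = 0) :
    ∀ x < N, computeDegrees.den m 29 x = ∑ y ∈ range N, g x y := by
  have := den_loop (a := 30) (p := .loop 31
    (.write 29 (.var 30) (.add (.read 29 (.var 30)) (.read 1 (entry 30 31))))) (m := m) (by decide)
    (fun i m' => ∀ x < N, m' 29 x = if x < i then ∑ y ∈ range N, g x y else 0) ?_ ?_
  · rw [hm.size] at this
    intro x hx
    rw [computeDegrees, this x hx, if_pos hx]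
  · intro x hx
    rw [setCell_of_ne _ _ _ (by decide), h29]
    simp
  · intro i m' hi hI hi' hfr
    rw [hm.size] at hi
    rw [setCell_of_ne _ _ _ (by decide)]
    have hm' := hm.congr (hfr 0 (by decide)) (hfr 1 (by decide)) (hfr 5 (by decide))
    have := den_loop (a := 31)
      (p := .write 29 (.var 30) (.add (.read 29 (.var 30)) (.read 1 (entry 30 31)))) (m := m')
      (by decide) (fun j m'' => m'' 29 = Function.update (m' 29) i (∑ y ∈ range j, g i y)) ?_ ?_
    · rw [hm'.size] at this
      intro x hx
      rw [this, Function.update_apply, hI x hx]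
      by_cases hxi : x = i
      · simp [hxi]
      · rw [if_neg hxi]
        exact if_congr (by omega) rfl rfl
    · rw [setCell_of_ne _ _ _ (by decide)]
      have := hI i hi
      rw [if_neg (lt_irrefl i)] at this
      rw [sum_range_zero]
      funext z
      by_cases hz : z = i
      · rw [hz, this, Function.update_self]
      · rw [Function.update_of_ne hz]
    · intro j m'' hj hJ hj' hfr'
      rw [hm'.size] at hj
      have hm'' := hm'.congr (hfr' 0 (by decide)) (hfr' 1 (by decide)) (hfr' 5 (by decide))
      have h30 : m'' 30 0 = i := by rw [hfr' 30 (by decide), hi']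
      rw [setCell_of_ne _ _ _ (by decide), den_write]
      simp [setCell, entry, h30, hj', hm''.offset i hi, hm''.matrix i hi j hj, hJ, sum_range_succ]

open Classical in
theorem den_computeSpan (hN : 2 ≤ N) {m : Memory} (hm : HasMatrix N g m) :
    ∀ z < N, computeSpan.den m 23 z =
      if InSpan N g (m 20 0) (m 21 0) (m 22 0) z then 1 else 0 := by
  have := den_loop (a := 36) (p := .seq orientationTest (.write 23 (.var 36) (.var 9))) (m := m)
    (by decide) (fun i m' => ∀ z < i, m' 23 z =
      if InSpan N g (m 20 0) (m 21 0) (m 22 0) z then 1 else 0) (by simp) ?_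
  · rwa [hm.size] at this
  · intro i m' hi hI hi' hfr
    have hm' := hm.congr (hfr 0 (by decide)) (hfr 1 (by decide)) (hfr 5 (by decide))
    have h36 : orientationTest.den m' 36 0 = i := by rw [den_frame _ _ (by decide), hi']
    have h23 : orientationTest.den m' 23 = m' 23 := den_frame _ _ (by decide)
    have h9 := den_orientationTest hN hm'
    rw [hfr 20 (by decide), hfr 21 (by decide), hfr 22 (by decide), hi'] at h9
    intro z hz
    rw [setCell_of_ne _ _ _ (by decide), den_seq, den_write, setCell_apply, h23]
    simp only [Expr.eval_var, h36, true_and]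
    rcases Nat.lt_succ_iff_lt_or_eq.1 hz with h | rfl
    · rw [if_neg h.ne, hI z h]
    · rw [if_pos rfl, h9]
      rfl

open Classical in
theorem den_computeSpanOf (hN : 2 ≤ N) {m : Memory} (hm : HasMatrix N g m) {src x y : ℕ}
    (hx : x ≠ 20 ∧ x ≠ 21) (hy : y ≠ 20 ∧ y ≠ 21 ∧ y ≠ 22) :
    (∀ z < N, (computeSpanOf src x y).den m 23 z =
      if InSpan N g (m src 0) (m x 0) (m y 0) z then 1 else 0) ∧
    (computeSpanOf src x y).den m 21 0 = m x 0 ∧ (computeSpanOf src x y).den m 22 0 = m y 0 := by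
  have key : ∃ m₁, (computeSpanOf src x y).den m = computeSpan.den m₁ ∧ HasMatrix N g m₁ ∧
      m₁ 20 0 = m src 0 ∧ m₁ 21 0 = m x 0 ∧ m₁ 22 0 = m y 0 := by
    refine ⟨_, rfl, hm.congr ?_ ?_ ?_, ?_, ?_, ?_⟩ <;>
      simp [den_write, hx, hy, setCell]
  obtain ⟨m₁, h1, h2, h3, h4, h5⟩ := key
  rw [h1]
  refine ⟨fun z hz => ?_, ?_, ?_⟩
  · rw [den_computeSpan hN h2 z hz, h3, h4, h5]
  · rw [den_frame _ _ (by decide), h4]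
  · rw [den_frame _ _ (by decide), h5]

open Classical in
theorem den_checkSpan {m : Memory} (hN : m 0 0 = N) :
    checkSpan.den m 24 0 = if ∀ z < N, z ≠ m 40 0 → m 23 z ≠ 0 then 1 else 0 := by
  rw [checkSpan, den_seq]
  set m₁ := (Stmt.write 24 (.lit 0) (.lit 1)).den m with hm₁
  have e0 : m₁ 0 = m 0 := den_frame _ _ (by decide)
  have e23 : m₁ 23 = m 23 := den_frame _ _ (by decide)
  have e40 : m₁ 40 = m 40 := den_frame _ _ (by decide)
  have := den_loop (a := 44)
    (p := .cond (.and (.ne (.var 44) (.var 40)) (.not (.read 23 (.var 44))))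
      (.write 24 (.lit 0) (.lit 0)) .skip) (m := m₁) (by decide)
    (fun i m' => m' 24 0 = if ∀ z < i, z ≠ m 40 0 → m 23 z ≠ 0 then 1 else 0) ?_ ?_
  · rwa [e0, hN] at this
  · simp [hm₁, den_write, setCell_apply]
  · intro i m' hi hI hi' hfr
    have h23 : m' 23 = m 23 := by rw [hfr 23 (by decide), e23]
    have h40 : m' 40 = m 40 := by rw [hfr 40 (by decide), e40]
    rw [setCell_of_ne _ _ _ (by decide)]
    by_cases hc : i ≠ m 40 0 ∧ m 23 i = 0
    · rw [den_cond_pos (by simpa [hi', h23, h40] using hc),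
        if_neg (fun h => h i (by omega) hc.1 hc.2)]
      simp [den_write, setCell_apply]
    · rw [den_cond_neg (by simpa [hi', h23, h40] using hc)]
      simp only [Stmt.den, id, hI]
      refine if_congr ⟨fun h z hz hz' => ?_, fun h z hz => h z (by omega)⟩ rfl rfl
      rcases Nat.lt_succ_iff_lt_or_eq.1 hz with hz | rfl
      · exact h z hz hz'
      · exact fun h0 => hc ⟨hz', h0⟩

/-- The property of the vertices `v`, `a`, `b`, `w` that the program tests. -/
structure IsCandidate (N : ℕ) (g : ℕ → ℕ → ℕ) (v a b w : ℕ) : Prop where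
  lt : v < N ∧ a < N ∧ b < N ∧ w < N
  deg_left : ∑ y ∈ range N, g v y = 3
  deg_right : ∑ y ∈ range N, g w y = 3
  ne : v ≠ w
  not_adj : g v w = 0
  ne_ab : a ≠ b
  ne_av : a ≠ v
  ne_bv : b ≠ v
  ne_aw : a ≠ w
  ne_bw : b ≠ w
  span : ∀ z < N, z ≠ v → InSpan N g v a b z

/-- The memory contains the graph and its degrees. -/
structure HasDegrees (N : ℕ) (g : ℕ → ℕ → ℕ) (m : Memory) : Prop extends HasMatrix N g m where
  degrees : ∀ x < N, m 29 x = ∑ y ∈ range N, g x y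

theorem HasDegrees.congr {m m' : Memory} (h : HasDegrees N g m) (h0 : m' 0 = m 0)
    (h1 : m' 1 = m 1) (h5 : m' 5 = m 5) (h29 : m' 29 = m 29) : HasDegrees N g m' :=
  ⟨h.toHasMatrix.congr h0 h1 h5, by rw [h29]; exact h.degrees⟩

/-- A candidate has been saved. -/
def Found (N : ℕ) (g : ℕ → ℕ → ℕ) (m : Memory) : Prop :=
  IsCandidate N g (m 25 0) (m 26 0) (m 27 0) (m 28 0)

theorem den_saveCandidate (m : Memory) :
    saveCandidate.den m 25 0 = m 40 0 ∧ saveCandidate.den m 26 0 = m 41 0 ∧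
      saveCandidate.den m 27 0 = m 42 0 ∧ saveCandidate.den m 28 0 = m 43 0 := by
  simp [saveCandidate, Stmt.den, setCell_apply]

/-- A saved candidate is overwritten only by another candidate, so success is never lost. -/
theorem den_tryCandidate (hN : 2 ≤ N) {m : Memory} (hm : HasDegrees N g m)
    (hlt : m 40 0 < N ∧ m 41 0 < N ∧ m 42 0 < N ∧ m 43 0 < N)
    (h : Found N g m ∨ IsCandidate N g (m 40 0) (m 41 0) (m 42 0) (m 43 0)) :
    Found N g (tryCandidate.den m) := by
  classical
  obtain ⟨s1, -, -⟩ := den_computeSpanOf hN hm.toHasMatrix (src := 40) (x := 41) (y := 42)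
    (by decide) (by decide)
  rw [tryCandidate, den_seq, den_seq]
  set m₁ := (computeSpanOf 40 41 42).den m with hm₁
  have f1 : ∀ k, k ∉ (computeSpanOf 40 41 42).writes → m₁ k = m k := fun k hk => den_frame _ _ hk
  have c1 := den_checkSpan (m := m₁) (N := N) (by rw [f1 0 (by decide), hm.size])
  set m₂ := checkSpan.den m₁ with hm₂
  have f2 : ∀ k, k ∉ (computeSpanOf 40 41 42).writes → k ∉ checkSpan.writes → m₂ k = m k :=
    fun k h1 h2 => (den_frame _ _ h2).trans (f1 k h1)
  have e25 := f2 25 (by decide) (by decide)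
  have e26 := f2 26 (by decide) (by decide)
  have e27 := f2 27 (by decide) (by decide)
  have e28 := f2 28 (by decide) (by decide)
  have e29 := f2 29 (by decide) (by decide)
  have e40 := f2 40 (by decide) (by decide)
  have e41 := f2 41 (by decide) (by decide)
  have e42 := f2 42 (by decide) (by decide)
  have e43 := f2 43 (by decide) (by decide)
  have e1 := f2 1 (by decide) (by decide)
  have e5 := f2 5 (by decide) (by decide)
  obtain ⟨l1, l2, l3, l4⟩ := hlt
  have hspan : (∀ z < N, z ≠ m₁ 40 0 → m₁ 23 z ≠ 0) ↔
      ∀ z < N, z ≠ m 40 0 → InSpan N g (m 40 0) (m 41 0) (m 42 0) z := by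
    rw [f1 40 (by decide)]
    refine forall₂_congr fun z hz => imp_congr_right fun _ => ?_
    rw [s1 z hz]
    simp
  have htest : candidateTest.eval m₂ ≠ 0 ↔
      IsCandidate N g (m 40 0) (m 41 0) (m 42 0) (m 43 0) := by
    have h24 : m₂ 24 0 ≠ 0 ↔ ∀ z < N, z ≠ m 40 0 → InSpan N g (m 40 0) (m 41 0) (m 42 0) z := by
      rw [c1, ← hspan]
      simp
    simp only [candidateTest, entry, ne_eq, Expr.eval_and, Expr.eval_var, Expr.eval_not,
      Expr.eval_ne, Expr.eval_read, Expr.eval_lit, Expr.eval_add, not_not, e29, e40, e41, e42, e43,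
      e1, e5, hm.degrees _ l1, hm.degrees _ l4, hm.offset _ l1, hm.matrix _ l1 _ l4]
    constructor
    · rintro ⟨t1, t2, t3, t4, t5, t6, t7, t8, t9, t10⟩
      exact ⟨⟨l1, l2, l3, l4⟩, t2, t3, t4, t5, t6, t7, t8, t9, t10, h24.1 t1⟩
    · intro t
      exact ⟨h24.2 t.span, t.deg_left, t.deg_right, t.ne, t.not_adj, t.ne_ab, t.ne_av, t.ne_bv,
        t.ne_aw, t.ne_bw⟩
  by_cases hc : IsCandidate N g (m 40 0) (m 41 0) (m 42 0) (m 43 0)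
  · rw [den_cond_pos (htest.2 hc)]
    obtain ⟨d1, d2, d3, d4⟩ := den_saveCandidate m₂
    unfold Found
    rw [d1, d2, d3, d4, e40, e41, e42, e43]
    exact hc
  · rw [den_cond_neg (fun h => hc (htest.1 h))]
    have := h.resolve_right hc
    unfold Found at this ⊢
    simp only [Stmt.den, id]
    rwa [e25, e26, e27, e28]

/-- The rule for one level of the nested search. `G i` says that index `i` leads to a candidate and
`L` bounds the outer counters; both depend only on arrays that the loop leaves alone. -/
theorem den_searchLoop {a : ℕ} {p : Stmt} (hwf : (Stmt.loop a p).wf)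
    (ha : ∀ b ∈ [0, 1, 5, 29, 25, 26, 27, 28], b ≠ a)
    (hwr : ∀ b ∈ [0, 1, 5, 29], b ∉ p.writes) {G : ℕ → Memory → Prop}
    (hG : ∀ i m m', (∀ k, k ∉ (Stmt.loop a p).writes → m' k = m k) → G i m → G i m')
    {L : Memory → Prop}
    (hL : ∀ m m', (∀ k, k ∉ (Stmt.loop a p).writes → m' k = m k) → L m → L m')
    (hp : ∀ m, HasDegrees N g m → L m → m a 0 < N → Found N g m ∨ G (m a 0) m →
      Found N g (p.den m)) {m : Memory}
    (hm : HasDegrees N g m) (hLm : L m) (h : Found N g m ∨ ∃ i < N, G i m) :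
    Found N g ((Stmt.loop a p).den m) := by
  have hfound : ∀ (m : Memory) v, Found N g (setCell m a 0 v) ↔ Found N g m := by
    intro m v
    unfold Found
    rw [setCell_of_ne _ _ _ (ha 25 (by decide)), setCell_of_ne _ _ _ (ha 26 (by decide)),
      setCell_of_ne _ _ _ (ha 27 (by decide)), setCell_of_ne _ _ _ (ha 28 (by decide))]
  -- Either a candidate is saved, or a good index is still to come.
  have := den_loop (m := m) hwf (fun i m' => Found N g m' ∨ ∃ j, i ≤ j ∧ j < N ∧ G j m) ?_ ?_
  · rw [hm.size] at this
    rcases this with h | ⟨j, h1, h2, -⟩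
    · exact h
    · omega
  · rw [hfound]
    exact h.imp_right fun ⟨i, hi, hG⟩ => ⟨i, Nat.zero_le i, hi, hG⟩
  · intro i m' hi hI hi' hfr
    rw [hm.size] at hi
    rw [hfound]
    have hw : ∀ b ∈ [0, 1, 5, 29], b ∉ (Stmt.loop a p).writes := by
      intro b hb
      simp only [writes, List.mem_cons, not_or]
      exact ⟨ha b (by fin_cases hb <;> decide), hwr b hb⟩
    have hm' := hm.congr (hfr 0 (hw 0 (by decide))) (hfr 1 (hw 1 (by decide)))
      (hfr 5 (hw 5 (by decide))) (hfr 29 (hw 29 (by decide)))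
    have key := hp m' hm' (hL m m' hfr hLm) (by omega)
    rw [hi'] at key
    rcases hI with h | ⟨j, h1, h2, h3⟩
    · exact Or.inl (key (Or.inl h))
    · rcases Nat.eq_or_lt_of_le h1 with rfl | h1
      · exact Or.inl (key (Or.inr (hG _ m m' hfr h3)))
      · exact Or.inr ⟨j, h1, h2, h3⟩

theorem den_search (hN : 2 ≤ N) {m : Memory} (hm : HasDegrees N g m)
    (h : ∃ v a b w, IsCandidate N g v a b w) : Found N g (search.den m) := by
  obtain ⟨v, a, b, w, h⟩ := h
  have s1 : ∀ m : Memory, HasDegrees N g m → (m 40 0 < N ∧ m 41 0 < N ∧ m 42 0 < N) →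
      (Found N g m ∨ ∃ w < N, IsCandidate N g (m 40 0) (m 41 0) (m 42 0) w) →
      Found N g ((Stmt.loop 43 tryCandidate).den m) := by
    intro m hm hL h
    refine den_searchLoop (by decide) (by decide) (by decide)
      (G := fun w m => IsCandidate N g (m 40 0) (m 41 0) (m 42 0) w) (fun i m m' hfr hG => ?_)
      (L := fun m => m 40 0 < N ∧ m 41 0 < N ∧ m 42 0 < N) (fun m m' hfr hL => ?_)
      (fun m hm hL hlt h => den_tryCandidate hN hm ⟨hL.1, hL.2.1, hL.2.2, hlt⟩ h) hm hL h
    all_goals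
      rw [hfr 40 (by decide), hfr 41 (by decide), hfr 42 (by decide)]
      assumption
  have s2 : ∀ m : Memory, HasDegrees N g m → (m 40 0 < N ∧ m 41 0 < N) →
      (Found N g m ∨ ∃ b < N, ∃ w < N, IsCandidate N g (m 40 0) (m 41 0) b w) →
      Found N g ((Stmt.loop 42 (Stmt.loop 43 tryCandidate)).den m) := by
    intro m hm hL h
    refine den_searchLoop (by decide) (by decide) (by decide)
      (G := fun b m => ∃ w < N, IsCandidate N g (m 40 0) (m 41 0) b w) (fun i m m' hfr hG => ?_)
      (L := fun m => m 40 0 < N ∧ m 41 0 < N) (fun m m' hfr hL => ?_)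
      (fun m hm hL hlt h => s1 m hm ⟨hL.1, hL.2, hlt⟩ h) hm hL h
    all_goals
      rw [hfr 40 (by decide), hfr 41 (by decide)]
      assumption
  have s3 : ∀ m : Memory, HasDegrees N g m → m 40 0 < N →
      (Found N g m ∨ ∃ a < N, ∃ b < N, ∃ w < N, IsCandidate N g (m 40 0) a b w) →
      Found N g ((Stmt.loop 41 (Stmt.loop 42 (Stmt.loop 43 tryCandidate))).den m) := by
    intro m hm hL h
    refine den_searchLoop (by decide) (by decide) (by decide)
      (G := fun a m => ∃ b < N, ∃ w < N, IsCandidate N g (m 40 0) a b w) (fun i m m' hfr hG => ?_)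
      (L := fun m => m 40 0 < N) (fun m m' hfr hL => ?_)
      (fun m hm hL hlt h => s2 m hm ⟨hL, hlt⟩ h) hm hL h
    all_goals
      rw [hfr 40 (by decide)]
      assumption
  obtain ⟨h1, h2, h3, h4⟩ := h.lt
  exact den_searchLoop (by decide) (by decide) (by decide)
    (G := fun v _ => ∃ a < N, ∃ b < N, ∃ w < N, IsCandidate N g v a b w) (fun _ _ _ _ h => h)
    (L := fun _ => True) (fun _ _ _ h => h) (fun m hm _ hlt h => s3 m hm hlt h) hm trivial
    (Or.inr ⟨v, h1, a, h2, b, h3, w, h4, h⟩)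

open Classical in
theorem den_outputMatrix {dst : ℕ} (hd : dst = 2 ∨ dst = 3) {m : Memory} (hm : HasMatrix N g m) :
    ∀ p < N, ∀ q < N, (outputMatrix dst).den m dst (p * N + q) =
      if (g p q ≠ 0 ∧ m 23 p ≠ 0 ∧ m 23 q ≠ 0) ∨ (p = m 21 0 ∧ q = m 22 0) ∨
        (p = m 22 0 ∧ q = m 21 0) then 1 else 0 := by
  set val : ℕ → ℕ → ℕ := fun p q => if (g p q ≠ 0 ∧ m 23 p ≠ 0 ∧ m 23 q ≠ 0) ∨
    (p = m 21 0 ∧ q = m 22 0) ∨ (p = m 22 0 ∧ q = m 21 0) then 1 else 0 with hval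
  have hd30 : dst ≠ 30 := by omega
  have hd31 : dst ≠ 31 := by omega
  have entryStep : ∀ (m' : Memory) (x y : ℕ), x < N → y < N → HasMatrix N g m' → m' 23 = m 23 →
      m' 21 = m 21 → m' 22 = m 22 → m' 30 0 = x → m' 31 0 = y →
      (outputEntry dst).den m' dst = Function.update (m' dst) (x * N + y) (val x y) := by
    intro m' x y hx hy hm' h23 h21 h22 h30 h31
    have ho := hm'.offset x hx
    have hg := hm'.matrix x hx y hy
    have htest : outputTest.eval m' = 0 ↔ ¬ ((g x y ≠ 0 ∧ m 23 x ≠ 0 ∧ m 23 y ≠ 0) ∨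
        (x = m 21 0 ∧ y = m 22 0) ∨ (x = m 22 0 ∧ y = m 21 0)) := by
      simp only [outputTest, entry, ne_eq, Expr.eval_add, Nat.add_eq_zero_iff, Expr.eval_and,
        Expr.eval_read, Expr.eval_var, Expr.eval_not, Expr.eval_ne, h30, h31, h23, h21, h22, ho, hg]
      tauto
    unfold outputEntry
    by_cases hc : outputTest.eval m' = 0
    · rw [den_cond_neg (not_not.2 hc), den_write]
      have : val x y = 0 := if_neg (htest.1 hc)
      simp [setCell, entry, h30, h31, ho, this]
    · rw [den_cond_pos hc, den_write]
      have : val x y = 1 := if_pos (by rw [htest] at hc; exact not_not.1 hc)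
      simp [setCell, entry, h30, h31, ho, this]
  have := den_loop (a := 30) (p := .loop 31 (outputEntry dst)) (m := m)
    (by rcases hd with rfl | rfl <;> decide)
    (fun i m' => ∀ p < N, ∀ q < N, p < i → m' dst (p * N + q) = val p q) (by simp) ?_
  · rw [hm.size] at this
    exact fun p hp q hq => this p hp q hq hp
  · intro x m' hx hI hmx hfr
    rw [hm.size] at hx
    rw [setCell_of_ne _ _ _ hd30]
    have fr : ∀ k ∈ [0, 1, 5, 21, 22, 23], m' k = m k := fun k hk =>
      hfr k (by rcases hd with rfl | rfl <;> revert k <;> decide)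
    have hm' := hm.congr (fr 0 (by decide)) (fr 1 (by decide)) (fr 5 (by decide))
    have := den_loop (a := 31) (p := outputEntry dst) (m := m')
      (by rcases hd with rfl | rfl <;> decide)
      (fun j m'' => ∀ p < N, ∀ q < N, (p < x ∨ p = x ∧ q < j) → m'' dst (p * N + q) = val p q) ?_ ?_
    · rw [hm'.size] at this
      intro p hp q hq hpx
      exact this p hp q hq (by omega)
    · intro p hp q hq hpq
      rw [setCell_of_ne _ _ _ hd31]
      exact hI p hp q hq (by omega)
    · intro y m'' hy hJ hmy hfr'
      rw [hm'.size] at hy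
      have fr' : ∀ k ∈ [0, 1, 5, 21, 22, 23, 30], m'' k = m' k := fun k hk =>
        hfr' k (by rcases hd with rfl | rfl <;> revert k <;> decide)
      have hm'' := hm'.congr (fr' 0 (by decide)) (fr' 1 (by decide)) (fr' 5 (by decide))
      intro p hp q hq hpq
      rw [setCell_of_ne _ _ _ hd31, entryStep m'' x y hx hy hm''
        ((fr' 23 (by decide)).trans (fr 23 (by decide)))
        ((fr' 21 (by decide)).trans (fr 21 (by decide)))
        ((fr' 22 (by decide)).trans (fr 22 (by decide)))
        (by rw [fr' 30 (by decide), hmx]) hmy, Function.update_apply,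
        if_congr (entry_inj hy hq) rfl rfl]
      split_ifs with h
      · rw [h.1, h.2]
      · exact hJ p hp q hq (by omega)

/-- The matrix entry `g p q` belongs to the circuit that avoids `d` and contains the
edge `s(a, b)`. -/
def InCircuit (N : ℕ) (g : ℕ → ℕ → ℕ) (d a b p q : ℕ) : Prop :=
  (g p q ≠ 0 ∧ InSpan N g d a b p ∧ InSpan N g d a b q) ∨ (p = a ∧ q = b) ∨ (p = b ∧ q = a)

open Classical in
theorem den_outputMatrix_computeSpanOf (hN : 2 ≤ N) {m : Memory} (hm : HasMatrix N g m)
    {src dst : ℕ} (hd : dst = 2 ∨ dst = 3) :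
    ∀ p < N, ∀ q < N,
      (outputMatrix dst).den ((computeSpanOf src 26 27).den m) dst (p * N + q) =
        if InCircuit N g (m src 0) (m 26 0) (m 27 0) p q then 1 else 0 := by
  intro p hp q hq
  obtain ⟨h23, h21, h22⟩ := den_computeSpanOf hN hm (src := src) (x := 26) (y := 27) (by decide)
    (by decide)
  have fr : ∀ k ∈ [0, 1, 5], (computeSpanOf src 26 27).den m k = m k := fun k hk =>
    den_frame _ _ (by revert k; simp only [computeSpanOf, writes]; decide)
  rw [den_outputMatrix hd (hm.congr (fr 0 (by decide)) (fr 1 (by decide)) (fr 5 (by decide)))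
    p hp q hq, h23 p hp, h23 q hq, h21, h22]
  exact if_congr (by simp [InCircuit]) rfl rfl

-- Existence of a candidate only guarantees that the search succeeds; the output belongs to
-- whichever candidate was saved last.
open Classical in
theorem den_decompose (hN : 2 ≤ N) {m : Memory} (h0 : m 0 0 = N)
    (hmat : ∀ x < N, ∀ y < N, m 1 (x * N + y) = g x y)
    (hsymm : ∀ x < N, ∀ y < N, g x y = g y x) (hloop : ∀ x < N, g x x = 0)
    (hle : ∀ x < N, ∀ y < N, g x y ≤ 1) (h5 : m 5 0 = 0) (h29 : ∀ x, m 29 x = 0)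
    (h : ∃ v a b w, IsCandidate N g v a b w) :
    ∃ v a b w, IsCandidate N g v a b w ∧ decompose.den m 4 0 = a ∧ decompose.den m 4 1 = b ∧
      (∀ p < N, ∀ q < N, decompose.den m 2 (p * N + q) =
        if InCircuit N g v a b p q then 1 else 0) ∧
      ∀ p < N, ∀ q < N, decompose.den m 3 (p * N + q) =
        if InCircuit N g w a b p q then 1 else 0 := by
  simp only [decompose, den_seq]
  set m₁ := computeOffsets.den m with hm₁
  have hM₁ : HasMatrix N g m₁ :=
    ⟨den_computeOffsets h0 h5, by rw [hm₁, den_frame _ _ (by decide)]; exact hmat, hsymm, hloop,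
      hle⟩
  set m₂ := computeDegrees.den m₁ with hm₂
  have hM₂ : HasDegrees N g m₂ :=
    ⟨hM₁.congr (den_frame _ _ (by decide)) (den_frame _ _ (by decide)) (den_frame _ _ (by decide)),
      den_computeDegrees hM₁ (by rw [hm₁, den_frame _ _ (by decide)]; exact h29)⟩
  have hf := den_search hN hM₂ h
  set m₃ := search.den m₂ with hm₃
  have hM₃ : HasMatrix N g m₃ := hM₂.toHasMatrix.congr
    (den_frame _ _ (by decide)) (den_frame _ _ (by decide)) (den_frame _ _ (by decide))
  have o₂ := den_outputMatrix_computeSpanOf hN hM₃ (src := 25) (Or.inl rfl)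
  set m₄ := (outputMatrix 2).den ((computeSpanOf 25 26 27).den m₃) with hm₄
  have f₄ : ∀ k ∈ [0, 1, 5, 25, 26, 27, 28], m₄ k = m₃ k := fun k hk => by
    rw [hm₄, den_frame _ _ (by revert k; decide), den_frame _ _ (by revert k; decide)]
  have hM₄ : HasMatrix N g m₄ :=
    hM₃.congr (f₄ 0 (by decide)) (f₄ 1 (by decide)) (f₄ 5 (by decide))
  have o₃ := den_outputMatrix_computeSpanOf hN hM₄ (src := 28) (Or.inr rfl)
  rw [f₄ 26 (by decide), f₄ 27 (by decide), f₄ 28 (by decide)] at o₃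
  set m₅ := (outputMatrix 3).den ((computeSpanOf 28 26 27).den m₄) with hm₅
  have f₅ : ∀ k ∈ [2, 25, 26, 27], m₅ k = m₄ k := fun k hk => by
    rw [hm₅, den_frame _ _ (by revert k; decide), den_frame _ _ (by revert k; decide)]
  refine ⟨m₃ 25 0, m₃ 26 0, m₃ 27 0, m₃ 28 0, hf, ?_, ?_, fun p hp q hq => ?_,
    fun p hp q hq => ?_⟩
  · simp [den_write, setCell_apply, f₅ 26 (by decide), f₄ 26 (by decide)]
  · simp [den_write, setCell_apply, f₅ 27 (by decide), f₄ 27 (by decide)]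
  · rw [den_frame _ _ (by decide), den_frame _ _ (by decide), f₅ 2 (by decide), o₂ p hp q hq]
  · rw [den_frame _ _ (by decide), den_frame _ _ (by decide), o₃ p hp q hq]

end Decompose

/-! ### Numbered graphs -/

section Numbering

variable {V : Type*} [Fintype V] [DecidableEq V] {N : ℕ} (num : V ≃ Fin N) {C : Graph V}

/-- The number of a vertex. -/
def number : V ↪ ℕ := num.toEmbedding.trans Fin.valEmbedding

theorem number_lt (x : V) : number num x < N := (num x).2

theorem exists_number {k : ℕ} (hk : k < N) : ∃ x, number num x = k :=
  ⟨num.symm ⟨k, hk⟩, by simp [number]⟩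

theorem map_number_univ : Finset.univ.map (number num) = Finset.range N := by
  ext k
  simp only [Finset.mem_map, Finset.mem_univ, true_and, Finset.mem_range]
  exact ⟨fun ⟨x, hx⟩ => hx ▸ number_lt num x, exists_number num⟩

theorem exists_map_number {S : Finset ℕ} (hS : S ⊆ Finset.range N) :
    ∃ X : Finset V, X.map (number num) = S := by
  refine ⟨Finset.univ.filter fun x => number num x ∈ S, ?_⟩
  ext k
  simp only [Finset.mem_map, Finset.mem_filter, Finset.mem_univ, true_and]
  constructor
  · rintro ⟨x, hx, rfl⟩
    exact hx
  · intro hk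
    obtain ⟨x, rfl⟩ := exists_number num (Finset.mem_range.1 (hS hk))
    exact ⟨x, hk, rfl⟩

open Classical in
theorem adjArray_number (G : Graph V) (x y : V) :
    adjArray num G (number num x * N + number num y) = if G.Adj x y then 1 else 0 := by
  by_cases h : G.Adj x y
  · rw [if_pos h]
    exact if_pos ⟨x, y, h, rfl⟩
  · rw [if_neg h]
    refine if_neg ?_
    rintro ⟨x', y', h', he⟩
    obtain ⟨h1, h2⟩ := (entry_inj (number_lt num y') (number_lt num y)).1 he
    rw [(number num).injective h1, (number num).injective h2] at h
    exact h h'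

/-- The adjacency matrix. -/
noncomputable def matrixOf (C : Graph V) (p q : ℕ) : ℕ := adjArray num C (p * N + q)

theorem cast_matrixOf (x y : V) :
    (matrixOf num C (number num x) (number num y) : ℤ) = adjInd C x y := by
  rw [matrixOf, adjArray_number, adjInd]
  push_cast
  rfl

theorem matrixOf_eq_zero {x y : V} :
    matrixOf num C (number num x) (number num y) = 0 ↔ ¬ C.Adj x y := by
  rw [matrixOf, adjArray_number]
  simp

theorem cast_sum_matrixOf (x : V) :
    ((∑ q ∈ Finset.range N, matrixOf num C (number num x) q : ℕ) : ℤ) = deg C x := by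
  rw [← map_number_univ num, Finset.sum_map]
  push_cast
  simp only [cast_matrixOf, deg, between, Finset.sum_singleton]

/-- The deleted vertices `c` and `z` contribute no edges to Hall's condition, so it suffices to
consider sets that avoid them. The loads at `a` and `b` use up exactly their share of the capacity,
which leaves `4|X \ {a, b}|`. -/
theorem inSpan_iff {c a b z : V} :
    InSpan N (matrixOf num C) (number num c) (number num a) (number num b) (number num z) ↔
      z ∈ spanSet C c a b := by
  have hcount : ∀ X : Finset V,
      ((∑ p ∈ X.map (number num), ∑ q ∈ X.map (number num),
          deleteTwo (matrixOf num C) (number num c) (number num z) p q : ℕ) : ℤ) =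
        inner C (X \ {c, z}) := by
    intro X
    simp only [Finset.sum_map]
    push_cast
    have h1 : X \ {c, z} = X.filter fun x => x ≠ c ∧ x ≠ z := by
      ext x
      simp
    unfold inner between
    rw [h1, Finset.sum_filter]
    refine Finset.sum_congr rfl fun x _ => ?_
    rw [Finset.sum_filter]
    split_ifs with hx
    · refine Finset.sum_congr rfl fun y _ => ?_
      simp only [deleteTwo, (number num).injective.ne_iff, ← cast_matrixOf num, hx.1, hx.2,
        ne_eq, not_false_eq_true, true_and]
      split_ifs <;> rfl
    · refine Finset.sum_eq_zero fun y _ => ?_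
      rw [deleteTwo, if_neg]
      · rfl
      · simp only [ne_eq, (number num).injective.eq_iff]
        tauto
  have hpin : ∀ X : Finset V,
      ∑ p ∈ X.map (number num), pinned (number num a) (number num b) p =
        2 * (X ∩ {a, b}).card := by
    intro X
    have h1 : X ∩ {a, b} = X.filter fun x => ¬ (x ≠ a ∧ x ≠ b) := by
      ext x
      simp only [Finset.mem_inter, Finset.mem_insert, Finset.mem_singleton, Finset.mem_filter]
      tauto
    rw [Finset.sum_map, h1, Finset.card_filter, Finset.mul_sum]
    refine Finset.sum_congr rfl fun x _ => ?_
    simp only [pinned, ne_eq, (number num).injective.eq_iff]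
    split_ifs <;> simp_all
  have hiff : InSpan N (matrixOf num C) (number num c) (number num a) (number num b)
      (number num z) ↔ ∀ X : Finset V, inner C (X \ {c, z}) ≤ 4 * ((X \ {a, b}).card : ℤ) := by
    have hX : ∀ X : Finset V, (∑ p ∈ X.map (number num), ∑ q ∈ X.map (number num),
          deleteTwo (matrixOf num C) (number num c) (number num z) p q) +
          2 * (∑ p ∈ X.map (number num), pinned (number num a) (number num b) p) ≤
            4 * (X.map (number num)).card ↔
        inner C (X \ {c, z}) ≤ 4 * ((X \ {a, b}).card : ℤ) := by
      intro X
      rw [← hcount X, hpin X, Finset.card_map]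
      have := Finset.card_sdiff_add_card_inter X {a, b}
      omega
    constructor
    · intro h X
      refine (hX X).1 (h _ ?_)
      rw [← map_number_univ num]
      exact Finset.map_subset_map.2 (Finset.subset_univ X)
    · intro h S hS
      obtain ⟨X, rfl⟩ := exists_map_number num hS
      exact (hX X).2 (h X)
  rw [hiff, mem_spanSet]
  constructor
  · intro h X hc hz
    have := h X
    rwa [Finset.sdiff_eq_self_of_disjoint (by simp [hc, hz])] at this
  · intro h X
    have h1 := h (X \ {c, z}) (by simp) (by simp)
    have h2 := Finset.card_le_card
      (Finset.sdiff_subset_sdiff (Finset.sdiff_subset : X \ {c, z} ⊆ X) (subset_refl {a, b}))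
    omega

/-- Admissibility quantifies over all tight sets, but it only says that the least one is already `V
- v`, and this is what the program can test. -/
theorem isCandidate_iff (hC : CircuitCount C) (hV : 3 ≤ Fintype.card V) {v a b w : V} :
    IsCandidate N (matrixOf num C) (number num v) (number num a) (number num b) (number num w) ↔
      DecompositionVertices C v a b w := by
  have hinj : ∀ x y, number num x ≠ number num y ↔ x ≠ y := fun x y =>
    (number num).injective.ne_iff
  have hdeg : ∀ x, ∑ y ∈ Finset.range N, matrixOf num C (number num x) y = 3 ↔ deg C x = 3 := by
    intro x
    rw [← cast_sum_matrixOf num]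
    norm_cast
  have hspan : (∀ z < N, z ≠ number num v →
      InSpan N (matrixOf num C) (number num v) (number num a) (number num b) z) ↔
        ∀ z, z ≠ v → z ∈ spanSet C v a b := by
    constructor
    · intro h z hz
      exact (inSpan_iff num).1 (h _ (number_lt num z) ((hinj _ _).2 hz))
    · intro h z hz hzv
      obtain ⟨z, rfl⟩ := exists_number num hz
      exact (inSpan_iff num).2 (h z ((hinj _ _).1 hzv))
  have hadm : deg C v = 3 → a ≠ b → a ≠ v → b ≠ v →
      ((∀ z, z ≠ v → z ∈ spanSet C v a b) ↔ Admissible C v a b) := by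
    intro hd hab hav hbv
    obtain ⟨T, hT⟩ := hC.exists_isTightSpan hV hd hab hav hbv
    rw [hC.spanSet_eq hab hav hbv hT]
    constructor
    · intro h X hX hv ha hb
      ext x
      simp only [Finset.mem_compl, Finset.mem_singleton]
      refine ⟨fun hx hxv => hv (hxv ▸ hx), fun hx => hT.subset X hX hv ha hb (h x hx)⟩
    · intro h z hz
      rw [h T hT.tight hT.notMem hT.left_mem hT.right_mem]
      simpa using hz
  constructor
  · intro h
    have hd := (hdeg v).1 h.deg_left
    have hab := (hinj _ _).1 h.ne_ab
    have hav := (hinj _ _).1 h.ne_av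
    have hbv := (hinj _ _).1 h.ne_bv
    exact ⟨hd, (hdeg w).1 h.deg_right, (hinj _ _).1 h.ne, (matrixOf_eq_zero num).1 h.not_adj, hab,
      hav, hbv, (hinj _ _).1 h.ne_aw, (hinj _ _).1 h.ne_bw,
      (hadm hd hab hav hbv).1 (hspan.1 h.span)⟩
  · intro h
    exact ⟨⟨number_lt num v, number_lt num a, number_lt num b, number_lt num w⟩,
      (hdeg v).2 h.deg_left, (hdeg w).2 h.deg_right, (hinj _ _).2 h.ne,
      (matrixOf_eq_zero num).2 h.not_adj, (hinj _ _).2 h.ne_ab, (hinj _ _).2 h.ne_av,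
      (hinj _ _).2 h.ne_bv, (hinj _ _).2 h.ne_aw, (hinj _ _).2 h.ne_bw,
      hspan.2 ((hadm h.deg_left h.ne_ab h.ne_av h.ne_bv).2 h.admissible)⟩

open Classical in
theorem eq_adjArray_spanGraph {c a b : V} (hab : a ≠ b) {f : ℕ → ℕ}
    (hf : ∀ p < N, ∀ q < N, f (p * N + q) =
      if InCircuit N (matrixOf num C) (number num c) (number num a) (number num b) p q
        then 1 else 0) :
    ∀ k < N * N, f k = adjArray num (spanGraph C (spanSet C c a b) a b) k := by
  intro k hk
  have hN : 0 < N := Nat.pos_of_ne_zero (by rintro rfl; simp at hk)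
  obtain ⟨x, hx⟩ := exists_number num ((Nat.div_lt_iff_lt_mul hN).2 hk)
  obtain ⟨y, hy⟩ := exists_number num (Nat.mod_lt k hN)
  have hk' : k = number num x * N + number num y := by
    rw [hx, hy, Nat.div_add_mod']
  rw [hk', hf _ (number_lt num x) _ (number_lt num y), adjArray_number]
  refine if_congr ?_ rfl rfl
  simp only [InCircuit, ne_eq, matrixOf_eq_zero, not_not, inSpan_iff,
    (number num).injective.eq_iff, spanGraph, Finset.mem_coe, Sym2.eq_iff]
  refine or_congr_right ⟨fun h => ⟨?_, h⟩, And.right⟩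
  rcases h with ⟨rfl, rfl⟩ | ⟨rfl, rfl⟩
  exacts [hab, hab.symm]

end Numbering

end CombRes

theorem mainTheorem3 :
    ∃ (P : CombRes.Program) (p : Polynomial ℕ),
      ∀ (V : Type*) (n : ℕ) (num : V ≃ Fin (n + 1)) (C : CombRes.Graph V),
        5 ≤ n + 1 → C.IsSpanning → CombRes.IsCircuit C → CombRes.IsThreeConnected C →
          ∃ (A B : CombRes.Graph V) (u v : V),
            CombRes.IsCircuit A ∧ CombRes.IsCircuit B ∧
            A.verts.ncard = n ∧ B.verts.ncard ≤ n ∧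
            CombRes.IsCombRes C A B s(u, v) ∧
            ∃ (t : ℕ) (m : CombRes.Memory),
              CombRes.Exec P (CombRes.inputMemory num C) t m ∧
              t ≤ p.eval (n + 1) ∧
              CombRes.Outputs num A B u v m := by
  classical
  refine ⟨CombRes.decompose.compile, CombRes.decompose.cost,
    fun V n num C hn hsp hcirc h3 => ?_⟩
  let _ : Fintype V := Fintype.ofEquiv _ num.symm
  have hcard : Fintype.card V = n + 1 := by rw [Fintype.card_congr num, Fintype.card_fin]
  have hC := CombRes.circuitCount_of_isCircuit hsp hcirc
  have hsep := CombRes.noSeparation_of_isThreeConnected hsp h3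
  obtain ⟨v₀, a₀, b₀, w₀, h₀⟩ := hC.exists_decompositionVertices hsep (by omega)
  obtain ⟨t, ht, hexec⟩ := CombRes.Stmt.exec_compile CombRes.decompose (by decide)
    (CombRes.inputMemory num C)
  obtain ⟨v, a, b, w, hcand, h40, h41, h2, h3⟩ := CombRes.den_decompose (N := n + 1)
    (g := CombRes.matrixOf num C) (m := CombRes.inputMemory num C) (by omega) rfl
    (fun _ _ _ _ => rfl)
    (fun x hx y hy => by
      obtain ⟨x, rfl⟩ := CombRes.exists_number num hx
      obtain ⟨y, rfl⟩ := CombRes.exists_number num hy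
      have h1 := CombRes.cast_matrixOf num (C := C) x y
      rw [CombRes.adjInd_comm, ← CombRes.cast_matrixOf num] at h1
      exact_mod_cast h1)
    (fun x hx => by
      obtain ⟨x, rfl⟩ := CombRes.exists_number num hx
      exact (CombRes.matrixOf_eq_zero num).2 fun h => h.ne rfl)
    (fun x hx y hy => by
      unfold CombRes.matrixOf CombRes.adjArray
      split_ifs <;> omega)
    -- Cell `0` of array `5` and the accumulators in array `29` are never cleared, so the zeros of
    -- the input memory matter here.
    rfl (fun _ => rfl) ⟨_, _, _, _, (CombRes.isCandidate_iff num hC (by omega)).2 h₀⟩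
  obtain ⟨v, rfl⟩ := CombRes.exists_number num hcand.lt.1
  obtain ⟨a, rfl⟩ := CombRes.exists_number num hcand.lt.2.1
  obtain ⟨b, rfl⟩ := CombRes.exists_number num hcand.lt.2.2.1
  obtain ⟨w, rfl⟩ := CombRes.exists_number num hcand.lt.2.2.2
  have hdec := (CombRes.isCandidate_iff num hC (by omega)).1 hcand
  have hTv := hC.isTightSpan_compl (by omega) hdec
  obtain ⟨T, hT⟩ := hC.exists_isTightSpan (by omega) hdec.deg_right hdec.ne_ab hdec.ne_aw hdec.ne_bw
  have hadj := hC.not_adj_elimination hdec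
  have hA := CombRes.eq_adjArray_spanGraph num hdec.ne_ab h2
  have hB := CombRes.eq_adjArray_spanGraph num hdec.ne_ab h3
  rw [hC.spanSet_eq hdec.ne_ab hdec.ne_av hdec.ne_bv hTv] at hA
  rw [hC.spanSet_eq hdec.ne_ab hdec.ne_aw hdec.ne_bw hT] at hB
  refine ⟨_, _, a, b, hC.isCircuit_spanGraph hTv hdec.ne_ab hadj,
    hC.isCircuit_spanGraph hT hdec.ne_ab hadj, ?_, ?_, hC.isCombRes hsp (by omega) hdec hT,
    t, _, hexec, ht, hA, hB, h40, h41⟩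
  · rw [CombRes.spanGraph_verts hTv, Set.ncard_coe_finset, Finset.card_compl, hcard,
      Finset.card_singleton, Nat.add_sub_cancel]
  · rw [CombRes.spanGraph_verts hT, Set.ncard_coe_finset]
    have h1 := Finset.card_lt_card (Finset.ssubset_univ_iff.2 hT.tight.ne_univ)
    rw [Finset.card_univ, hcard] at h1
    omega
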